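/- **Setting.** Let $Q=(Q_0,Q_1)$ be a finite quiver (loops and multiple arrows allowed); an arrow $b$ goes from $tb$ to $hb$, and has a variable $t_b$. Let $\Lambda^Q=\bigotimes_{i\in Q_0}\Lambda^{(i)}$ be the tensor power of the ring of symmetric functions over $\mathbb Z[t_b^{\pm1}\mid b\in Q_1]$, with alphabet $X^{(i)}$ at the vertex $i$, and for $f\in\Lambda^Q$ let $f^\perp$ be the adjoint, for the Hall scalar product, of multiplication by $f$. Put $\Omega=\sum_{k\ge0}h_k$, so that $\Omega[zX]=\sum_k z^kh_k[X]$ and $\Omega[-zX]=\Omega[zX]^{-1}$. For $i\in Q_0$, $a\ge1$ the quiver currents $H^{(i,a)}_\beta$ ($\beta\in\mathbb Z^a$) are the operators on $\Lambda^Q$ given by $$\sum_{\beta\in\mathbb Z^a}u^\beta H^{(i,a)}_\beta=\prod_{1\le p<q\le a}\Bigl(1-\frac{u_q}{u_p}\Bigr)\;\prod_{j}\Omega[u_jX^{(i)}]\;\Bigl(\prod_j\Omega[-u_j^{-1}X^{(i)}]\Bigr)^{\perp}\prod_{b:\,tb=i}\Bigl(\prod_j\Omega[t_bu_j^{-1}X^{(hb)}]\Bigr)^{\perp}.$$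 Let $\mathbf i=(i_1,\dots,i_m)$ be vertices, $\mathbf a=(a_1,\dots,a_m)$ positive integers, and $\mu(\bullet)=(\mu(1),\dots,\mu(m))$ with $\mu(k)\in\mathbb Z^{a_k}$ weakly decreasing. The quiver Hall–Littlewood symmetric function is $$H^{\mathbf i,\mathbf a}_{\mu(\bullet)}=H^{(i_1,a_1)}_{\mu(1)}\cdots H^{(i_m,a_m)}_{\mu(m)}\cdot1 .$$ Let $\nu^{(i)}=\sum_{k:\,i_k=i}a_k$. Consider the variables $x(k)_p$ ($1\le k\le m$, $1\le p\le a_k$), ordered lexicographically; those with $i_k=i$, in this order, are also written $x^{(i)}_1,\dots,x^{(i)}_{\nu^{(i)}}$. Weights are integer vectors indexed by these variables; $\mu^\bullet$ is the weight with entries $\mu(k)_p$, $\rho^\bullet$ is $(\nu^{(i)}-1,\dots,1,0)$ at each vertex $i$, and $S^\bullet=\prod_iS_{\nu^{(i)}}$. Let $R_{\mathbf i,\mathbf a}$ be the set of $\alpha=(b,x(k)_p,x(\ell)_q)$ with $k<\ell$, $b\in Q_1$, $tb=i_k$, $hb=i_\ell$; put $t_\alpha=t_b$ and let $\bar\alpha$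 be the exponent of $x(k)_p/x(\ell)_q$. For a dominant weight $\lambda^\bullet$ (weakly decreasing at every vertex) the quiver Kostka–Shoji polynomial is $$\mathcal K^{\mathbf i,\mathbf a}_{\lambda^\bullet,\mu(\bullet)}(t_{Q_1})=\sum_{w\in S^\bullet}(-1)^{w}\sum_{n}\ \prod_{\alpha\in R_{\mathbf i,\mathbf a}}t_\alpha^{n(\alpha)}\in\mathbb Z[t_{Q_1}],$$ where $n$ runs over the (finitely many) maps $R_{\mathbf i,\mathbf a}\to\mathbb Z_{\ge0}$ with $\sum_\alpha n(\alpha)\bar\alpha=w^{-1}(\lambda^\bullet+\rho^\bullet)-(\mu^\bullet+\rho^\bullet)$. Let $J^\bullet=\sum_{w\in S^\bullet}(-1)^ww$, and for a Laurent polynomial $f$ in the $x$-variables (and, coefficientwise, for a power series in the $t_b$ with such coefficients) let $D(f)=J^\bullet(x^{\rho^\bullet})^{-1}J^\bullet(x^{\rho^\bullet}f)$. The quiver Hall–Littlewood series is $$\chi^{\mathbf i,\mathbf a}_{\mu(\bullet)}=D\Bigl(x^{\mu^\bullet}\prod_{\alpha\in R_{\mathbf i,\mathbf a}}(1-t_\alpha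 x^{\bar\alpha})^{-1}\Bigr)\in\mathbb Z[x^{\pm1}][[t_{Q_1}]],$$ and $s_{\lambda^\bullet}(x)=D(x^{\lambda^\bullet})$ is the product over the vertices of the Schur (Laurent) polynomials of $\lambda^{(i)}$. **Theorem 3.1.** Let $\mathbb Y^{Q_0}_{\nu^\bullet}$ be the set of $Q_0$-tuples of partitions $\lambda^\bullet$ such that $\lambda^{(i)}$ has at most $\nu^{(i)}$ rows for all $i$, and let $s_{\lambda^\bullet}[X^\bullet]=\prod_is_{\lambda^{(i)}}[X^{(i)}]$. Then $$H^{\mathbf i,\mathbf a}_{\mu(\bullet)}=\sum_{\lambda^\bullet\in\mathbb Y^{Q_0}_{\nu^\bullet}}\mathcal K^{\mathbf i,\mathbf a}_{\lambda^\bullet,\mu(\bullet)}(t_{Q_1})\,s_{\lambda^\bullet}[X^\bullet].$$ The sum is finite: its coefficients vanish unless $\sum_{k}|\mu(k)|=\sum_{i}|\lambda^{(i)}|$, and only finitely many of them are nonzero. The same polynomials are the coefficients of the series: the quotient defining $\chi^{\mathbf i,\mathbf a}_{\mu(\bullet)}$ is exact and $$\chi^{\mathbf i,\mathbf a}_{\mu(\bullet)}=\sum_{\lambda^\bullet\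 \text{dominant}}\mathcal K^{\mathbf i,\mathbf a}_{\lambda^\bullet,\mu(\bullet)}(t_{Q_1})\,s_{\lambda^\bullet}(x),$$ where for each monomial in the $t_b$ only finitely many $\lambda^\bullet$ contribute. Thus $H^{\mathbf i,\mathbf a}_{\mu(\bullet)}$ is the polynomial truncation of $\chi^{\mathbf i,\mathbf a}_{\mu(\bullet)}$. -/

import Mathlib

open scoped TensorProduct

noncomputable section

namespace QuiverHL

/-! ### Symmetric functions, one alphabet per vertex -/

section SymmetricFunctions

variable {Q₀ R V W : Type*} [CommRing R]

/-- `Λ^Q = ⨂_{i ∈ Q₀} Λ^{(i)}` over `R`, where `Λ = R[h₁, h₂, …]`: the generator `X (i, n)` is the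
complete homogeneous symmetric function `h_{n+1}[X^{(i)}]`. -/
abbrev SymFun (Q₀ R : Type*) [CommRing R] := MvPolynomial (Q₀ × ℕ) R

/-- `h_n[X^{(i)}]` for `n ∈ ℤ`, with `h_0 = 1` and `h_n = 0` for `n < 0`. -/
def h (i : Q₀) : ℤ → SymFun Q₀ R
  | Int.ofNat 0 => 1
  | Int.ofNat (n + 1) => MvPolynomial.X (i, n)
  | Int.negSucc _ => 0

open Classical in
/-- The sum of all monomials of degree `n` in those variables `x_v` (`v : V`) which belong to the
alphabet `X^{(i)}`, i.e. for which `c v = i`. -/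
def hSeries (c : V → Q₀) (i : Q₀) (n : ℕ) : MvPowerSeries V R :=
  fun m => if m.degree = n ∧ ∀ v ∈ m.support, c v = i then 1 else 0

/-- A quiver symmetric function as a formal series in actual variables `x_v` (`v : V`), where the
variables with `c v = i` form the alphabet `X^{(i)}`. -/
def realize (c : V → Q₀) : SymFun Q₀ R →ₐ[R] MvPowerSeries V R :=
  MvPolynomial.aeval fun p => hSeries c p.1 (p.2 + 1)

/-- The monomial in the alphabets `X^{(i)} = {x^{(i)}_{n,j} : n, j ∈ ℕ}` whose exponents at vertex
`i` are the parts of the partition with `s (i, n)` parts equal to `n + 1` for all `n`. -/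
def partitionExponent (s : Q₀ × ℕ →₀ ℕ) : Q₀ × ℕ × ℕ →₀ ℕ :=
  s.sum fun p k => ∑ j ∈ Finset.range k, Finsupp.single (p.1, p.2, j) (p.2 + 1)

/-- The Hall scalar product on `Λ^Q`: products of complete homogeneous functions are dual to products
of monomial symmetric functions. That is, `⟨h_λ, g⟩` is the coefficient of `x^λ` in `g`. -/
def hall : SymFun Q₀ R →ₗ[R] SymFun Q₀ R →ₗ[R] R :=
  (MvPolynomial.basisMonomials (Q₀ × ℕ) R).constr R fun s =>
    (MvPowerSeries.coeff (partitionExponent s)).comp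
      (realize (R := R) (Prod.fst : Q₀ × ℕ × ℕ → Q₀)).toLinearMap

/-- The coproduct `g[X] ↦ g[X + Y]`, i.e. `h_n ↦ ∑ h_j ⊗ h_{n-j}` at every vertex. -/
def coproduct : SymFun Q₀ R →ₐ[R] SymFun Q₀ R ⊗[R] SymFun Q₀ R :=
  MvPolynomial.aeval fun p => ∑ x ∈ Finset.HasAntidiagonal.antidiagonal (p.2 + 1), h p.1 x.1 ⊗ₜ[R] h p.1 x.2

/-- The skewing operator `f^⊥`, adjoint to multiplication by `f` (see `hall_mul_left`). -/
def skew (f : SymFun Q₀ R) : SymFun Q₀ R →ₗ[R] SymFun Q₀ R :=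
  (TensorProduct.lid R (SymFun Q₀ R)).toLinearMap ∘ₗ
    LinearMap.rTensor (SymFun Q₀ R) (hall f) ∘ₗ coproduct.toLinearMap

theorem coeff_hSeries (c : V → Q₀) (i : Q₀) (n : ℕ) (m : V →₀ ℕ)
    [Decidable (m.degree = n ∧ ∀ v ∈ m.support, c v = i)] :
    MvPowerSeries.coeff m (hSeries (R := R) c i n) =
      if m.degree = n ∧ ∀ v ∈ m.support, c v = i then 1 else 0 := by
  rw [MvPowerSeries.coeff_apply]
  unfold hSeries
  congr

theorem degree_embDomain (e : V ↪ W) (m : V →₀ ℕ) : (Finsupp.embDomain e m).degree = m.degree := by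
  simp [Finsupp.degree_apply, Finsupp.support_embDomain]

theorem killCompl_realize (e : V ↪ W) (c : W → Q₀) (g : SymFun Q₀ R) :
    MvPowerSeries.killCompl e (realize c g) = realize (c ∘ e) g := by
  classical
  have : (MvPowerSeries.killCompl e).comp (realize (R := R) c) = realize (c ∘ e) := by
    apply MvPolynomial.algHom_ext
    intro p
    ext m
    simp [realize, MvPowerSeries.coeff_killCompl, coeff_hSeries, degree_embDomain,
      Finsupp.support_embDomain]
  exact DFunLike.congr_fun this g

theorem realize_h (c : V → Q₀) (i : Q₀) (n : ℕ) :
    realize c (h i n : SymFun Q₀ R) = hSeries c i n := by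
  classical
  cases n with
  | zero =>
    have h0 : (h i ((0 : ℕ) : ℤ) : SymFun Q₀ R) = 1 := rfl
    rw [h0, map_one]
    ext m
    rw [coeff_hSeries, MvPowerSeries.coeff_one]
    by_cases hm : m = 0
    · simp [hm]
    · simp [hm, Finsupp.degree_eq_zero_iff]
  | succ n =>
    have h1 : (h i ((n + 1 : ℕ) : ℤ) : SymFun Q₀ R) = MvPolynomial.X (i, n) := rfl
    rw [h1, realize, MvPolynomial.aeval_X]

theorem coeff_rename_mul_rename (f : MvPowerSeries V R) (g : MvPowerSeries W R)
    (m : V →₀ ℕ) (n : W →₀ ℕ) :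
    MvPowerSeries.coeff (m.embDomain Function.Embedding.inl + n.embDomain Function.Embedding.inr)
      (MvPowerSeries.rename (Function.Embedding.inl : V ↪ V ⊕ W) f *
        MvPowerSeries.rename (Function.Embedding.inr : W ↪ V ⊕ W) g) =
      MvPowerSeries.coeff m f * MvPowerSeries.coeff n g := by
  classical
  rw [MvPowerSeries.coeff_mul, Finset.sum_eq_single
    (m.embDomain Function.Embedding.inl, n.embDomain Function.Embedding.inr)]
  · simp only [MvPowerSeries.coeff_embDomain_rename]
  · rintro ⟨a, b⟩ hab hne
    rw [Finset.HasAntidiagonal.mem_antidiagonal] at hab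
    by_cases ha : a ∈ Set.range (Finsupp.mapDomain (Function.Embedding.inl : V ↪ V ⊕ W))
    swap
    · rw [MvPowerSeries.coeff_rename_eq_zero _ _ ha, zero_mul]
    by_cases hb : b ∈ Set.range (Finsupp.mapDomain (Function.Embedding.inr : W ↪ V ⊕ W))
    swap
    · rw [MvPowerSeries.coeff_rename_eq_zero _ _ hb, mul_zero]
    obtain ⟨a, rfl⟩ := ha
    obtain ⟨b, rfl⟩ := hb
    exfalso
    apply hne
    simp only [← Finsupp.embDomain_eq_mapDomain] at hab ⊢
    have h1 : a = m := by
      ext v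
      have := DFunLike.congr_fun hab (Sum.inl v)
      have e1 := Finsupp.embDomain_apply_self (Function.Embedding.inl : V ↪ V ⊕ W) a v
      have e2 := Finsupp.embDomain_apply_self (Function.Embedding.inl : V ↪ V ⊕ W) m v
      have e3 := Finsupp.embDomain_of_notMem_range (Function.Embedding.inr : W ↪ V ⊕ W) b (Sum.inl v)
        (by simp)
      have e4 := Finsupp.embDomain_of_notMem_range (Function.Embedding.inr : W ↪ V ⊕ W) n (Sum.inl v)
        (by simp)
      simp only [Function.Embedding.inl_apply] at e1 e2
      simpa [e1, e2, e3, e4] using this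
    have h2 : b = n := by
      subst h1
      exact Finsupp.embDomain_injective _ (add_left_cancel hab)
    rw [h1, h2]
  · intro hn
    simp at hn

theorem exists_embDomain_add (m : V ⊕ W →₀ ℕ) : ∃ (a : V →₀ ℕ) (b : W →₀ ℕ),
    m = a.embDomain Function.Embedding.inl + b.embDomain Function.Embedding.inr := by
  refine ⟨m.comapDomain Sum.inl Sum.inl_injective.injOn,
    m.comapDomain Sum.inr Sum.inr_injective.injOn, ?_⟩
  ext x
  rcases x with v | w
  · have e1 := Finsupp.embDomain_apply_self (Function.Embedding.inl : V ↪ V ⊕ W)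
      (m.comapDomain Sum.inl Sum.inl_injective.injOn) v
    simp only [Function.Embedding.inl_apply] at e1
    rw [Finsupp.add_apply, e1, Finsupp.embDomain_of_notMem_range _ _ _ (by simp)]
    simp
  · have e1 := Finsupp.embDomain_apply_self (Function.Embedding.inr : W ↪ V ⊕ W)
      (m.comapDomain Sum.inr Sum.inr_injective.injOn) w
    simp only [Function.Embedding.inr_apply] at e1
    rw [Finsupp.add_apply, e1, Finsupp.embDomain_of_notMem_range _ _ _ (by simp)]
    simp

/-- Realizing `g[X + Y]` in two disjoint sets of variables. -/
def realize₂ (c : V → Q₀) (d : W → Q₀) :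
    SymFun Q₀ R ⊗[R] SymFun Q₀ R →ₐ[R] MvPowerSeries (V ⊕ W) R :=
  Algebra.TensorProduct.productMap
    ((MvPowerSeries.rename (Function.Embedding.inl : V ↪ V ⊕ W)).comp (realize c))
    ((MvPowerSeries.rename (Function.Embedding.inr : W ↪ V ⊕ W)).comp (realize d))

theorem realize₂_coproduct (c : V → Q₀) (d : W → Q₀) (g : SymFun Q₀ R) :
    realize₂ (R := R) c d (coproduct (R := R) g) = realize (Sum.elim c d) g := by
  classical
  have : (realize₂ (R := R) c d).comp (coproduct (R := R)) = realize (R := R) (Sum.elim c d) := by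
    apply MvPolynomial.algHom_ext
    rintro ⟨i, n⟩
    have hr : realize (R := R) (Sum.elim c d) (MvPolynomial.X (i, n)) =
      hSeries (Sum.elim c d) i (n + 1) := by rw [realize, MvPolynomial.aeval_X]
    rw [hr, AlgHom.comp_apply, coproduct, MvPolynomial.aeval_X, map_sum]
    simp only [realize₂, Algebra.TensorProduct.productMap_apply_tmul, AlgHom.comp_apply, realize_h]
    ext m
    obtain ⟨a, b, rfl⟩ := exists_embDomain_add m
    simp only [map_sum, coeff_rename_mul_rename, coeff_hSeries]
    have hdeg : (a.embDomain (Function.Embedding.inl : V ↪ V ⊕ W) +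
        b.embDomain (Function.Embedding.inr : W ↪ V ⊕ W)).degree = a.degree + b.degree := by
      rw [map_add, degree_embDomain, degree_embDomain]
    have hsupp : (∀ v ∈ (a.embDomain (Function.Embedding.inl : V ↪ V ⊕ W) +
        b.embDomain (Function.Embedding.inr : W ↪ V ⊕ W)).support, Sum.elim c d v = i) ↔
        (∀ v ∈ a.support, c v = i) ∧ ∀ v ∈ b.support, d v = i := by
      have h1 : ∀ v, (a.embDomain (Function.Embedding.inl : V ↪ V ⊕ W) +
          b.embDomain (Function.Embedding.inr : W ↪ V ⊕ W)) (Sum.inl v) = a v := by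
        intro v
        have e1 := Finsupp.embDomain_apply_self (Function.Embedding.inl : V ↪ V ⊕ W) a v
        simp only [Function.Embedding.inl_apply] at e1
        rw [Finsupp.add_apply, e1, Finsupp.embDomain_of_notMem_range _ _ _ (by simp), add_zero]
      have h2 : ∀ v, (a.embDomain (Function.Embedding.inl : V ↪ V ⊕ W) +
          b.embDomain (Function.Embedding.inr : W ↪ V ⊕ W)) (Sum.inr v) = b v := by
        intro v
        have e1 := Finsupp.embDomain_apply_self (Function.Embedding.inr : W ↪ V ⊕ W) b v
        simp only [Function.Embedding.inr_apply] at e1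
        rw [Finsupp.add_apply, e1, Finsupp.embDomain_of_notMem_range _ _ _ (by simp), zero_add]
      simp only [Finsupp.mem_support_iff, Sum.forall, h1, h2, Sum.elim_inl, Sum.elim_inr]
    simp only [hdeg, hsupp]
    by_cases hab : a.degree + b.degree = n + 1
    · rw [Finset.sum_eq_single (a.degree, b.degree)]
      · simp only [hab, true_and]
        split_ifs <;> first | (exfalso; tauto) | simp only [mul_one, mul_zero]
      · rintro ⟨x, y⟩ _ hne
        have : ¬ (a.degree = x ∧ b.degree = y) := by
          rintro ⟨rfl, rfl⟩
          exact hne rfl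
        by_cases hx : a.degree = x
        · have hy : b.degree ≠ y := fun hy => this ⟨hx, hy⟩
          simp [hy]
        · simp [hx]
      · intro hn
        simp [hab] at hn
    · rw [if_neg (fun hh => hab hh.1)]
      apply Finset.sum_eq_zero
      rintro ⟨x, y⟩ hxy
      rw [Finset.HasAntidiagonal.mem_antidiagonal] at hxy
      simp only at hxy
      by_cases hx : a.degree = x
      · have hy : b.degree ≠ y := by omega
        simp [hy]
      · simp [hx]
  exact DFunLike.congr_fun this g

theorem partitionExponent_apply (s : Q₀ × ℕ →₀ ℕ) (i : Q₀) (n j : ℕ) :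
    partitionExponent s (i, n, j) = if j < s (i, n) then n + 1 else 0 := by
  classical
  rw [partitionExponent, Finsupp.sum_apply, Finsupp.sum]
  simp only [Finsupp.finsetSum_apply, Finsupp.single_apply, Prod.mk.injEq]
  rw [Finset.sum_eq_single (i, n)]
  · simp
  · rintro ⟨i', n'⟩ _ hne
    apply Finset.sum_eq_zero
    intro j' _
    rw [if_neg]
    rintro ⟨rfl, rfl, _⟩
    exact hne rfl
  · intro hs
    rw [Finsupp.notMem_support_iff] at hs
    simp [hs]

theorem hall_monomial (s : Q₀ × ℕ →₀ ℕ) (g : SymFun Q₀ R) :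
    hall (MvPolynomial.monomial s 1) g = MvPowerSeries.coeff (partitionExponent s)
      (realize (R := R) (Prod.fst : Q₀ × ℕ × ℕ → Q₀) g) := by
  have := (MvPolynomial.basisMonomials (Q₀ × ℕ) R).constr_basis R (fun s =>
    (MvPowerSeries.coeff (partitionExponent s)).comp
      (realize (R := R) (Prod.fst : Q₀ × ℕ × ℕ → Q₀)).toLinearMap) s
  rw [MvPolynomial.coe_basisMonomials] at this
  rw [hall, this]
  rfl

theorem coeff_partitionExponent_add (s t : Q₀ × ℕ →₀ ℕ) (g : SymFun Q₀ R) :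
    MvPowerSeries.coeff (partitionExponent (s + t))
      (realize (R := R) (Prod.fst : Q₀ × ℕ × ℕ → Q₀) g) =
    MvPowerSeries.coeff ((partitionExponent s).embDomain Function.Embedding.inl +
        (partitionExponent t).embDomain Function.Embedding.inr)
      (realize (R := R) (Sum.elim (Prod.fst : Q₀ × ℕ × ℕ → Q₀) (Prod.fst : Q₀ × ℕ × ℕ → Q₀)) g) := by
  classical
  obtain ⟨φ, hφ⟩ : ∃ φ : {x : Q₀ × ℕ × ℕ // x.2.2 < s (x.1, x.2.1) + t (x.1, x.2.1)} ↪
      Q₀ × ℕ × ℕ, ∀ x, φ x = x.1 := ⟨Function.Embedding.subtype _, fun x => rfl⟩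
  obtain ⟨ψ, hψ⟩ : ∃ ψ : {x : Q₀ × ℕ × ℕ // x.2.2 < s (x.1, x.2.1) + t (x.1, x.2.1)} ↪
      (Q₀ × ℕ × ℕ) ⊕ (Q₀ × ℕ × ℕ), ∀ x, ψ x = if x.1.2.2 < s (x.1.1, x.1.2.1) then Sum.inl x.1
        else Sum.inr (x.1.1, x.1.2.1, x.1.2.2 - s (x.1.1, x.1.2.1)) := by
    refine ⟨⟨fun x => if x.1.2.2 < s (x.1.1, x.1.2.1) then Sum.inl x.1 else
      Sum.inr (x.1.1, x.1.2.1, x.1.2.2 - s (x.1.1, x.1.2.1)), ?_⟩, fun x => rfl⟩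
    rintro ⟨⟨i, n, j⟩, hx⟩ ⟨⟨i', n', j'⟩, hx'⟩ hh
    simp only at hh hx hx'
    split_ifs at hh with h1 h2 h2
    · exact Subtype.ext (Sum.inl_injective hh)
    · simp only [Sum.inr.injEq, Prod.mk.injEq] at hh
      obtain ⟨rfl, rfl, h3⟩ := hh
      have : j = j' := by omega
      subst this
      rfl
  obtain ⟨e, he⟩ : ∃ e : {x : Q₀ × ℕ × ℕ // x.2.2 < s (x.1, x.2.1) + t (x.1, x.2.1)} →₀ ℕ,
      ∀ x, e x = x.1.2.1 + 1 := by
    refine ⟨(partitionExponent (s + t)).comapDomain φ φ.injective.injOn, ?_⟩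
    rintro ⟨⟨i, n, j⟩, hx⟩
    simp only at hx
    rw [Finsupp.comapDomain_apply, hφ, partitionExponent_apply, Finsupp.add_apply, if_pos hx]
  have h1 : partitionExponent (s + t) = e.embDomain φ := by
    ext ⟨i, n, j⟩
    by_cases hx : j < s (i, n) + t (i, n)
    · have := Finsupp.embDomain_apply_self φ e ⟨(i, n, j), hx⟩
      rw [he, hφ] at this
      rw [partitionExponent_apply, Finsupp.add_apply, if_pos hx]
      exact this.symm
    · rw [partitionExponent_apply, Finsupp.add_apply, if_neg hx,
        Finsupp.embDomain_of_notMem_range]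
      rintro ⟨⟨x, hx'⟩, hh⟩
      rw [hφ] at hh
      simp only at hh
      subst hh
      exact hx hx'
  have h2 : (partitionExponent s).embDomain Function.Embedding.inl +
      (partitionExponent t).embDomain Function.Embedding.inr = e.embDomain ψ := by
    ext x
    rcases x with ⟨i, n, j⟩ | ⟨i, n, j⟩
    · have e1 := Finsupp.embDomain_apply_self (Function.Embedding.inl :
        Q₀ × ℕ × ℕ ↪ (Q₀ × ℕ × ℕ) ⊕ (Q₀ × ℕ × ℕ)) (partitionExponent s) (i, n, j)
      simp only [Function.Embedding.inl_apply] at e1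
      rw [Finsupp.add_apply, e1, Finsupp.embDomain_of_notMem_range _ _ _ (by simp), add_zero,
        partitionExponent_apply]
      split_ifs with hj
      · have h3 := Finsupp.embDomain_apply_self ψ e ⟨(i, n, j), by simp only; omega⟩
        rw [he, hψ, if_pos hj] at h3
        exact h3.symm
      · rw [Finsupp.embDomain_of_notMem_range]
        rintro ⟨⟨⟨i', n', j'⟩, hx'⟩, hx⟩
        simp only [hψ] at hx
        split_ifs at hx with h4
        simp only [Sum.inl.injEq, Prod.mk.injEq] at hx
        obtain ⟨rfl, rfl, rfl⟩ := hx
        exact hj h4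
    · have e1 := Finsupp.embDomain_apply_self (Function.Embedding.inr :
        Q₀ × ℕ × ℕ ↪ (Q₀ × ℕ × ℕ) ⊕ (Q₀ × ℕ × ℕ)) (partitionExponent t) (i, n, j)
      simp only [Function.Embedding.inr_apply] at e1
      rw [Finsupp.add_apply, e1, Finsupp.embDomain_of_notMem_range _ _ _ (by simp), zero_add,
        partitionExponent_apply]
      split_ifs with hj
      · have h3 := Finsupp.embDomain_apply_self ψ e ⟨(i, n, s (i, n) + j), by simp only; omega⟩
        rw [he, hψ, if_neg (by simp)] at h3
        simpa using h3.symm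
      · rw [Finsupp.embDomain_of_notMem_range]
        rintro ⟨⟨⟨i', n', j'⟩, hx'⟩, hx⟩
        simp only [hψ] at hx hx'
        split_ifs at hx with h4
        simp only [Sum.inr.injEq, Prod.mk.injEq] at hx
        obtain ⟨rfl, rfl, rfl⟩ := hx
        omega
  rw [h1, h2, ← MvPowerSeries.coeff_killCompl, ← MvPowerSeries.coeff_killCompl, killCompl_realize,
    killCompl_realize]
  congr 3
  funext x
  simp only [Function.comp_apply, hψ, hφ]
  split_ifs <;> rfl

/-- `f^⊥` is adjoint to multiplication by `f` for the Hall scalar product. -/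
theorem hall_mul_left (f p g : SymFun Q₀ R) : hall (f * p) g = hall p (skew f g) := by
  have key : ∀ (s t : Q₀ × ℕ →₀ ℕ) (z : SymFun Q₀ R ⊗[R] SymFun Q₀ R),
      MvPowerSeries.coeff ((partitionExponent s).embDomain Function.Embedding.inl +
        (partitionExponent t).embDomain Function.Embedding.inr)
      (realize₂ (R := R) (Prod.fst : Q₀ × ℕ × ℕ → Q₀) (Prod.fst : Q₀ × ℕ × ℕ → Q₀) z) =
      hall (MvPolynomial.monomial t 1) (TensorProduct.lid R (SymFun Q₀ R)
        (LinearMap.rTensor (SymFun Q₀ R) (hall (MvPolynomial.monomial s 1)) z)) := by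
    intro s t z
    induction z using TensorProduct.induction_on with
    | zero => simp
    | tmul a b =>
      rw [realize₂, Algebra.TensorProduct.productMap_apply_tmul, AlgHom.comp_apply,
        AlgHom.comp_apply, coeff_rename_mul_rename, LinearMap.rTensor_tmul, TensorProduct.lid_tmul,
        map_smul, hall_monomial, hall_monomial, smul_eq_mul]
    | add a b ha hb => simp only [map_add, ha, hb]
  have mono : ∀ s t : Q₀ × ℕ →₀ ℕ,
      hall (MvPolynomial.monomial s 1 * MvPolynomial.monomial t 1) g =
        hall (MvPolynomial.monomial t 1) (skew (MvPolynomial.monomial s (1 : R)) g) := by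
    intro s t
    rw [MvPolynomial.monomial_mul, one_mul, hall_monomial, coeff_partitionExponent_add,
      ← realize₂_coproduct, key]
    rfl
  have hs : ∀ (a : R) (u : SymFun Q₀ R), skew (a • u) = a • skew u := by
    intro a u
    simp [skew, LinearMap.rTensor_smul, LinearMap.smul_comp, LinearMap.comp_smul]
  have ha : ∀ u v : SymFun Q₀ R, skew (u + v) = skew u + skew v := by
    intro u v
    simp [skew, LinearMap.rTensor_add, LinearMap.add_comp, LinearMap.comp_add]
  have hm : ∀ (s : Q₀ × ℕ →₀ ℕ) (a : R),
      MvPolynomial.monomial s a = a • MvPolynomial.monomial s (1 : R) := by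
    intro s a
    rw [MvPolynomial.smul_monomial, smul_eq_mul, mul_one]
  induction f using MvPolynomial.induction_on' with
  | monomial s a =>
    induction p using MvPolynomial.induction_on' with
    | monomial t b =>
      rw [hm s, hm t, smul_mul_smul_comm, hs]
      simp only [map_smul, LinearMap.smul_apply, mono, smul_eq_mul]
      ring
    | add p q hp hq => rw [mul_add, map_add, map_add, LinearMap.add_apply, LinearMap.add_apply, hp, hq]
  | add u v hu hv => rw [add_mul, map_add, LinearMap.add_apply, hu, hv, ha, LinearMap.add_apply, map_add]

/-- The Schur function `s_μ[X^{(i)}] = det (h_{μ_p - p + q})`, where `p, q` run over the rows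
of `μ`. -/
def schur (i : Q₀) (μ : YoungDiagram) : SymFun Q₀ R :=
  Matrix.det (Matrix.of fun p q : Fin (μ.colLen 0) =>
    h i ((μ.rowLen (p : ℕ) : ℤ) - ((p : ℕ) : ℤ) + ((q : ℕ) : ℤ)))

/-- The tensor Schur function `s_{λ^•}[X^•] = ∏_i s_{λ^{(i)}}[X^{(i)}]`. -/
def tensorSchur [Fintype Q₀] (lam : Q₀ → YoungDiagram) : SymFun Q₀ R := ∏ i, schur i (lam i)

end SymmetricFunctions

/-! ### Quivers and currents -/

/-- A quiver with vertex set `Q₀` and arrow set `Q₁`; loops and multiple arrows are allowed. -/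
structure QuiverData (Q₀ Q₁ : Type*) where
  /-- the vertex at which an arrow starts -/
  tail : Q₁ → Q₀
  /-- the vertex at which an arrow ends -/
  head : Q₁ → Q₀

section Currents

variable {Q₀ Q₁ : Type*}

/-- The Laurent polynomial ring `ℤ[t_b^{±1} | b ∈ Q₁]` in the arrow variables. -/
abbrev ArrowRing (Q₁ : Type*) := AddMonoidAlgebra ℤ (Q₁ →₀ ℤ)

/-- The arrow variable `t_b`. -/
def arrowVar (b : Q₁) : ArrowRing Q₁ := AddMonoidAlgebra.single (Finsupp.single b 1) 1

/-- The inclusion `ℤ[t_{Q₁}] → ℤ[t_{Q₁}^{±1}]`. -/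
def toArrowRing : MvPolynomial Q₁ ℤ →ₐ[ℤ] ArrowRing Q₁ := MvPolynomial.aeval arrowVar

/-- `Ω[c v_j X^{(i)}] = ∑_n c^n v_j^n h_n[X^{(i)}]`, a power series in auxiliary variables
`v_1, …, v_a`. -/
def omega {a : ℕ} (i : Q₀) (c : ArrowRing Q₁) (j : Fin a) :
    MvPowerSeries (Fin a) (SymFun Q₀ (ArrowRing Q₁)) :=
  fun g => if g.support ⊆ {j} then MvPolynomial.C (c ^ g j) * h i (g j) else 0

variable [Fintype Q₁] [DecidableEq Q₀]

/-- `Ω[-U^* X^{(i)}] ∏_{b ∈ Out(i)} Ω[t_b U^* X^{(hb)}]` as a power series in `v_j = u_j^{-1}`. -/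
def skewSeries (Q : QuiverData Q₀ Q₁) (i : Q₀) (a : ℕ) :
    MvPowerSeries (Fin a) (SymFun Q₀ (ArrowRing Q₁)) :=
  (∏ j : Fin a, MvPowerSeries.invOfUnit (omega i 1 j) 1) *
    ∏ b : Q₁ with Q.tail b = i, ∏ j : Fin a, omega (Q.head b) (arrowVar b) j

/-- `R(U) = ∏_{p < q} (1 - u_q / u_p)`, a Laurent polynomial in `u_1, …, u_a`. -/
def rootFactor (a : ℕ) : AddMonoidAlgebra ℤ (Fin a → ℤ) :=
  ∏ p : Fin a, ∏ q : Fin a with p < q,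
    (1 - AddMonoidAlgebra.single (Pi.single q 1 - Pi.single p 1) 1)

/-- The quiver current `H_β^{(i,a)}`, for `β ∈ ℤ^a`: the coefficient of `u^β` in
`R(U) Ω[U X^{(i)}] Ω[-U^* X^{(i)}]^⊥ ∏_{b ∈ Out(i)} Ω[t_b U^* X^{(hb)}]^⊥`, as an operator on `Λ^Q`.
Here `R(U)` contributes `u^δ`, the skewing series contributes `u^{-γ}`, hence
`Ω[U X^{(i)}] = ∑_p u^p ∏_j h_{p_j}[X^{(i)}]` contributes `p = β - δ + γ`. Only finitely many `γ`
contribute, as the skewing operator at `u^{-γ}` lowers degrees by `|γ|`. -/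
def current (Q : QuiverData Q₀ Q₁) (i : Q₀) (a : ℕ) (β : Fin a → ℤ)
    (f : SymFun Q₀ (ArrowRing Q₁)) : SymFun Q₀ (ArrowRing Q₁) :=
  ∑ δ ∈ (rootFactor a).coeff.support, (rootFactor a).coeff δ •
    ∑ᶠ γ : Fin a →₀ ℕ, (∏ j, h i (β j - δ j + (γ j : ℤ))) *
      skew (MvPowerSeries.coeff γ (skewSeries Q i a)) f

end Currents

/-- A pair `(𝐢, 𝐚)`: a sequence of `m` vertices `i_k` and positive integers `a_k`. -/
structure CurrentSeq (Q₀ : Type*) where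
  /-- the length of the sequence -/
  m : ℕ
  /-- the vertices `i_1, …, i_m` -/
  vertex : Fin m → Q₀
  /-- the positive integers `a_1, …, a_m` -/
  size : Fin m → ℕ
  size_pos : ∀ k, 0 < size k

namespace CurrentSeq

variable {Q₀ Q₁ : Type*} (D : CurrentSeq Q₀)

/-- The quiver Hall-Littlewood symmetric function `H_{μ(1)}^{(i_1,a_1)} ⋯ H_{μ(m)}^{(i_m,a_m)} · 1`. -/
def hallLittlewood [Fintype Q₁] [DecidableEq Q₀] (Q : QuiverData Q₀ Q₁)
    (μ : ∀ k, Fin (D.size k) → ℤ) : SymFun Q₀ (ArrowRing Q₁) :=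
  (List.finRange D.m).foldr (fun k f => current Q (D.vertex k) (D.size k) (μ k) f) 1

/-- The basis `⊔_k 𝓑(k)` of `𝐕`: the pair `(k, p)` stands for `e(k)_p`. Weights of the maximal torus
`T^•` are functions `D.Basis → ℤ`. -/
abbrev Basis : Type := Σ k : Fin D.m, Fin (D.size k)

/-- The vertex `i` with `b ∈ 𝓑^{(i)}`. -/
def vtx (b : D.Basis) : Q₀ := D.vertex b.1

/-- `b` precedes `b'` in the ordered basis. -/
def Before (b b' : D.Basis) : Prop := b.1 < b'.1 ∨ b.1 = b'.1 ∧ (b.2 : ℕ) < (b'.2 : ℕ)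

instance : DecidableRel D.Before := fun _ _ => inferInstanceAs (Decidable (_ ∨ _))

/-- The weight `μ^•` obtained by concatenating the `μ(k)` at each vertex. -/
def concat (μ : ∀ k, Fin (D.size k) → ℤ) : D.Basis → ℤ := fun b => μ b.1 b.2

/-- A weight is dominant for `G^•` if it is weakly decreasing along every `𝓑^{(i)}`. -/
def IsDominant (γ : D.Basis → ℤ) : Prop :=
  ∀ b b', D.vtx b = D.vtx b' → D.Before b b' → γ b' ≤ γ b

/-- The roots `R_{𝐢,𝐚}`: an arrow `b`, an element `y` of block `k` and an element `z` of block `ℓ`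
with `k < ℓ`, `tb = i_k` and `hb = i_ℓ`. -/
def Root (Q : QuiverData Q₀ Q₁) : Type _ :=
  {α : Q₁ × D.Basis × D.Basis //
    α.2.1.1 < α.2.2.1 ∧ Q.tail α.1 = D.vtx α.2.1 ∧ Q.head α.1 = D.vtx α.2.2}

instance [Fintype Q₁] [DecidableEq Q₀] (Q : QuiverData Q₀ Q₁) : Fintype (D.Root Q) :=
  inferInstanceAs (Fintype {α : Q₁ × D.Basis × D.Basis //
    α.2.1.1 < α.2.2.1 ∧ Q.tail α.1 = D.vtx α.2.1 ∧ Q.head α.1 = D.vtx α.2.2})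

/-- The weight of a root in the torus `T^•`, i.e. the exponent of `y / z`. -/
def rootWeight {Q : QuiverData Q₀ Q₁} (α : D.Root Q) : D.Basis → ℤ :=
  Pi.single α.1.2.1 1 - Pi.single α.1.2.2 1

/-- The Kostant partitions of the weight `γ`. -/
def kostantPartitions [Fintype Q₁] [DecidableEq Q₀] (Q : QuiverData Q₀ Q₁) (γ : D.Basis → ℤ) :
    Set (D.Root Q → ℕ) :=
  {n | ∑ α, n α • D.rootWeight α = γ}

theorem finite_kostantPartitions [Fintype Q₁] [DecidableEq Q₀] (Q : QuiverData Q₀ Q₁)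
    (γ : D.Basis → ℤ) : (D.kostantPartitions Q γ).Finite := by
  let L : (D.Basis → ℤ) →+ ℤ :=
    { toFun := fun γ => ∑ b : D.Basis, ((D.m : ℤ) - (b.1 : ℕ)) * γ b
      map_zero' := by simp
      map_add' := by
        intro x y
        simp [mul_add, Finset.sum_add_distrib] }
  have hL : ∀ α : D.Root Q, 1 ≤ L (D.rootWeight α) := by
    intro α
    have h1 : (α.1.2.1.1 : ℕ) < (α.1.2.2.1 : ℕ) := α.2.1
    have h2 : L (D.rootWeight α) = (α.1.2.2.1 : ℕ) - ((α.1.2.1.1 : ℕ) : ℤ) := by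
      simp [L, rootWeight, mul_sub, Finset.sum_sub_distrib, Pi.single_apply]
    rw [h2]
    omega
  classical
  apply (Set.finite_Icc (0 : D.Root Q → ℕ) (fun _ => (L γ).toNat)).subset
  intro n hn
  refine ⟨fun α => Nat.zero_le _, fun α => ?_⟩
  have h1 : ∑ β, (n β : ℤ) * L (D.rootWeight β) = L γ := by
    rw [← show ∑ β, n β • D.rootWeight β = γ from hn, map_sum]
    exact Finset.sum_congr rfl fun β _ => by rw [map_nsmul, nsmul_eq_mul]
  have h2 : (n α : ℤ) ≤ ∑ β, (n β : ℤ) * L (D.rootWeight β) := by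
    calc (n α : ℤ) ≤ (n α : ℤ) * L (D.rootWeight α) := by
          have := hL α
          nlinarith [Int.natCast_nonneg (n α)]
      _ ≤ _ := Finset.single_le_sum (f := fun β => (n β : ℤ) * L (D.rootWeight β))
          (fun β _ => mul_nonneg (Int.natCast_nonneg _) (by linarith [hL β])) (Finset.mem_univ α)
  have h3 : n α ≤ (L γ).toNat := by omega
  exact h3

variable [DecidableEq Q₀]

/-- `ν^{(i)}`, the dimension of `𝐕^{(i)}`. -/
def dim (i : Q₀) : ℕ := ∑ k with D.vertex k = i, D.size k

/-- The position of `b` in `𝓑^{(i)}`, counted from `0`. -/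
def row (b : D.Basis) : ℕ :=
  (Finset.univ.filter fun b' : D.Basis => D.vtx b' = D.vtx b ∧ D.Before b' b).card

/-- The weight `ρ^•`: at each vertex `ρ^{(i)} = (ν^{(i)} - 1, …, 1, 0)`. -/
def rho (b : D.Basis) : ℤ :=
  ((Finset.univ.filter fun b' : D.Basis => D.vtx b' = D.vtx b ∧ D.Before b b').card : ℤ)

/-- The Weyl group `S^• = ∏_i S_{ν^{(i)}}`: the permutations of the basis preserving all `𝓑^{(i)}`. -/
def weyl : Finset (Equiv.Perm D.Basis) :=
  Finset.univ.filter fun w => ∀ b, D.vtx (w b) = D.vtx b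

/-- The quiver Kostka-Shoji polynomial `𝒦_{λ^•,μ(•)}^{𝐢,𝐚}(t_{Q₁})`, for a weight `λ^•`, by the
alternating Kostant partition formula; note `(w⁻¹ γ) b = γ (w b)`. -/
def kostkaShoji [Fintype Q₁] (Q : QuiverData Q₀ Q₁) (μ : ∀ k, Fin (D.size k) → ℤ)
    (lam : D.Basis → ℤ) : MvPolynomial Q₁ ℤ :=
  ∑ w ∈ D.weyl, (Equiv.Perm.sign w : ℤ) •
    ∑ n ∈ (D.finite_kostantPartitions Q
        (fun b => (lam + D.rho) (w b) - (D.concat μ + D.rho) b)).toFinset,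
      ∏ α : D.Root Q, MvPolynomial.X α.1.1 ^ n α

/-- A tuple of partitions, at most `ν^{(i)}` rows at vertex `i`, as a weight of `T^•`. -/
def partitionWeight (lam : Q₀ → YoungDiagram) : D.Basis → ℤ :=
  fun b => ((lam (D.vtx b)).rowLen (D.row b) : ℤ)

/-! The quiver Hall-Littlewood series. -/

/-- `R(T^•) = ℤ[x_b^{±1} | b ∈ D.Basis]`. -/
abbrev WeightRing : Type := AddMonoidAlgebra ℤ (D.Basis → ℤ)

/-- The monomial `x^γ`. -/
def xpow (γ : D.Basis → ℤ) : D.WeightRing := AddMonoidAlgebra.single γ 1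

/-- The antisymmetrizer `J^• = ∑_w (-1)^w w`, where `w (x^γ) = x^{wγ}` and `wγ = γ ∘ w⁻¹`. -/
def antisym (f : D.WeightRing) : D.WeightRing :=
  ∑ w ∈ D.weyl, (Equiv.Perm.sign w : ℤ) • AddMonoidAlgebra.mapDomain (fun γ => γ ∘ ⇑w⁻¹) f

open Classical in
/-- The Demazure operator `D_{w_0^•}(f) = J^•(x^{ρ^•})⁻¹ J^•(x^{ρ^•} f)`: the exact quotient. -/
def demazure (f : D.WeightRing) : D.WeightRing :=
  if hf : ∃ g, D.antisym (D.xpow D.rho) * g = D.antisym (D.xpow D.rho * f) then hf.choose else 0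

/-- `B_{𝐢,𝐚} = ∏_α (1 - t_α x^{α})⁻¹ ∈ R(T^•)[[t_{Q₁}]]`. -/
def rootSeries [Fintype Q₁] (Q : QuiverData Q₀ Q₁) : MvPowerSeries Q₁ D.WeightRing :=
  ∏ α : D.Root Q,
    MvPowerSeries.invOfUnit (1 - MvPowerSeries.monomial (Finsupp.single α.1.1 1)
      (D.xpow (D.rootWeight α))) 1

/-- The quiver Hall-Littlewood series `χ = D_{w_0^•}(x^{μ(•)} B_{𝐢,𝐚})` in `R(T^•)[[t_{Q₁}]]`; the
Demazure operator is linear over the arrow variables, so it acts on each coefficient. -/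
def hlSeries [Fintype Q₁] (Q : QuiverData Q₀ Q₁) (μ : ∀ k, Fin (D.size k) → ℤ) :
    MvPowerSeries Q₁ D.WeightRing :=
  fun d => D.demazure (D.xpow (D.concat μ) * MvPowerSeries.coeff d (D.rootSeries Q))

/-- The irreducible character `s_{λ^•}(x) = J^•(x^{ρ^•})⁻¹ J^•(x^{λ^• + ρ^•})` of `G^•`, i.e. the
product over the vertices of the Schur polynomials `s_{λ^{(i)}}(x^{(i)})`. -/
def schurChar (lam : D.Basis → ℤ) : D.WeightRing := D.demazure (D.xpow lam)

end CurrentSeq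

end QuiverHL
end

/-! Encode the product ∏_b h_{γ_b}[X^{(c b)}] by the Laurent monomial x^γ (`hEval`); a negative
exponent gives 0. In generating-function form, f^⊥ multiplies ∏_b Ω[x_b X^{(c b)}] by the value of f
on the letters x_b. Hence a term x^e of that value acts on the encoding as multiplication by x^{-e}
(`hall_hProd`, `skew_hProd`).

A current H_β^{(i,a)} therefore adjoins a new letters with exponents β and multiplies by a kernel:
the factors 1 - x_p/x_q for new letters p < q, the factors 1 - x_p/x_b for old letters b at i, and
the geometric series (1 - t x_p/x_b)^{-1} for old letters b at the heads of the arrows leaving i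
(`current_hEval`). The series may be truncated, since their high terms produce a negative exponent.
Induction on the length of the sequence (`exists_hallLittlewood_eq_hEval`) presents the
Hall-Littlewood function as the value at x^μ ∏ (1 - x_y/x_z) ∏_α (1 - t_α x^α)^{-1}, where y runs
before z at the same vertex.

The Weyl denominator formula (`pairDenominator_eq_sum`) expands the middle product as ∑_w (-1)^w
x^{ρ - ρ∘w}. Each choice of multiplicities n then contributes its monomial in the t_b times a
Jacobi-Trudi determinant with weight g = μ + ρ + ∑ n(α)ᾱ. This determinant alternates in g: it
vanishes if g repeats an entry at some vertex, and otherwise equals, up to sign, the determinant for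
λ + ρ with λ dominant. A dominant λ with a negative entry gives 0, and the remaining ones are tuples
of partitions. Collecting the terms for a fixed λ yields the alternating Kostant sum.

The series is straightened in the same way, with the alternant J(x^g) in place of the determinant;
there no dominant weight drops out. The lemmas `alternatingSum_eq_sum` and `sum_smul_alternatingSum`
serve both cases. Exactness of the quotient (`antisym_rho_dvd`) comes from factoring every alternant
matrix through a Vandermonde matrix. -/

noncomputable section

namespace QuiverHL

set_option linter.unusedSectionVars false

section

/-! ### Skewing products of complete homogeneous functions -/

section SkewFormula

variable {Q₀ R B : Type*} [CommRing R] [Fintype B]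

/-- `∏_b h_{γ_b}[X^{(c b)}]`, for an integer vector `γ`. -/
def hProd (c : B → Q₀) (γ : B → ℤ) : SymFun Q₀ R := ∏ b, h (c b) (γ b)

theorem h_of_neg (i : Q₀) {n : ℤ} (hn : n < 0) : (h i n : SymFun Q₀ R) = 0 := by
  cases n with
  | ofNat n => exact absurd hn (by simp)
  | negSucc n => rfl

theorem h_zero (i : Q₀) : (h i 0 : SymFun Q₀ R) = 1 := rfl

theorem hProd_of_neg (c : B → Q₀) {γ : B → ℤ} {b : B} (hb : γ b < 0) :
    (hProd c γ : SymFun Q₀ R) = 0 :=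
  Finset.prod_eq_zero (Finset.mem_univ b) (h_of_neg _ hb)

/-- For negative n only k = 0 is left and its second factor is 0, so one formula covers all
integers. -/
theorem coproduct_h (i : Q₀) (n : ℤ) :
    coproduct (R := R) (h i n : SymFun Q₀ R) =
      ∑ k ∈ Finset.range (n.toNat + 1), h i (k : ℤ) ⊗ₜ[R] h i (n - k) := by
  cases n with
  | negSucc n =>
    have h0 : (h i (Int.negSucc n) : SymFun Q₀ R) = 0 := rfl
    simp [h0, Int.toNat]
  | ofNat n =>
    cases n with
    | zero =>
      have h0 : (h i 0 : SymFun Q₀ R) = 1 := rfl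
      simp [h0, Algebra.TensorProduct.one_def]
    | succ n =>
      have h1 : (h i (Int.ofNat (n + 1)) : SymFun Q₀ R) = MvPolynomial.X (i, n) := rfl
      rw [h1, coproduct, MvPolynomial.aeval_X, Finset.Nat.sum_antidiagonal_eq_sum_range_succ_mk]
      refine Finset.sum_congr rfl fun k hk => ?_
      have hk' : k ≤ n + 1 := Nat.lt_succ_iff.1 (Finset.mem_range.1 hk)
      simp [Nat.cast_sub hk']

theorem prod_tmul {A ι : Type*} [CommRing A] [Algebra R A] (s : Finset ι) (f g : ι → A) :
    ∏ j ∈ s, (f j ⊗ₜ[R] g j) = (∏ j ∈ s, f j) ⊗ₜ[R] ∏ j ∈ s, g j := by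
  classical
  induction s using Finset.induction_on with
  | empty => simp [Algebra.TensorProduct.one_def]
  | insert j s hj ih => simp [Finset.prod_insert hj, ih]

/-- The vectors `e : B → ℕ` below `γ : B → ℤ` (or `0`, where `γ` is negative). -/
def subVectors [DecidableEq B] (γ : B → ℤ) : Finset (B → ℕ) :=
  Fintype.piFinset fun b => Finset.range ((γ b).toNat + 1)

theorem mem_subVectors [DecidableEq B] {γ : B → ℤ} {e : B → ℕ} :
    e ∈ subVectors γ ↔ ∀ b, e b ≤ (γ b).toNat := by
  simp [subVectors]

variable [DecidableEq B]

theorem coproduct_hProd (c : B → Q₀) (γ : B → ℤ) :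
    coproduct (R := R) (hProd c γ : SymFun Q₀ R) = ∑ e ∈ subVectors γ,
      hProd c (fun b => (e b : ℤ)) ⊗ₜ[R] hProd c (fun b => γ b - e b) := by
  rw [hProd, map_prod]
  simp only [coproduct_h]
  rw [Finset.prod_univ_sum]
  simp only [prod_tmul]
  rfl

theorem skew_hProd_eq_sum_hall (c : B → Q₀) (γ : B → ℤ) (f : SymFun Q₀ R) :
    skew f (hProd c γ) = ∑ e ∈ subVectors γ,
      hall f (hProd c (fun b => (e b : ℤ))) • hProd c (fun b => γ b - e b) := by
  simp [skew, coproduct_hProd]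

/-- Matches the splittings produced by the coproduct with those in the coefficient of a product of
power series. -/
theorem sum_subVectors_eq_sum_antidiagonal {M : Type*} [AddCommMonoid M] (e : B → ℕ)
    (φ : (B →₀ ℕ) → (B →₀ ℕ) → M) :
    ∑ d ∈ subVectors (fun b => (e b : ℤ)), φ (Finsupp.equivFunOnFinite.symm d)
        (Finsupp.equivFunOnFinite.symm (e - d)) =
      ∑ x ∈ Finset.HasAntidiagonal.antidiagonal (Finsupp.equivFunOnFinite.symm e), φ x.1 x.2 := by
  refine Finset.sum_nbij' (fun d => (Finsupp.equivFunOnFinite.symm d,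
    Finsupp.equivFunOnFinite.symm (e - d))) (fun x => ⇑x.1) ?_ ?_ ?_ ?_ ?_
  · intro d hd
    rw [mem_subVectors] at hd
    rw [Finset.HasAntidiagonal.mem_antidiagonal]
    ext b
    have := hd b
    simp at this
    simp [this]
  · rintro ⟨x, y⟩ hxy
    rw [Finset.HasAntidiagonal.mem_antidiagonal] at hxy
    rw [mem_subVectors]
    intro b
    have := DFunLike.congr_fun hxy b
    simp at this
    simp
    omega
  · intro d _
    rfl
  · rintro ⟨x, y⟩ hxy
    rw [Finset.HasAntidiagonal.mem_antidiagonal] at hxy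
    ext b
    · rfl
    · have := DFunLike.congr_fun hxy b
      simp at this
      simp
      omega
  · intro d _
    rfl

theorem coeff_zero_realize_hProd {V : Type*} (c : B → Q₀) (d : V → Q₀) (e : B → ℕ) :
    MvPowerSeries.coeff 0 (realize (R := R) d (hProd c fun b => (e b : ℤ))) =
      if e = 0 then 1 else 0 := by
  classical
  rw [hProd, map_prod, MvPowerSeries.coeff_zero_eq_constantCoeff_apply, map_prod]
  have : ∀ b, MvPowerSeries.constantCoeff (realize (R := R) d (h (c b) (e b : ℤ))) =
      if e b = 0 then 1 else 0 := by
    intro b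
    rw [realize_h, ← MvPowerSeries.coeff_zero_eq_constantCoeff_apply, coeff_hSeries]
    simp [eq_comm]
  simp only [this, Finset.prod_ite_zero, Finset.prod_const_one, funext_iff, Finset.mem_univ,
    true_implies, Pi.zero_apply]

theorem realize_h_single (i j : Q₀) (n : ℕ) [Decidable (j = i)] :
    realize (R := R) (fun _ : Unit => i) (h j (n : ℤ)) =
      if j = i ∨ n = 0 then MvPowerSeries.monomial (Finsupp.single () n) 1 else 0 := by
  classical
  rw [realize_h]
  refine MvPowerSeries.ext fun m => ?_
  obtain ⟨k, rfl⟩ : ∃ k, m = Finsupp.single () k := ⟨(m : Unit →₀ ℕ) (), by ext; simp⟩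
  rw [coeff_hSeries]
  by_cases hk : k = 0
  · subst hk
    by_cases hn : n = 0
    · subst hn
      simp
    · by_cases hji : j = i
      · simp [hn, hji, MvPowerSeries.coeff_monomial, eq_comm]
      · simp [hn, hji, eq_comm]
  · rw [Finsupp.support_single _ hk]
    by_cases hji : j = i
    · subst hji
      simp [MvPowerSeries.coeff_monomial]
    · by_cases hn : n = 0
      · simp [hn, Ne.symm hji, hk]
      · simp [hn, hji, Ne.symm hji]

/-- In a single variable x at vertex i, a factor h_{e_b} becomes x^{e_b} if b lies at i, and
otherwise vanishes unless e_b = 0. So both sides test whether e has total n and is supported at i.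
This is the symmetry of the Hall pairing needed for the generators in `hall_hProd`. -/
theorem coeff_single_realize_hProd (c : B → Q₀) (i : Q₀) (v : ℕ × ℕ) (e : B → ℕ) (n : ℕ) :
    MvPowerSeries.coeff (Finsupp.single (i, v) n)
        (realize (R := R) (Prod.fst : Q₀ × ℕ × ℕ → Q₀) (hProd c fun b => (e b : ℤ))) =
      MvPowerSeries.coeff (Finsupp.equivFunOnFinite.symm e) (hSeries (R := R) c i n) := by
  classical
  let ε : Unit ↪ Q₀ × ℕ × ℕ := ⟨fun _ => (i, v), fun _ _ _ => rfl⟩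
  have h1 : Finsupp.single (i, v) n = (Finsupp.single () n).embDomain ε := by
    rw [Finsupp.embDomain_single]; rfl
  rw [h1, ← MvPowerSeries.coeff_killCompl, killCompl_realize]
  have h2 : (Prod.fst : Q₀ × ℕ × ℕ → Q₀) ∘ ε = fun _ => i := rfl
  rw [h2, hProd, map_prod]
  simp only [realize_h_single]
  rw [Finset.prod_ite_zero, coeff_hSeries]
  have hp : ∏ b : B, MvPowerSeries.monomial (R := R) (Finsupp.single () (e b)) 1 =
      MvPowerSeries.monomial (Finsupp.single () (∑ b, e b)) 1 := by
    have := MvPowerSeries.prod_monomial (R := R) (fun b => Finsupp.single () (e b)) (fun _ => 1)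
      Finset.univ
    rw [this, ← Finsupp.single_finsetSum, Finset.prod_const_one]
  have h3 : (Finsupp.equivFunOnFinite.symm e).degree = ∑ b, e b := by
    simp [Finsupp.degree_eq_sum]
  have h4 : (∀ v ∈ (Finsupp.equivFunOnFinite.symm e).support, c v = i) ↔
      ∀ b, c b = i ∨ e b = 0 := by
    simp [or_iff_not_imp_right]
  simp only [hp, h3, h4, Finset.mem_univ, true_implies]
  by_cases hb : ∀ b, c b = i ∨ e b = 0
  · rw [if_pos hb, MvPowerSeries.coeff_monomial]
    simp only [hb, and_true, implies_true, Finsupp.single_eq_single_iff]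
    congr 1
    rw [eq_iff_iff]
    constructor
    · rintro (⟨-, h⟩ | ⟨h, h'⟩) <;> omega
    · exact fun h => Or.inl ⟨trivial, h.symm⟩
  · rw [if_neg hb, map_zero, if_neg fun h => hb h.2]

/-- The pairing with a product of complete homogeneous functions is a coefficient. -/
theorem hall_hProd (c : B → Q₀) (f : SymFun Q₀ R) (e : B → ℕ) :
    hall f (hProd c fun b => (e b : ℤ)) =
      MvPowerSeries.coeff (Finsupp.equivFunOnFinite.symm e) (realize c f) := by
  classical
  induction f using MvPolynomial.induction_on generalizing e with
  | C r =>
    have h1 : (MvPolynomial.C r : SymFun Q₀ R) = r • MvPolynomial.monomial 0 1 := by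
      rw [MvPolynomial.smul_monomial, smul_eq_mul, mul_one]; rfl
    rw [h1, map_smul, LinearMap.smul_apply, hall_monomial, map_smul, map_smul]
    have h2 : partitionExponent (0 : Q₀ × ℕ →₀ ℕ) = 0 := by simp [partitionExponent]
    rw [h2, coeff_zero_realize_hProd]
    have h3 : (MvPolynomial.monomial 0 1 : SymFun Q₀ R) = 1 := rfl
    rw [h3, map_one, MvPowerSeries.coeff_one]
    congr 2
    simp only [eq_iff_iff]
    rw [Equiv.symm_apply_eq]
    rfl
  | add p q hp hq => rw [map_add, LinearMap.add_apply, hp, hq, map_add, map_add]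
  | mul_X p x hp =>
    obtain ⟨i, n⟩ := x
    have hX : ∀ e : B → ℕ, hall (MvPolynomial.X (i, n)) (hProd (R := R) c fun b => (e b : ℤ)) =
        MvPowerSeries.coeff (Finsupp.equivFunOnFinite.symm e)
          (realize (R := R) c (MvPolynomial.X (i, n))) := by
      intro e
      have h1 : partitionExponent (Finsupp.single (i, n) 1) = Finsupp.single (i, n, 0) (n + 1) := by
        rw [partitionExponent, Finsupp.sum_single_index] <;> simp
      rw [show (MvPolynomial.X (i, n) : SymFun Q₀ R) =
        MvPolynomial.monomial (Finsupp.single (i, n) 1) 1 from rfl, hall_monomial, h1,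
        coeff_single_realize_hProd]
      rw [show (MvPolynomial.monomial (Finsupp.single (i, n) 1) 1 : SymFun Q₀ R) =
        MvPolynomial.X (i, n) from rfl, realize, MvPolynomial.aeval_X]
    have hsub : ∀ e' ∈ subVectors (fun b => (e b : ℤ)),
        (fun b => (e b : ℤ) - (e' b : ℤ)) = fun b => (((e - e') b : ℕ) : ℤ) := by
      intro e' he'
      rw [mem_subVectors] at he'
      funext b
      have := he' b
      simp only [Int.toNat_natCast] at this
      rw [Pi.sub_apply, Nat.cast_sub this]
    -- Adjointness gives ⟨pX, h_e⟩ = ⟨X, p^⊥ h_e⟩, and p^⊥ h_e involves only the pairings of p with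
    -- h_{e'} for e' ≤ e, known by induction; hence the generalization over e.
    rw [hall_mul_left, skew_hProd_eq_sum_hall, map_sum, map_mul, MvPowerSeries.coeff_mul,
      ← sum_subVectors_eq_sum_antidiagonal e fun x y => MvPowerSeries.coeff x (realize (R := R) c p) *
        MvPowerSeries.coeff y (realize (R := R) c (MvPolynomial.X (i, n)))]
    refine Finset.sum_congr rfl fun e' he' => ?_
    rw [map_smul, hp, hsub e' he', hX, smul_eq_mul]

/-- Skewing a product of complete homogeneous functions by `f` only depends on the realization of
`f` in the variables `x_b`: it is `subAct γ (realize c f)`, see `skew_hProd`. -/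
def subAct (c : B → Q₀) (γ : B → ℤ) : MvPowerSeries B R →ₗ[R] SymFun Q₀ R :=
  ∑ e ∈ subVectors γ, (LinearMap.toSpanSingleton R _ (hProd c fun b => γ b - e b)).comp
    (MvPowerSeries.coeff (Finsupp.equivFunOnFinite.symm e))

/-- The coproduct splits off h_e from h_γ, and the pairing of f with h_e is the coefficient of x^e
in f(x). This replaces skewing operators by ordinary power series. -/
theorem skew_hProd (c : B → Q₀) (γ : B → ℤ) (f : SymFun Q₀ R) :
    skew f (hProd c γ) = subAct c γ (realize c f) := by
  simp [skew_hProd_eq_sum_hall, subAct, hall_hProd]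

theorem subAct_monomial (c : B → Q₀) (γ : B → ℤ) (e : B →₀ ℕ) (r : R) :
    subAct c γ (MvPowerSeries.monomial e r) = r • hProd c fun b => γ b - e b := by
  classical
  simp only [subAct, LinearMap.sum_apply, LinearMap.comp_apply, LinearMap.toSpanSingleton_apply,
    MvPowerSeries.coeff_monomial]
  by_cases he : ∀ b, e b ≤ (γ b).toNat
  · rw [Finset.sum_eq_single ⇑e]
    · simp
    · intro d _ hd
      rw [if_neg, zero_smul]
      rintro rfl
      exact hd rfl
    · intro h
      exact absurd (mem_subVectors.2 he) h
  -- An exponent above max(γ_b, 0) makes γ_b - e_b negative, so cutting the sum at `subVectors`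
  -- loses nothing.
  · have h1 : (hProd c fun b => γ b - e b : SymFun Q₀ R) = 0 := by
      push Not at he
      obtain ⟨b, hb⟩ := he
      exact hProd_of_neg (b := b) c (by omega)
    rw [h1, smul_zero]
    refine Finset.sum_eq_zero fun d hd => ?_
    rw [if_neg, zero_smul]
    rintro rfl
    exact he (mem_subVectors.1 hd)

end SkewFormula

end

section

/-! ### Generating series in the products v_j x_b, and their truncations -/

section Kernel

variable {R B J : Type*} [CommRing R]

/-- The product `v_j x_b` as a power series in the `v_j` over the power series in the `x_b`. -/
def pairVar (j : J) (b : B) : MvPowerSeries J (MvPowerSeries B R) :=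
  MvPowerSeries.monomial (Finsupp.single j 1) (MvPowerSeries.monomial (Finsupp.single b 1) 1)

theorem coeff_base_smul (r : R) (F : MvPowerSeries J (MvPowerSeries B R)) (γ : J →₀ ℕ) :
    MvPowerSeries.coeff γ (r • F) = r • MvPowerSeries.coeff γ F :=
  rfl

open Classical in
/-- The sum of all monomials of degree `n` in the variables `x_b` with `b ∈ s`. -/
def completeOn (s : Finset B) (n : ℕ) : MvPowerSeries B R :=
  fun m => if m.degree = n ∧ m.support ⊆ s then 1 else 0

theorem coeff_completeOn (s : Finset B) (n : ℕ) (m : B →₀ ℕ)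
    [Decidable (m.degree = n ∧ m.support ⊆ s)] :
    MvPowerSeries.coeff m (completeOn (R := R) s n) =
      if m.degree = n ∧ m.support ⊆ s then 1 else 0 := by
  rw [MvPowerSeries.coeff_apply]
  unfold completeOn
  congr

theorem completeOn_zero (s : Finset B) : completeOn (R := R) s 0 = 1 := by
  classical
  ext m
  rw [coeff_completeOn, MvPowerSeries.coeff_one]
  by_cases hm : m = 0
  · simp [hm]
  · simp [hm, Finsupp.degree_eq_zero_iff]

theorem completeOn_empty_succ (n : ℕ) : completeOn (R := R) (∅ : Finset B) (n + 1) = 0 := by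
  classical
  ext m
  rw [coeff_completeOn, if_neg, map_zero]
  rintro ⟨h1, h2⟩
  rw [Finset.subset_empty, Finsupp.support_eq_empty] at h2
  simp [h2] at h1

/-- The monomials divisible by x_b are exactly x_b times those of one degree less in the same
letters; the others do not involve b. -/
theorem completeOn_insert_succ [DecidableEq B] {s : Finset B} {b : B} (hb : b ∉ s) (n : ℕ) :
    completeOn (R := R) (insert b s) (n + 1) -
      completeOn (insert b s) n * MvPowerSeries.monomial (Finsupp.single b 1) 1 =
        completeOn s (n + 1) := by
  ext m
  rw [map_sub, MvPowerSeries.coeff_mul_monomial, mul_one]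
  simp only [coeff_completeOn]
  by_cases hm : m b = 0
  · rw [if_neg (c := Finsupp.single b 1 ≤ m), sub_zero]
    · have : b ∉ m.support := by simp [hm]
      simp only [Finset.subset_insert_iff_of_notMem this]
    · intro h
      have := h b
      simp [hm] at this
  · obtain ⟨m, rfl⟩ : ∃ m', m = m' + Finsupp.single b 1 := by
      refine ⟨m - Finsupp.single b 1, (tsub_add_cancel_of_le ?_).symm⟩
      rw [Finsupp.single_le_iff]
      omega
    rw [if_pos le_add_self, add_tsub_cancel_right]
    have hd : (m + Finsupp.single b 1).degree = m.degree + 1 := by simp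
    have hs : (m + Finsupp.single b 1).support = insert b m.support := by
      ext x
      by_cases hx : x = b
      · subst hx; simp
      · simp [hx]
    rw [hd, hs]
    have h1 : insert b m.support ⊆ insert b s ↔ m.support ⊆ insert b s := by
      simp [Finset.insert_subset_iff]
    have h2 : ¬ insert b m.support ⊆ s := fun h => hb (h (Finset.mem_insert_self _ _))
    simp [h1, h2]

/-- `∑_n r^n v_j^n h_n[x_b : b ∈ s]`. -/
def omegaOn [DecidableEq J] (s : Finset B) (r : R) (j : J) : MvPowerSeries J (MvPowerSeries B R) :=
  fun g => if g.support ⊆ {j} then MvPowerSeries.C (r ^ g j) * completeOn s (g j) else 0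

theorem coeff_omegaOn [DecidableEq J] (s : Finset B) (r : R) (j : J) (g : J →₀ ℕ) :
    MvPowerSeries.coeff g (omegaOn s r j) =
      if g.support ⊆ {j} then MvPowerSeries.C (r ^ g j) * completeOn s (g j) else 0 :=
  rfl

theorem omegaOn_empty [DecidableEq J] (r : R) (j : J) : omegaOn (∅ : Finset B) r j = 1 := by
  refine MvPowerSeries.ext fun g => ?_
  rw [coeff_omegaOn, MvPowerSeries.coeff_one]
  by_cases hg : g.support ⊆ {j}
  · rw [if_pos hg]
    rcases hn : g j with _ | n
    · have : g = 0 := by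
        ext k
        by_cases hk : k = j
        · rw [hk, hn]; rfl
        · by_contra h
          exact hk (Finset.mem_singleton.1 (hg (Finsupp.mem_support_iff.2 h)))
      simp [completeOn_zero, this]
    · rw [completeOn_empty_succ, mul_zero, if_neg]
      rintro rfl
      simp at hn
  · rw [if_neg hg, if_neg]
    rintro rfl
    simp at hg

theorem omegaOn_insert [DecidableEq J] [DecidableEq B] {s : Finset B} {b : B} (hb : b ∉ s) (r : R)
    (j : J) : omegaOn (insert b s) r j * (1 - r • pairVar j b) = omegaOn s r j := by
  refine MvPowerSeries.ext fun g => ?_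
  rw [mul_sub, mul_one, mul_smul_comm, map_sub, coeff_base_smul, pairVar,
    MvPowerSeries.coeff_mul_monomial]
  simp only [coeff_omegaOn]
  by_cases hg : g.support ⊆ {j}
  · obtain ⟨n, rfl⟩ : ∃ n, g = Finsupp.single j n :=
      ⟨g j, (Finsupp.support_subset_singleton.1 hg)⟩
    cases n with
    | zero => simp [completeOn_zero]
    | succ n =>
      have h1 : Finsupp.single j 1 ≤ Finsupp.single j (n + 1) := by simp
      have h2 : Finsupp.single j (n + 1) - Finsupp.single j 1 = Finsupp.single j n := by
        rw [← Finsupp.single_tsub, Nat.add_sub_cancel]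
      have h3 : ∀ k : ℕ, (Finsupp.single j k).support ⊆ {j} := fun k => Finsupp.support_single_subset
      rw [if_pos h1, h2, if_pos (h3 _), if_pos (h3 _), if_pos (h3 _)]
      simp only [Finsupp.single_eq_same]
      rw [← completeOn_insert_succ hb n, mul_sub, MvPowerSeries.smul_eq_C_mul, pow_succ' r n,
        map_mul]
      ring
  · have hg' : ¬ (g - Finsupp.single j 1).support ⊆ {j} := by
      intro h
      apply hg
      intro k hk
      by_contra hkj
      have hkj' : k ≠ j := by simpa using hkj
      refine hkj (h ?_)
      simpa [Finsupp.single_apply, Ne.symm hkj'] using hk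
    simp [hg, hg']

/-- The generating series of the complete functions is a product of geometric series; each factor
removes one letter. -/
theorem omegaOn_mul_prod [DecidableEq J] (s : Finset B) (r : R) (j : J) :
    omegaOn s r j * ∏ b ∈ s, (1 - r • pairVar j b) = 1 := by
  classical
  induction s using Finset.induction_on with
  | empty => rw [Finset.prod_empty, mul_one, omegaOn_empty]
  | insert b s hb ih => rw [Finset.prod_insert hb, ← mul_assoc, omegaOn_insert hb, ih]

/-- The map from polynomials in the products `v_j x_b` to power series. -/
def pairSeries : MvPolynomial (J × B) R →ₐ[R] MvPowerSeries J (MvPowerSeries B R) :=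
  MvPolynomial.aeval fun p => pairVar p.1 p.2

/-- The exponents of the v_j and of the x_b are the two marginals of u, so they have the same total
degree. The vanishing and truncation arguments rest on this. -/
theorem pairSeries_monomial (u : J × B →₀ ℕ) (r : R) :
    pairSeries (MvPolynomial.monomial u r) = MvPowerSeries.monomial (u.mapDomain Prod.fst)
      (MvPowerSeries.monomial (u.mapDomain Prod.snd) r) := by
  have h1 : (u.prod fun k n => (pairVar k.1 k.2 : MvPowerSeries J (MvPowerSeries B R)) ^ n) =
      MvPowerSeries.monomial (u.mapDomain Prod.fst)
        (MvPowerSeries.monomial (u.mapDomain Prod.snd) 1) := by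
    induction u using Finsupp.induction_linear with
    | zero => simp
    | add u v hu hv =>
      rw [Finsupp.prod_add_index' (fun _ => pow_zero _) (fun _ _ _ => pow_add _ _ _), hu, hv,
        MvPowerSeries.monomial_mul_monomial, MvPowerSeries.monomial_mul_monomial, one_mul,
        Finsupp.mapDomain_add, Finsupp.mapDomain_add]
    | single k n =>
      rw [Finsupp.prod_single_index (h := fun (k : J × B) (n : ℕ) =>
        (pairVar k.1 k.2 : MvPowerSeries J (MvPowerSeries B R)) ^ n) (pow_zero _), pairVar, MvPowerSeries.monomial_pow,
        MvPowerSeries.monomial_pow]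
      simp
  rw [pairSeries, MvPolynomial.aeval_monomial, h1, ← Algebra.smul_def]
  refine MvPowerSeries.ext fun g => ?_
  classical
  rw [coeff_base_smul, MvPowerSeries.coeff_monomial, MvPowerSeries.coeff_monomial]
  split_ifs
  · rw [← map_smul, smul_eq_mul, mul_one]
  · rw [smul_zero]

theorem smul_pairVar (r : R) (j : J) (b : B) :
    r • (pairVar j b : MvPowerSeries J (MvPowerSeries B R)) = MvPowerSeries.monomial
      (Finsupp.single j 1) (r • MvPowerSeries.monomial (Finsupp.single b 1) 1) := by
  classical
  refine MvPowerSeries.ext fun g => ?_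
  rw [coeff_base_smul, pairVar, MvPowerSeries.coeff_monomial, MvPowerSeries.coeff_monomial]
  split_ifs
  · rfl
  · exact smul_zero r

theorem coeff_mul_one_sub_monomial_pow {A : Type*} [CommRing A] {γ : J →₀ ℕ} {N : ℕ}
    (hN : γ.degree < N) (j : J) (x : A) (F : MvPowerSeries J A) :
    MvPowerSeries.coeff γ (F * (1 - MvPowerSeries.monomial (Finsupp.single j 1) x ^ N)) =
      MvPowerSeries.coeff γ F := by
  classical
  rw [mul_sub, mul_one, map_sub, MvPowerSeries.monomial_pow, MvPowerSeries.coeff_mul_monomial,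
    if_neg, sub_zero]
  intro h
  have h1 : N ≤ γ j := by simpa using h j
  have h2 := Finsupp.le_degree j γ
  omega

/-- A quotient by factors `1 - x v_j` agrees up to degree `N` with the quotient in which the
geometric series are truncated. -/
theorem coeff_eq_coeff_mul_geom_sum {A ι : Type*} [CommRing A] (s : Finset ι) (j : ι → J)
    (x : ι → A) {K P : MvPowerSeries J A}
    (hK : K * ∏ y ∈ s, (1 - MvPowerSeries.monomial (Finsupp.single (j y) 1) (x y)) = P)
    {γ : J →₀ ℕ} {N : ℕ} (hN : γ.degree < N) :
    MvPowerSeries.coeff γ K = MvPowerSeries.coeff γ (P * ∏ y ∈ s, ∑ n ∈ Finset.range N,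
      MvPowerSeries.monomial (Finsupp.single (j y) 1) (x y) ^ n) := by
  classical
  -- Each factor times its truncated geometric series is 1 - (x v_j)^N, which is invisible below
  -- degree N.
  rw [← hK, mul_assoc, ← Finset.prod_mul_distrib]
  simp only [mul_neg_geom_sum]
  clear hK
  induction s using Finset.induction_on with
  | empty => simp
  | insert y s hy ih =>
    rw [Finset.prod_insert hy, mul_left_comm, mul_comm, coeff_mul_one_sub_monomial_pow hN, ← ih]

/-- The coefficient of v^γ has degree |γ| in the x_b. If this exceeds ∑ max(η_b, 0), every monomial
in it lowers some η_b below 0. -/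
theorem subAct_coeff_pairSeries_eq_zero {Q₀ : Type*} [Fintype B] [DecidableEq B] (c : B → Q₀)
    (η : B → ℤ) (P : MvPolynomial (J × B) R) {γ : J →₀ ℕ} (hγ : ∑ b, (η b).toNat < γ.degree) :
    subAct c η (MvPowerSeries.coeff γ (pairSeries P)) = 0 := by
  classical
  induction P using MvPolynomial.induction_on' with
  | add p q hp hq => rw [map_add, map_add, map_add, hp, hq, add_zero]
  | monomial u r =>
    rw [pairSeries_monomial, MvPowerSeries.coeff_monomial]
    split_ifs with h
    · rw [subAct_monomial]
      have h1 : (u.mapDomain Prod.snd).degree = γ.degree := by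
        rw [h, Finsupp.degree_mapDomain, Finsupp.degree_mapDomain]
      rw [← h1, Finsupp.degree_eq_sum] at hγ
      obtain ⟨b, -, hb⟩ := Finset.exists_lt_of_sum_lt hγ
      rw [hProd_of_neg (b := b) c (by omega), smul_zero]
    · rw [map_zero]

end Kernel

end

section

/-! ### From series coefficients to multiplication of Laurent polynomials -/

section Evaluation

variable {Q₀ R B B' J : Type*} [CommRing R] [Fintype B] [Fintype B'] [Fintype J]

/-- The linear map `x^γ ↦ ∏_b h_{γ_b}[X^{(c b)}]` on Laurent polynomials. -/
def hEval (c : B → Q₀) : AddMonoidAlgebra R (B → ℤ) →ₗ[R] SymFun Q₀ R :=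
  (Finsupp.linearCombination R (hProd c)).comp
    (AddMonoidAlgebra.coeffLinearEquiv R).toLinearMap

theorem hEval_single (c : B → Q₀) (γ : B → ℤ) (r : R) :
    hEval c (AddMonoidAlgebra.single γ r) = r • hProd c γ := by
  simp [hEval, AddMonoidAlgebra.coeffLinearEquiv]

/-- The Laurent monomial `x_y / x_z`. -/
def ratio (R : Type*) [CommRing R] [DecidableEq B] (y z : B) : AddMonoidAlgebra R (B → ℤ) :=
  AddMonoidAlgebra.single (Pi.single y 1 - Pi.single z 1) 1

variable [DecidableEq B] [DecidableEq J]

/-- The homomorphism `v_j x_b ↦ x_j / x_b`. -/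
def pairLaurent : MvPolynomial (J × B) R →ₐ[R] AddMonoidAlgebra R (J ⊕ B → ℤ) :=
  MvPolynomial.aeval fun p => ratio R (Sum.inl p.1) (Sum.inr p.2)

theorem pairLaurent_monomial (u : J × B →₀ ℕ) (r : R) :
    pairLaurent (MvPolynomial.monomial u r) = AddMonoidAlgebra.single
      (Sum.elim (fun j => (u.mapDomain Prod.fst j : ℤ)) fun b => -(u.mapDomain Prod.snd b : ℤ)) r := by
  have h1 : (u.prod fun k n => (ratio R (Sum.inl k.1) (Sum.inr k.2) : AddMonoidAlgebra R (J ⊕ B → ℤ)) ^ n) =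
      AddMonoidAlgebra.single (Sum.elim (fun j => (u.mapDomain Prod.fst j : ℤ))
        fun b => -(u.mapDomain Prod.snd b : ℤ)) 1 := by
    induction u using Finsupp.induction_linear with
    | zero =>
      rw [Finsupp.prod_zero_index, AddMonoidAlgebra.one_def]
      congr 1
      ext (j | b) <;> simp
    | add u v hu hv =>
      rw [Finsupp.prod_add_index' (fun _ => pow_zero _) (fun _ _ _ => pow_add _ _ _), hu, hv,
        AddMonoidAlgebra.single_mul_single, one_mul, Finsupp.mapDomain_add, Finsupp.mapDomain_add]
      congr 1
      ext (j | b) <;> simp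
      ring
    | single k n =>
      rw [Finsupp.prod_single_index (h := fun (k : J × B) (n : ℕ) =>
        (ratio R (Sum.inl k.1) (Sum.inr k.2) : AddMonoidAlgebra R (J ⊕ B → ℤ)) ^ n) (pow_zero _),
        ratio, AddMonoidAlgebra.single_pow, one_pow]
      congr 1
      ext (j | b)
      · simp [Finsupp.single_apply, Pi.single_apply, eq_comm]
      · simp [Finsupp.single_apply, Pi.single_apply, eq_comm]
  rw [pairLaurent, MvPolynomial.aeval_monomial, h1, ← Algebra.smul_def,
    AddMonoidAlgebra.smul_single, smul_eq_mul, mul_one]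

theorem hProd_sumElim (c : B → Q₀) (c' : J → Q₀) (β : J → ℤ) (η : B → ℤ) :
    (hProd (Sum.elim c' c) (Sum.elim β η) : SymFun Q₀ R) = hProd c' β * hProd c η := by
  simp [hProd]

/-- A monomial v^γ x^e raises β by γ and lowers η by e, which is multiplication by the image of the
monomial under v_j x_b ↦ x_j/x_b. -/
theorem finsum_hProd_mul_subAct (c : B → Q₀) (c' : J → Q₀) (β : J → ℤ) (η : B → ℤ)
    (P : MvPolynomial (J × B) R) :
    ∑ᶠ γ : J →₀ ℕ, hProd c' (fun j => β j + γ j) *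
        subAct c η (MvPowerSeries.coeff γ (pairSeries P)) =
      hEval (Sum.elim c' c) (AddMonoidAlgebra.single (Sum.elim β η) 1 * pairLaurent P) := by
  classical
  -- Outside this box some coordinate, hence the degree, exceeds ∑ max(η_b, 0), and the term
  -- vanishes.
  set Γ : Finset (J →₀ ℕ) :=
    Finset.Iic (Finsupp.equivFunOnFinite.symm fun _ => ∑ b, (η b).toNat) with hΓ
  have hmem : ∀ γ : J →₀ ℕ, γ ∉ Γ → ∑ b, (η b).toNat < γ.degree := by
    intro γ hγ
    rw [hΓ, Finset.mem_Iic, Finsupp.le_def] at hγ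
    push Not at hγ
    obtain ⟨j, hj⟩ := hγ
    exact lt_of_lt_of_le hj (Finsupp.le_degree j γ)
  rw [finsum_eq_sum_of_support_subset (s := Γ)]
  · induction P using MvPolynomial.induction_on' with
    | add p q hp hq => simp only [map_add, mul_add, Finset.sum_add_distrib, hp, hq]
    | monomial u r =>
      simp only [pairSeries_monomial, MvPowerSeries.coeff_monomial, apply_ite (subAct c η), map_zero,
        mul_ite, mul_zero, Finset.sum_ite_eq', subAct_monomial]
      rw [pairLaurent_monomial, AddMonoidAlgebra.single_mul_single, one_mul, hEval_single]
      have h1 : (Sum.elim β η + Sum.elim (fun j => (u.mapDomain Prod.fst j : ℤ))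
          fun b => -(u.mapDomain Prod.snd b : ℤ)) = Sum.elim
          (fun j => β j + (u.mapDomain Prod.fst j : ℤ)) fun b => η b - u.mapDomain Prod.snd b := by
        ext (j | b) <;> simp [sub_eq_add_neg]
      rw [h1, hProd_sumElim, mul_smul_comm]
      split_ifs with h
      · rfl
      -- If the exponent of the monomial lies outside the box, the right side must vanish too; the
      -- degree argument with coefficient 1 shows this.
      · have h2 := hmem _ h
        have h3 := subAct_coeff_pairSeries_eq_zero c η (MvPolynomial.monomial u (1 : R)) h2
        rw [pairSeries_monomial, MvPowerSeries.coeff_monomial_same, subAct_monomial, one_smul] at h3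
        rw [h3, mul_zero, smul_zero]
  · intro γ hγ
    by_contra h
    exact hγ (by simp only [subAct_coeff_pairSeries_eq_zero c η P (hmem γ h), mul_zero])

end Evaluation

/-! ### The skewing series of a current, evaluated in letters -/

section Current

variable {Q₀ Q₁ B : Type*} [Fintype Q₁] [DecidableEq Q₀] [Fintype B] [DecidableEq B]

theorem map_realize_omega {a : ℕ} (c : B → Q₀) (i : Q₀) (r : ArrowRing Q₁) (j : Fin a) :
    MvPowerSeries.map (realize c).toRingHom (omega i r j) =
      omegaOn (Finset.univ.filter fun b => c b = i) r j := by
  classical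
  refine MvPowerSeries.ext fun g => ?_
  rw [MvPowerSeries.coeff_map, coeff_omegaOn]
  have h1 : MvPowerSeries.coeff g (omega i r j) =
    if g.support ⊆ {j} then MvPolynomial.C (r ^ g j) * h i (g j) else 0 := rfl
  rw [h1]
  split_ifs
  · simp only [AlgHom.toRingHom_eq_coe, RingHom.coe_coe, map_mul, realize_h]
    congr 1
    · exact (realize (R := ArrowRing Q₁) c).commutes _
    · refine MvPowerSeries.ext fun m => ?_
      rw [coeff_hSeries, coeff_completeOn]
      simp [Finset.subset_iff]
  · exact map_zero _

/-- The numerator `∏ (1 - v_j x_b)` over the letters `b` at the vertex `i`. -/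
def pairNumerator (R : Type*) [CommRing R] (c : B → Q₀) (i : Q₀) (a : ℕ) :
    MvPolynomial (Fin a × B) R :=
  ∏ j : Fin a, ∏ b with c b = i, (1 - MvPolynomial.X (j, b))

/-- The triples (arrow starting at `i`, row `j`, letter at the head of the arrow). -/
def arrowTriples (Q : QuiverData Q₀ Q₁) (c : B → Q₀) (i : Q₀) (a : ℕ) :
    Finset (Q₁ × Fin a × B) :=
  Finset.univ.filter fun x => Q.tail x.1 = i ∧ c x.2.2 = Q.head x.1

/-- The product of the geometric series of the `t_b v_j x_b`, truncated at order `N`. -/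
def pairGeom (Q : QuiverData Q₀ Q₁) (c : B → Q₀) (i : Q₀) (a N : ℕ) :
    MvPolynomial (Fin a × B) (ArrowRing Q₁) :=
  ∏ x ∈ arrowTriples Q c i a, ∑ n ∈ Finset.range N, (arrowVar x.1 • MvPolynomial.X x.2) ^ n

/-- In the letters x_b the skewing series is ∏ (1 - v_j x_b) divided by ∏ (1 - t v_j x_b); the
denominators are cleared so that the right side is a polynomial. -/
theorem map_realize_skewSeries_mul_prod (Q : QuiverData Q₀ Q₁) (c : B → Q₀) (i : Q₀) (a : ℕ) :
    MvPowerSeries.map (realize c).toRingHom (skewSeries Q i a) *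
        ∏ x ∈ arrowTriples Q c i a, (1 - arrowVar x.1 • pairVar x.2.1 x.2.2) =
      pairSeries (pairNumerator (ArrowRing Q₁) c i a) := by
  have hinv : ∀ j : Fin a, MvPowerSeries.map (realize c).toRingHom
      (MvPowerSeries.invOfUnit (omega i (1 : ArrowRing Q₁) j) 1) =
      ∏ b with c b = i, (1 - pairVar j b) := by
    intro j
    have h1 : omega i (1 : ArrowRing Q₁) j * MvPowerSeries.invOfUnit (omega i 1 j) 1 = 1 := by
      apply MvPowerSeries.mul_invOfUnit
      have : MvPowerSeries.coeff 0 (omega i (1 : ArrowRing Q₁) j) =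
        if (0 : Fin a →₀ ℕ).support ⊆ {j} then
          MvPolynomial.C (1 ^ (0 : Fin a →₀ ℕ) j) * h i ((0 : Fin a →₀ ℕ) j : ℕ) else 0 := rfl
      rw [← MvPowerSeries.coeff_zero_eq_constantCoeff_apply, this]
      simp [h_zero]
    have h2 := congr_arg (MvPowerSeries.map (realize (R := ArrowRing Q₁) c).toRingHom) h1
    rw [map_mul, map_one, map_realize_omega] at h2
    have h3 := omegaOn_mul_prod (Finset.univ.filter fun b => c b = i) (1 : ArrowRing Q₁) j
    simp only [one_smul] at h3
    rw [mul_comm] at h2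
    -- Both sides are inverse to the same series Ω[v_j x].
    exact left_inv_eq_right_inv h2 h3
  have harr : (∏ b : Q₁ with Q.tail b = i, ∏ j : Fin a,
      omegaOn (Finset.univ.filter fun x => c x = Q.head b) (arrowVar b) j) *
      ∏ x ∈ arrowTriples Q c i a, (1 - arrowVar x.1 • pairVar x.2.1 x.2.2) = 1 := by
    have : ∏ x ∈ arrowTriples Q c i a, (1 - arrowVar x.1 • pairVar x.2.1 x.2.2 :
          MvPowerSeries (Fin a) (MvPowerSeries B (ArrowRing Q₁))) =
        ∏ b : Q₁ with Q.tail b = i, ∏ j : Fin a, ∏ x with c x = Q.head b,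
          (1 - arrowVar b • pairVar j x) := by
      rw [arrowTriples, Finset.prod_filter, Fintype.prod_prod_type, Finset.prod_filter]
      refine Finset.prod_congr rfl fun b _ => ?_
      rw [Fintype.prod_prod_type]
      by_cases hb : Q.tail b = i
      · simp [hb, Finset.prod_filter]
      · simp [hb]
    rw [this, ← Finset.prod_mul_distrib]
    refine Finset.prod_eq_one fun b _ => ?_
    rw [← Finset.prod_mul_distrib]
    exact Finset.prod_eq_one fun j _ => omegaOn_mul_prod _ _ _
  rw [skewSeries, map_mul, map_prod, map_prod]
  simp only [map_prod, hinv, map_realize_omega]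
  rw [mul_assoc, harr, mul_one, pairNumerator, map_prod]
  simp [map_prod, pairSeries]

theorem coeff_map_realize_skewSeries (Q : QuiverData Q₀ Q₁) (c : B → Q₀) (i : Q₀) (a : ℕ)
    {γ : Fin a →₀ ℕ} {N : ℕ} (hN : γ.degree < N) :
    realize c (MvPowerSeries.coeff γ (skewSeries Q i a)) = MvPowerSeries.coeff γ
      (pairSeries (pairNumerator (ArrowRing Q₁) c i a * pairGeom Q c i a N)) := by
  have h0 := map_realize_skewSeries_mul_prod Q c i a
  simp only [smul_pairVar] at h0
  have h1 := coeff_eq_coeff_mul_geom_sum _ (fun x : Q₁ × Fin a × B => x.2.1)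
    (fun x => arrowVar x.1 • MvPowerSeries.monomial (Finsupp.single x.2.2 1) 1) h0 hN
  rw [MvPowerSeries.coeff_map] at h1
  simp only [← smul_pairVar] at h1
  rw [map_mul, pairGeom, map_prod]
  simp only [map_sum, map_pow, map_smul]
  refine h1.trans ?_
  simp [pairSeries]

/-- One order N serves all γ: below degree N the truncation is exact, and from N on both sides
vanish for degree reasons. -/
theorem skew_skewSeries_hProd (Q : QuiverData Q₀ Q₁) (c : B → Q₀) (i : Q₀) (a : ℕ) (η : B → ℤ)
    {N : ℕ} (hN : ∑ b, (η b).toNat < N) (γ : Fin a →₀ ℕ) :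
    skew (MvPowerSeries.coeff γ (skewSeries Q i a)) (hProd c η) =
      subAct c η (MvPowerSeries.coeff γ
        (pairSeries (pairNumerator (ArrowRing Q₁) c i a * pairGeom Q c i a N))) := by
  rw [skew_hProd]
  by_cases hγ : γ.degree < N
  · rw [coeff_map_realize_skewSeries Q c i a hγ]
  · rw [coeff_map_realize_skewSeries Q c i a (Nat.lt_succ_self γ.degree),
      subAct_coeff_pairSeries_eq_zero c η _ (by omega),
      subAct_coeff_pairSeries_eq_zero c η _ (by omega)]

end Current

end

section

/-! ### Currents as multiplication by Laurent kernels -/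

section CurrentAction

variable {Q₀ Q₁ B : Type*} [Fintype Q₁] [DecidableEq Q₀] [Fintype B] [DecidableEq B]

/-- The homomorphism `u^δ ↦ x^{-δ}` to Laurent polynomials in two sets of variables. -/
def negLaurent (R J B : Type*) [CommRing R] :
    AddMonoidAlgebra ℤ (J → ℤ) →ₐ[ℤ] AddMonoidAlgebra R (J ⊕ B → ℤ) :=
  AddMonoidAlgebra.lift ℤ _ _
    { toFun := fun δ => AddMonoidAlgebra.single (Sum.elim (-δ.toAdd) 0) 1
      map_one' := by
        rw [AddMonoidAlgebra.one_def]
        congr 1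
        ext (j | b) <;> simp
      map_mul' := fun x y => by
        rw [AddMonoidAlgebra.single_mul_single, one_mul]
        congr 1
        ext (j | b) <;> simp
        ring }

theorem negLaurent_single (R J B : Type*) [CommRing R] (δ : J → ℤ) (n : ℤ) :
    negLaurent R J B (AddMonoidAlgebra.single δ n) =
      n • AddMonoidAlgebra.single (Sum.elim (-δ) 0) 1 := by
  rw [negLaurent, AddMonoidAlgebra.lift_single]
  rfl

/-- The factor u^δ lowers the indices of the h's by δ, so 1 - u_q/u_p turns into the raising factor
1 - x_p/x_q. -/
theorem negLaurent_rootFactor (R B : Type*) [CommRing R] [DecidableEq B] (a : ℕ) :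
    negLaurent R (Fin a) B (rootFactor a) =
      ∏ p : Fin a, ∏ q : Fin a with p < q, (1 - ratio R (Sum.inl p) (Sum.inl q)) := by
  rw [rootFactor, map_prod]
  refine Finset.prod_congr rfl fun p _ => ?_
  rw [map_prod]
  refine Finset.prod_congr rfl fun q _ => ?_
  rw [map_sub, map_one, negLaurent_single, one_smul, ratio]
  congr 2
  ext (j | b) <;> simp [Pi.single_apply]

/-- The inclusion of Laurent polynomials in the second set of variables. -/
def inrLaurent (R J B : Type*) [CommRing R] :
    AddMonoidAlgebra R (B → ℤ) →ₐ[R] AddMonoidAlgebra R (J ⊕ B → ℤ) :=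
  AddMonoidAlgebra.mapDomainAlgHom R R
    { toFun := fun η => Sum.elim 0 η
      map_zero' := by ext (j | b) <;> simp
      map_add' := fun x y => by ext (j | b) <;> simp }

theorem inrLaurent_single (R J B : Type*) [CommRing R] (η : B → ℤ) (r : R) :
    inrLaurent R J B (AddMonoidAlgebra.single η r) = AddMonoidAlgebra.single (Sum.elim (0 : J → ℤ) η) r := by
  simp [inrLaurent]

/-- The Laurent polynomial by which a quiver current acts, with the geometric series truncated at
order `N`. -/
def currentKernel (Q : QuiverData Q₀ Q₁) (c : B → Q₀) (i : Q₀) (a N : ℕ) :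
    AddMonoidAlgebra (ArrowRing Q₁) (Fin a ⊕ B → ℤ) :=
  negLaurent _ _ _ (rootFactor a) * pairLaurent (pairNumerator _ c i a * pairGeom Q c i a N)

/-- A `finsum` is additive only for finite supports; this makes currents linear on the values of
`hEval`. -/
theorem finite_skew_hEval (Q : QuiverData Q₀ Q₁) (c : B → Q₀) (i : Q₀) (a : ℕ)
    (F : AddMonoidAlgebra (ArrowRing Q₁) (B → ℤ)) :
    {γ : Fin a →₀ ℕ | skew (MvPowerSeries.coeff γ (skewSeries Q i a)) (hEval c F) ≠ 0}.Finite := by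
  induction F using AddMonoidAlgebra.induction_on with
  | of η =>
    refine (Set.finite_Iic (Finsupp.equivFunOnFinite.symm fun _ => ∑ b, (η b).toNat)).subset ?_
    intro γ hγ
    by_contra h
    apply hγ
    rw [AddMonoidAlgebra.of_apply, hEval_single, one_smul, toAdd_ofAdd,
      skew_skewSeries_hProd Q c i a η (Nat.lt_succ_self _), subAct_coeff_pairSeries_eq_zero]
    rw [Set.mem_Iic, Finsupp.le_def] at h
    push Not at h
    obtain ⟨j, hj⟩ := h
    exact lt_of_lt_of_le hj (Finsupp.le_degree j γ)
  | add x y hx hy =>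
    refine (hx.union hy).subset fun γ hγ => ?_
    by_contra h
    simp only [Set.mem_union, Set.mem_ofPred_eq, not_or, not_not] at h
    exact hγ (by rw [map_add, map_add, h.1, h.2, add_zero])
  | smul r x hx =>
    refine hx.subset fun γ hγ h => hγ ?_
    rw [map_smul, map_smul, h, smul_zero]

theorem finite_support_current (Q : QuiverData Q₀ Q₁) (c : B → Q₀) (i : Q₀) (a : ℕ)
    (F : AddMonoidAlgebra (ArrowRing Q₁) (B → ℤ))
    (k : (Fin a →₀ ℕ) → SymFun Q₀ (ArrowRing Q₁)) :
    (Function.support fun γ : Fin a →₀ ℕ =>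
      k γ * skew (MvPowerSeries.coeff γ (skewSeries Q i a)) (hEval c F)).Finite :=
  (finite_skew_hEval Q c i a F).subset fun γ hγ h => hγ (by simp only [h, mul_zero])

theorem current_hEval_add (Q : QuiverData Q₀ Q₁) (c : B → Q₀) (i : Q₀) (a : ℕ) (β : Fin a → ℤ)
    (F G : AddMonoidAlgebra (ArrowRing Q₁) (B → ℤ)) :
    current Q i a β (hEval c (F + G)) =
      current Q i a β (hEval c F) + current Q i a β (hEval c G) := by
  simp only [current]
  rw [← Finset.sum_add_distrib]
  refine Finset.sum_congr rfl fun δ _ => ?_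
  rw [← smul_add, ← finsum_add_distrib (finite_support_current Q c i a F _)
    (finite_support_current Q c i a G _)]
  simp only [map_add, mul_add]

theorem current_hEval_smul (Q : QuiverData Q₀ Q₁) (c : B → Q₀) (i : Q₀) (a : ℕ) (β : Fin a → ℤ)
    (r : ArrowRing Q₁) (F : AddMonoidAlgebra (ArrowRing Q₁) (B → ℤ)) :
    current Q i a β (hEval c (r • F)) = r • current Q i a β (hEval c F) := by
  simp only [current]
  rw [Finset.smul_sum]
  refine Finset.sum_congr rfl fun δ _ => ?_
  rw [smul_comm r, smul_finsum' r (finite_support_current Q c i a F _)]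
  simp only [map_smul, mul_smul_comm]

/-- Each monomial u^δ of the root factor shifts β to β - δ, so summing over δ multiplies by the
image of the root factor. -/
theorem current_hProd (Q : QuiverData Q₀ Q₁) (c : B → Q₀) (i : Q₀) (a : ℕ) (β : Fin a → ℤ)
    (η : B → ℤ) {N : ℕ} (hN : ∑ b, (η b).toNat < N) :
    current Q i a β (hProd c η) = hEval (Sum.elim (fun _ => i) c)
      (AddMonoidAlgebra.single (Sum.elim β η) 1 * currentKernel Q c i a N) := by
  have h1 : ∀ δ : Fin a → ℤ, ∑ᶠ γ : Fin a →₀ ℕ, (∏ j, h i (β j - δ j + (γ j : ℤ))) *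
      skew (MvPowerSeries.coeff γ (skewSeries Q i a)) (hProd c η) =
      hEval (Sum.elim (fun _ => i) c) (AddMonoidAlgebra.single (Sum.elim (β - δ) η) 1 *
        pairLaurent (pairNumerator _ c i a * pairGeom Q c i a N)) := by
    intro δ
    rw [← finsum_hProd_mul_subAct]
    simp only [skew_skewSeries_hProd Q c i a η hN]
    rfl
  simp only [current, h1]
  have h2 : negLaurent (ArrowRing Q₁) (Fin a) B (rootFactor a) =
      ∑ δ ∈ (rootFactor a).coeff.support, (rootFactor a).coeff δ •
        AddMonoidAlgebra.single (Sum.elim (-δ) 0) 1 := by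
    conv_lhs => rw [← AddMonoidAlgebra.sum_coeff_single (rootFactor a)]
    rw [Finsupp.sum, map_sum]
    exact Finset.sum_congr rfl fun δ _ => negLaurent_single _ _ _ _ _
  rw [currentKernel, h2, Finset.sum_mul, Finset.mul_sum, map_sum]
  refine Finset.sum_congr rfl fun δ _ => ?_
  rw [smul_mul_assoc, mul_smul_comm, map_zsmul, ← mul_assoc, AddMonoidAlgebra.single_mul_single,
    one_mul]
  congr 5
  ext (j | b) <;> simp [sub_eq_add_neg]

/-- The threshold depends on the monomials of F. Allowing every larger N lets two summands share an
order. -/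
theorem current_hEval (Q : QuiverData Q₀ Q₁) (c : B → Q₀) (i : Q₀) (a : ℕ) (β : Fin a → ℤ)
    (F : AddMonoidAlgebra (ArrowRing Q₁) (B → ℤ)) :
    ∃ N₀, ∀ N ≥ N₀, current Q i a β (hEval c F) = hEval (Sum.elim (fun _ => i) c)
      (AddMonoidAlgebra.single (Sum.elim β 0) 1 * currentKernel Q c i a N * inrLaurent _ _ _ F) := by
  induction F using AddMonoidAlgebra.induction_on with
  | of η =>
    refine ⟨∑ b, (η b).toNat + 1, fun N hN => ?_⟩
    have h1 : Sum.elim β (0 : B → ℤ) + Sum.elim (0 : Fin a → ℤ) η = (Sum.elim β η : Fin a ⊕ B → ℤ) := by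
      ext (j | b) <;> simp
    rw [AddMonoidAlgebra.of_apply, hEval_single, one_smul, toAdd_ofAdd, current_hProd Q c i a β _ hN,
      inrLaurent_single, mul_right_comm, AddMonoidAlgebra.single_mul_single, one_mul, h1]
  | add x y hx hy =>
    obtain ⟨N₁, h₁⟩ := hx
    obtain ⟨N₂, h₂⟩ := hy
    refine ⟨max N₁ N₂, fun N hN => ?_⟩
    rw [current_hEval_add, h₁ N (le_of_max_le_left hN), h₂ N (le_of_max_le_right hN), map_add,
      mul_add, map_add]
  | smul r x hx =>
    obtain ⟨N₁, h₁⟩ := hx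
    refine ⟨N₁, fun N hN => ?_⟩
    rw [current_hEval_smul, h₁ N hN, map_smul, mul_smul_comm, map_smul]

theorem pairLaurent_pairNumerator (R : Type*) [CommRing R] (c : B → Q₀) (i : Q₀) (a : ℕ) :
    pairLaurent (pairNumerator R c i a) =
      ∏ j : Fin a, ∏ b with c b = i, (1 - ratio R (Sum.inl j) (Sum.inr b)) := by
  simp [pairNumerator, pairLaurent, map_prod]

theorem pairLaurent_pairGeom (Q : QuiverData Q₀ Q₁) (c : B → Q₀) (i : Q₀) (a N : ℕ) :
    pairLaurent (pairGeom Q c i a N) = ∏ x ∈ arrowTriples Q c i a,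
      ∑ n ∈ Finset.range N, (arrowVar x.1 • ratio _ (Sum.inl x.2.1) (Sum.inr x.2.2)) ^ n := by
  simp [pairGeom, pairLaurent, map_prod]

end CurrentAction

end

section

/-! ### Renaming letters -/

section Reindex

variable {Q₀ R B B' : Type*} [CommRing R]

/-- Renaming the variables of Laurent polynomials. -/
def reindexLaurent (R : Type*) [CommRing R] (σ : B ≃ B') :
    AddMonoidAlgebra R (B → ℤ) →ₐ[R] AddMonoidAlgebra R (B' → ℤ) :=
  AddMonoidAlgebra.mapDomainAlgHom R R
    { toFun := fun η => η ∘ σ.symm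
      map_zero' := rfl
      map_add' := fun _ _ => rfl }

theorem reindexLaurent_single (σ : B ≃ B') (η : B → ℤ) (r : R) :
    reindexLaurent R σ (AddMonoidAlgebra.single η r) =
      AddMonoidAlgebra.single (η ∘ σ.symm) r := by
  simp [reindexLaurent]

theorem reindexLaurent_ratio [DecidableEq B] [DecidableEq B'] (σ : B ≃ B') (y z : B) :
    reindexLaurent R σ (ratio R y z) = ratio R (σ y) (σ z) := by
  rw [ratio, reindexLaurent_single, ratio]
  congr 1
  ext b
  simp [Pi.single_apply, Equiv.symm_apply_eq]

theorem inrLaurent_ratio {J : Type*} [DecidableEq B] [DecidableEq J] (y z : B) :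
    inrLaurent R J B (ratio R y z) = ratio R (Sum.inr y) (Sum.inr z) := by
  rw [ratio, inrLaurent_single, ratio]
  congr 1
  ext (j | b) <;> simp [Pi.single_apply]

theorem hEval_reindexLaurent [Fintype B] [Fintype B'] (σ : B ≃ B') (c : B' → Q₀)
    (F : AddMonoidAlgebra R (B → ℤ)) :
    hEval c (reindexLaurent R σ F) = hEval (c ∘ σ) F := by
  induction F using AddMonoidAlgebra.induction_on with
  | of η =>
    rw [AddMonoidAlgebra.of_apply, reindexLaurent_single, hEval_single, hEval_single, hProd, hProd,
      ← Equiv.prod_comp σ]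
    simp
  | add x y hx hy => simp only [map_add, hx, hy]
  | smul r x hx => simp only [map_smul, hx]

end Reindex

/-! ### The Laurent kernel of a whole sequence -/

namespace CurrentSeq

variable {Q₀ Q₁ : Type*} [DecidableEq Q₀] [Fintype Q₁]

/-- `∏ (1 - x_y / x_z)` over the pairs of letters `y` before `z` at the same vertex. -/
def pairDenominator (D : CurrentSeq Q₀) (R : Type*) [CommRing R] :
    AddMonoidAlgebra R (D.Basis → ℤ) :=
  ∏ y, ∏ z, if D.vtx y = D.vtx z ∧ D.Before y z then 1 - ratio R y z else 1

/-- The product of the geometric series of the `t_α x^α`, truncated at an order depending on the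
first letter of the root. -/
def rootGeom (D : CurrentSeq Q₀) (Q : QuiverData Q₀ Q₁) (N : D.Basis → ℕ) :
    AddMonoidAlgebra (ArrowRing Q₁) (D.Basis → ℤ) :=
  ∏ b : Q₁, ∏ y : D.Basis, ∏ z : D.Basis,
    if y.1 < z.1 ∧ Q.tail b = D.vtx y ∧ Q.head b = D.vtx z then
      ∑ n ∈ Finset.range (N y), (arrowVar b • ratio _ y z) ^ n else 1

/-- The triple product splits readily into first block and tail, while the product over roots
matches Kostant partitions; both forms are needed. -/
theorem prod_root {M : Type*} [CommMonoid M] (D : CurrentSeq Q₀) (Q : QuiverData Q₀ Q₁)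
    (f : Q₁ → D.Basis → D.Basis → M) :
    ∏ b : Q₁, ∏ y : D.Basis, ∏ z : D.Basis,
      (if y.1 < z.1 ∧ Q.tail b = D.vtx y ∧ Q.head b = D.vtx z then f b y z else 1) =
    ∏ α : D.Root Q, f α.1.1 α.1.2.1 α.1.2.2 := by
  have h1 := Finset.prod_subtype (F := inferInstanceAs (Fintype (D.Root Q))) (p := fun α : Q₁ × D.Basis × D.Basis =>
      α.2.1.1 < α.2.2.1 ∧ Q.tail α.1 = D.vtx α.2.1 ∧ Q.head α.1 = D.vtx α.2.2)
    (Finset.univ.filter fun α : Q₁ × D.Basis × D.Basis =>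
      α.2.1.1 < α.2.2.1 ∧ Q.tail α.1 = D.vtx α.2.1 ∧ Q.head α.1 = D.vtx α.2.2)
    (fun x => by simp) (fun α => f α.1 α.2.1 α.2.2)
  rw [Finset.prod_filter, Fintype.prod_prod_type] at h1
  refine Eq.trans ?_ h1
  exact Finset.prod_congr rfl fun b _ => by rw [Fintype.prod_prod_type]

theorem arrowVar_ratio_pow (D : CurrentSeq Q₀) (t : ArrowRing Q₁) (y z : D.Basis) (n : ℕ) :
    (t • ratio (ArrowRing Q₁) y z) ^ n =
      AddMonoidAlgebra.single (n • (Pi.single y 1 - Pi.single z 1)) (t ^ n) := by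
  rw [ratio, AddMonoidAlgebra.smul_single, AddMonoidAlgebra.single_pow, smul_eq_mul, mul_one]

theorem single_mul_rootGeom (D : CurrentSeq Q₀) (Q : QuiverData Q₀ Q₁) (N : D.Basis → ℕ)
    [DecidableEq (D.Root Q)] (g : D.Basis → ℤ) :
    AddMonoidAlgebra.single g 1 * D.rootGeom Q N =
      ∑ n ∈ Fintype.piFinset fun α : D.Root Q => Finset.range (N α.1.2.1),
        AddMonoidAlgebra.single (g + ∑ α, n α • D.rootWeight α) (∏ α, arrowVar α.1.1 ^ n α) := by
  rw [rootGeom, prod_root D Q fun b y z => ∑ n ∈ Finset.range (N y), (arrowVar b • ratio _ y z) ^ n,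
    Finset.prod_univ_sum, Finset.mul_sum]
  refine Finset.sum_congr rfl fun n _ => ?_
  simp only [arrowVar_ratio_pow]
  have : ∀ s : Finset (D.Root Q), ∏ α ∈ s, AddMonoidAlgebra.single
      (n α • (Pi.single α.1.2.1 1 - Pi.single α.1.2.2 1 : D.Basis → ℤ))
        ((arrowVar α.1.1 : ArrowRing Q₁) ^ n α) =
      AddMonoidAlgebra.single (∑ α ∈ s, n α • D.rootWeight α) (∏ α ∈ s, arrowVar α.1.1 ^ n α) := by
    intro s
    induction s using Finset.induction_on with
    | empty => simp [AddMonoidAlgebra.one_def]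
    | insert α s hα ih =>
      rw [Finset.prod_insert hα, ih, AddMonoidAlgebra.single_mul_single, Finset.sum_insert hα,
        Finset.prod_insert hα]
      rfl
  rw [this, AddMonoidAlgebra.single_mul_single, one_mul]

/-- Only boundedly many multiples of the roots can be added to a weight within the cone of
nonnegative vectors. -/
theorem exists_bound_of_nonneg (D : CurrentSeq Q₀) (Q : QuiverData Q₀ Q₁) (g : D.Basis → ℤ) :
    ∃ M : ℕ, ∀ n : D.Root Q → ℕ, (∀ b, 0 ≤ (g + ∑ α, n α • D.rootWeight α) b) → ∀ α, n α < M := by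
  -- L weights block k (from 0) by m - k, so every root raises L by at least 1 and preserves the
  -- total S. On nonnegative vectors L ≤ m S, hence each n(α) is at most m S(g) - L(g).
  let L : (D.Basis → ℤ) →+ ℤ :=
    { toFun := fun γ => ∑ b : D.Basis, ((D.m : ℤ) - (b.1 : ℕ)) * γ b
      map_zero' := by simp
      map_add' := by
        intro x y
        simp [mul_add, Finset.sum_add_distrib] }
  let S : (D.Basis → ℤ) →+ ℤ :=
    { toFun := fun γ => ∑ b : D.Basis, γ b
      map_zero' := by simp
      map_add' := by
        intro x y
        simp [Finset.sum_add_distrib] }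
  have hS : ∀ α : D.Root Q, S (D.rootWeight α) = 0 := by
    intro α
    simp [S, rootWeight, Finset.sum_sub_distrib]
  have hL : ∀ α : D.Root Q, 1 ≤ L (D.rootWeight α) := by
    intro α
    have h1 : (α.1.2.1.1 : ℕ) < (α.1.2.2.1 : ℕ) := α.2.1
    have h2 : L (D.rootWeight α) = (α.1.2.2.1 : ℕ) - ((α.1.2.1.1 : ℕ) : ℤ) := by
      simp [L, rootWeight, mul_sub, Finset.sum_sub_distrib, Pi.single_apply]
    rw [h2]
    omega
  refine ⟨(D.m * S g - L g).toNat + 1, fun n hn α => ?_⟩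
  have h1 : S (g + ∑ α, n α • D.rootWeight α) = S g := by
    rw [map_add, map_sum, Finset.sum_eq_zero, add_zero]
    exact fun α _ => by rw [map_nsmul, hS, smul_zero]
  have h2 : L (g + ∑ α, n α • D.rootWeight α) ≤ D.m * S g := by
    rw [← h1]
    change ∑ b : D.Basis, _ ≤ (D.m : ℤ) * ∑ b : D.Basis, _
    rw [Finset.mul_sum]
    exact Finset.sum_le_sum fun b _ => mul_le_mul_of_nonneg_right (by omega) (hn b)
  have h3 : (n α : ℤ) ≤ ∑ β, (n β : ℤ) * L (D.rootWeight β) := by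
    calc (n α : ℤ) ≤ (n α : ℤ) * L (D.rootWeight α) := by
          have := hL α
          nlinarith [Int.natCast_nonneg (n α)]
      _ ≤ _ := Finset.single_le_sum (f := fun β => (n β : ℤ) * L (D.rootWeight β))
          (fun β _ => mul_nonneg (Int.natCast_nonneg _) (by linarith [hL β])) (Finset.mem_univ α)
  have h4 : L (g + ∑ α, n α • D.rootWeight α) = L g + ∑ β, (n β : ℤ) * L (D.rootWeight β) := by
    rw [map_add, map_sum]
    congr 1
    exact Finset.sum_congr rfl fun β _ => by rw [map_nsmul, nsmul_eq_mul]
  omega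

theorem hEval_single_mul_rootGeom (D : CurrentSeq Q₀) (Q : QuiverData Q₀ Q₁) (N : D.Basis → ℕ)
    [DecidableEq (D.Root Q)] (g : D.Basis → ℤ) :
    hEval D.vtx (AddMonoidAlgebra.single g 1 * D.rootGeom Q N) =
      ∑ n ∈ Fintype.piFinset fun α : D.Root Q => Finset.range (N α.1.2.1),
        (∏ α, arrowVar α.1.1 ^ n α : ArrowRing Q₁) •
          hProd D.vtx (g + ∑ α, n α • D.rootWeight α) := by
  rw [single_mul_rootGeom, map_sum]
  simp only [hEval_single]

/-- The value of `hEval` on a multiple of the product of geometric series does not depend on the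
orders of truncation, if these are large. -/
theorem exists_hEval_mul_rootGeom_eq (D : CurrentSeq Q₀) (Q : QuiverData Q₀ Q₁)
    (F : AddMonoidAlgebra (ArrowRing Q₁) (D.Basis → ℤ)) :
    ∃ M : ℕ, ∀ N N' : D.Basis → ℕ, (∀ y, M ≤ N y) → (∀ y, M ≤ N' y) →
      hEval D.vtx (F * D.rootGeom Q N) = hEval D.vtx (F * D.rootGeom Q N') := by
  classical
  induction F using AddMonoidAlgebra.induction_on with
  | of g =>
    obtain ⟨M, hM⟩ := D.exists_bound_of_nonneg Q g
    have key : ∀ N : D.Basis → ℕ, (∀ y, M ≤ N y) →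
        hEval D.vtx (AddMonoidAlgebra.single g 1 * D.rootGeom Q N) =
        hEval D.vtx (AddMonoidAlgebra.single g 1 * D.rootGeom Q fun _ => M) := by
      intro N hN
      rw [hEval_single_mul_rootGeom, hEval_single_mul_rootGeom]
      symm
      apply Finset.sum_subset
      · exact Fintype.piFinset_subset _ _ fun α => Finset.range_subset_range.2 (hN _)
      · intro n _ hn
        -- Beyond the bound the weight leaves the nonnegative cone, so the extra terms are 0.
        have : ∃ b, (g + ∑ α, n α • D.rootWeight α) b < 0 := by
          by_contra h
          push Not at h
          exact hn (Fintype.mem_piFinset.2 fun α => Finset.mem_range.2 (hM n h α))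
        obtain ⟨b, hb⟩ := this
        rw [hProd_of_neg _ hb, smul_zero]
    refine ⟨M, fun N N' hN hN' => ?_⟩
    rw [AddMonoidAlgebra.of_apply]
    exact (key N hN).trans (key N' hN').symm
  | add x y hx hy =>
    obtain ⟨M₁, h₁⟩ := hx
    obtain ⟨M₂, h₂⟩ := hy
    refine ⟨max M₁ M₂, fun N N' hN hN' => ?_⟩
    rw [add_mul, add_mul, map_add, map_add,
      h₁ N N' (fun y => le_of_max_le_left (hN y)) (fun y => le_of_max_le_left (hN' y)),
      h₂ N N' (fun y => le_of_max_le_right (hN y)) (fun y => le_of_max_le_right (hN' y))]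
  | smul r x hx =>
    obtain ⟨M₁, h₁⟩ := hx
    refine ⟨M₁, fun N N' hN hN' => ?_⟩
    rw [smul_mul_assoc, smul_mul_assoc, map_smul, map_smul, h₁ N N' hN hN']

/-! ### Splitting off the first current -/

section Cons

variable {m : ℕ} (vertex : Fin (m + 1) → Q₀) (size : Fin (m + 1) → ℕ) (hs : ∀ k, 0 < size k)

/-- The sequence without its first term. -/
def tail : CurrentSeq Q₀ := ⟨m, fun k => vertex k.succ, fun k => size k.succ, fun k => hs k.succ⟩

/-- The letters of a sequence are those of its first term and those of the tail. -/
def consEquiv : Fin (size 0) ⊕ (tail vertex size hs).Basis ≃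
    (⟨m + 1, vertex, size, hs⟩ : CurrentSeq Q₀).Basis :=
  Equiv.ofBijective (Sum.elim (fun p => ⟨0, p⟩) fun b => ⟨b.1.succ, b.2⟩) (by
    constructor
    · rintro (p | ⟨k, p⟩) (q | ⟨l, q⟩) h
      · exact congr_arg _ (eq_of_heq (Sigma.mk.inj_iff.1 h).2)
      · exact absurd (Sigma.mk.inj_iff.1 h).1.symm (Fin.succ_ne_zero _)
      · exact absurd (Sigma.mk.inj_iff.1 h).1 (Fin.succ_ne_zero _)
      · obtain ⟨h1, h2⟩ := Sigma.mk.inj_iff.1 h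
        obtain rfl := Fin.succ_injective _ h1
        obtain rfl := eq_of_heq h2
        rfl
    · rintro ⟨k, p⟩
      induction k using Fin.cases with
      | zero => exact ⟨Sum.inl p, rfl⟩
      | succ k => exact ⟨Sum.inr ⟨k, p⟩, rfl⟩)

theorem consEquiv_inl (p : Fin (size 0)) : consEquiv vertex size hs (Sum.inl p) = ⟨0, p⟩ := rfl

theorem consEquiv_inr (b : (tail vertex size hs).Basis) :
    consEquiv vertex size hs (Sum.inr b) = ⟨b.1.succ, b.2⟩ := rfl

theorem vtx_comp_consEquiv : (⟨m + 1, vertex, size, hs⟩ : CurrentSeq Q₀).vtx ∘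
    consEquiv vertex size hs = Sum.elim (fun _ => vertex 0) (tail vertex size hs).vtx := by
  funext x
  rcases x with p | b <;> rfl

/-- Pairs inside the first block give the root factor, pairs from it to the tail give the numerator
from Ω[-U^*X], and pairs in the tail give its own product. No tail letter precedes the first block.
-/
theorem pairDenominator_cons (R : Type*) [CommRing R] :
    pairDenominator ⟨m + 1, vertex, size, hs⟩ R = reindexLaurent R (consEquiv vertex size hs)
      (negLaurent R _ _ (rootFactor (size 0)) *
        pairLaurent (pairNumerator R (tail vertex size hs).vtx (vertex 0) (size 0)) *
        inrLaurent R _ _ ((tail vertex size hs).pairDenominator R)) := by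
  rw [pairDenominator, ← Equiv.prod_comp (consEquiv vertex size hs), Fintype.prod_sum_type]
  simp only [← Equiv.prod_comp (consEquiv vertex size hs) (fun z => ite _ _ _),
    Fintype.prod_sum_type, ← reindexLaurent_ratio, Finset.prod_mul_distrib]
  rw [negLaurent_rootFactor, pairLaurent_pairNumerator, pairDenominator]
  simp only [map_mul, map_prod, map_sub, map_one, apply_ite (inrLaurent _ _ _), inrLaurent_ratio,
    apply_ite (reindexLaurent _ _), Finset.prod_filter, reindexLaurent_ratio]
  have h1 : ∀ p q : Fin (size 0), ((vtx ⟨m + 1, vertex, size, hs⟩ (consEquiv vertex size hs (Sum.inl p)) =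
      vtx ⟨m + 1, vertex, size, hs⟩ (consEquiv vertex size hs (Sum.inl q)) ∧
      Before ⟨m + 1, vertex, size, hs⟩ (consEquiv vertex size hs (Sum.inl p))
        (consEquiv vertex size hs (Sum.inl q))) ↔ p < q) := by
    intro p q
    simp [consEquiv_inl, Before, vtx]
  have h2 : ∀ p b, ((vtx ⟨m + 1, vertex, size, hs⟩ (consEquiv vertex size hs (Sum.inl p)) =
      vtx ⟨m + 1, vertex, size, hs⟩ (consEquiv vertex size hs (Sum.inr b)) ∧
      Before ⟨m + 1, vertex, size, hs⟩ (consEquiv vertex size hs (Sum.inl p))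
        (consEquiv vertex size hs (Sum.inr b))) ↔ (tail vertex size hs).vtx b = vertex 0) := by
    intro p b
    exact ⟨fun h => h.1.symm, fun h => ⟨h.symm, Or.inl (Fin.succ_pos _)⟩⟩
  have h3 : ∀ p b, ((vtx ⟨m + 1, vertex, size, hs⟩ (consEquiv vertex size hs (Sum.inr b)) =
      vtx ⟨m + 1, vertex, size, hs⟩ (consEquiv vertex size hs (Sum.inl p)) ∧
      Before ⟨m + 1, vertex, size, hs⟩ (consEquiv vertex size hs (Sum.inr b))
        (consEquiv vertex size hs (Sum.inl p))) ↔ False) := by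
    intro p b
    refine iff_false_intro fun h => ?_
    rcases h.2 with h' | h'
    · exact absurd h' (Fin.not_lt_zero _)
    · exact absurd h'.1 (Fin.succ_ne_zero _)
  have h4 : ∀ b b', ((vtx ⟨m + 1, vertex, size, hs⟩ (consEquiv vertex size hs (Sum.inr b)) =
      vtx ⟨m + 1, vertex, size, hs⟩ (consEquiv vertex size hs (Sum.inr b')) ∧
      Before ⟨m + 1, vertex, size, hs⟩ (consEquiv vertex size hs (Sum.inr b))
        (consEquiv vertex size hs (Sum.inr b'))) ↔ (tail vertex size hs).vtx b =
          (tail vertex size hs).vtx b' ∧ (tail vertex size hs).Before b b') := by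
    intro b b'
    exact and_congr_right fun _ => or_congr Fin.succ_lt_succ_iff
      (and_congr_left' Fin.succ_inj)
  simp only [h1, h2, h3, h4, if_false, Finset.prod_const_one, one_mul]

/-- Roots join different blocks, so they either start in the first block and end in the tail, or lie
in the tail. The two kinds are truncated at different orders in the induction. -/
theorem rootGeom_cons (Q : QuiverData Q₀ Q₁) (N : (⟨m + 1, vertex, size, hs⟩ : CurrentSeq Q₀).Basis → ℕ)
    (N₀ N₁ : ℕ) (hN₀ : ∀ p, N ⟨0, p⟩ = N₀)
    (hN₁ : ∀ b : (tail vertex size hs).Basis, N ⟨b.1.succ, b.2⟩ = N₁) :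
    rootGeom ⟨m + 1, vertex, size, hs⟩ Q N = reindexLaurent _ (consEquiv vertex size hs)
      (pairLaurent (pairGeom Q (tail vertex size hs).vtx (vertex 0) (size 0) N₀) *
        inrLaurent _ _ _ ((tail vertex size hs).rootGeom Q fun _ => N₁)) := by
  rw [pairLaurent_pairGeom, rootGeom, rootGeom, arrowTriples, Finset.prod_filter,
    Fintype.prod_prod_type, map_prod, ← Finset.prod_mul_distrib, map_prod]
  refine Finset.prod_congr rfl fun b _ => ?_
  rw [← Equiv.prod_comp (consEquiv vertex size hs), Fintype.prod_sum_type, map_mul,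
    Fintype.prod_prod_type]
  simp only [← Equiv.prod_comp (consEquiv vertex size hs) (fun z => ite _ _ _),
    Fintype.prod_sum_type, Finset.prod_mul_distrib]
  have h1 : ∀ p q : Fin (size 0), ((consEquiv vertex size hs (Sum.inl p)).1 <
      (consEquiv vertex size hs (Sum.inl q)).1 ∧
      Q.tail b = vtx ⟨m + 1, vertex, size, hs⟩ (consEquiv vertex size hs (Sum.inl p)) ∧
      Q.head b = vtx ⟨m + 1, vertex, size, hs⟩ (consEquiv vertex size hs (Sum.inl q))) ↔ False :=
    fun p q => iff_false_intro fun h => absurd h.1 (lt_irrefl _)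
  have h2 : ∀ p x, ((consEquiv vertex size hs (Sum.inl p)).1 <
      (consEquiv vertex size hs (Sum.inr x)).1 ∧
      Q.tail b = vtx ⟨m + 1, vertex, size, hs⟩ (consEquiv vertex size hs (Sum.inl p)) ∧
      Q.head b = vtx ⟨m + 1, vertex, size, hs⟩ (consEquiv vertex size hs (Sum.inr x))) ↔
      Q.tail b = vertex 0 ∧ (tail vertex size hs).vtx x = Q.head b :=
    fun p x => ⟨fun h => ⟨h.2.1, h.2.2.symm⟩, fun h => ⟨Fin.succ_pos _, h.1, h.2.symm⟩⟩
  have h3 : ∀ x p, ((consEquiv vertex size hs (Sum.inr x)).1 <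
      (consEquiv vertex size hs (Sum.inl p)).1 ∧
      Q.tail b = vtx ⟨m + 1, vertex, size, hs⟩ (consEquiv vertex size hs (Sum.inr x)) ∧
      Q.head b = vtx ⟨m + 1, vertex, size, hs⟩ (consEquiv vertex size hs (Sum.inl p))) ↔ False :=
    fun x p => iff_false_intro fun h => absurd h.1 (Fin.not_lt_zero _)
  have h4 : ∀ x x', ((consEquiv vertex size hs (Sum.inr x)).1 <
      (consEquiv vertex size hs (Sum.inr x')).1 ∧
      Q.tail b = vtx ⟨m + 1, vertex, size, hs⟩ (consEquiv vertex size hs (Sum.inr x)) ∧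
      Q.head b = vtx ⟨m + 1, vertex, size, hs⟩ (consEquiv vertex size hs (Sum.inr x'))) ↔
      x.1 < x'.1 ∧ Q.tail b = (tail vertex size hs).vtx x ∧
        Q.head b = (tail vertex size hs).vtx x' :=
    fun x x' => and_congr_left' Fin.succ_lt_succ_iff
  have h5 : ∀ p, N (consEquiv vertex size hs (Sum.inl p)) = N₀ := hN₀
  have h6 : ∀ x, N (consEquiv vertex size hs (Sum.inr x)) = N₁ := hN₁
  simp only [h1, h2, h3, h4, h5, h6, if_false, Finset.prod_const_one, one_mul, map_prod,
    apply_ite (inrLaurent _ _ _), apply_ite (reindexLaurent _ _), map_sum, map_pow, map_smul,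
    inrLaurent_ratio, reindexLaurent_ratio, map_one]

end Cons

/-- The quiver Hall-Littlewood symmetric function is the value at a Laurent polynomial of the map
sending monomials to products of complete homogeneous functions. -/
theorem exists_hallLittlewood_eq_hEval (D : CurrentSeq Q₀) (Q : QuiverData Q₀ Q₁)
    (μ : ∀ k, Fin (D.size k) → ℤ) : ∃ M : ℕ, ∀ N : D.Basis → ℕ, (∀ y, M ≤ N y) →
      D.hallLittlewood Q μ = hEval D.vtx (AddMonoidAlgebra.single (D.concat μ) 1 *
        D.pairDenominator (ArrowRing Q₁) * D.rootGeom Q N) := by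
  obtain ⟨m, vertex, size, hs⟩ := D
  induction m with
  | zero =>
    refine ⟨0, fun N _ => ?_⟩
    have : IsEmpty (⟨0, vertex, size, hs⟩ : CurrentSeq Q₀).Basis :=
      ⟨fun b => Fin.elim0 b.1⟩
    have h1 : hallLittlewood ⟨0, vertex, size, hs⟩ Q μ = 1 := rfl
    rw [h1, pairDenominator, rootGeom]
    simp [hEval_single, hProd]
  | succ m ih =>
    obtain ⟨M₁, hM₁⟩ := ih (fun k => vertex k.succ) (fun k => size k.succ) (fun k => hs k.succ)
      fun k => μ k.succ
    -- All truncations beyond M₂ agree, so the one built by the induction, of order max N₀ M₂ on the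
    -- first block and max M₁ M₂ on the tail, stands for all of them.
    obtain ⟨M₂, hM₂⟩ := exists_hEval_mul_rootGeom_eq ⟨m + 1, vertex, size, hs⟩ Q
      (AddMonoidAlgebra.single (concat ⟨m + 1, vertex, size, hs⟩ μ) 1 *
        pairDenominator ⟨m + 1, vertex, size, hs⟩ (ArrowRing Q₁))
    have h1 : hallLittlewood ⟨m + 1, vertex, size, hs⟩ Q μ =
        current Q (vertex 0) (size 0) (μ 0)
          ((tail vertex size hs).hallLittlewood Q fun k => μ k.succ) := by
      simp only [hallLittlewood, List.finRange_succ, List.foldr_cons, List.foldr_map]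
      rfl
    have h2 := hM₁ (fun _ => max M₁ M₂) fun _ => le_max_left _ _
    -- N₀ depends on the Laurent polynomial of the tail, so the tail's truncation order has to be
    -- fixed before.
    obtain ⟨N₀, hN₀⟩ := current_hEval Q (tail vertex size hs).vtx (vertex 0) (size 0) (μ 0)
      (AddMonoidAlgebra.single (concat (tail vertex size hs) fun k => μ k.succ) 1 *
        (tail vertex size hs).pairDenominator (ArrowRing Q₁) *
          (tail vertex size hs).rootGeom Q fun _ => max M₁ M₂)
    have h3 := hN₀ (max N₀ M₂) (le_max_left _ _)
    refine ⟨M₂, fun N hN => ?_⟩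
    have h4 : (AddMonoidAlgebra.single (concat ⟨m + 1, vertex, size, hs⟩ μ) 1 :
        AddMonoidAlgebra (ArrowRing Q₁) _) = reindexLaurent _ (consEquiv vertex size hs)
          (AddMonoidAlgebra.single (Sum.elim (μ 0) 0) 1 * inrLaurent _ _ _
            (AddMonoidAlgebra.single (concat (tail vertex size hs) fun k => μ k.succ) 1)) := by
      rw [inrLaurent_single, AddMonoidAlgebra.single_mul_single, reindexLaurent_single, one_mul]
      congr 1
      funext b
      obtain ⟨x, rfl⟩ := (consEquiv vertex size hs).surjective b
      rw [Function.comp_apply, Equiv.symm_apply_apply]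
      rcases x with p | b
      · simp [consEquiv_inl, concat]
      · simp [consEquiv_inr, concat]
    rw [hM₂ N (fun y => if (y.1 : ℕ) = 0 then max N₀ M₂ else max M₁ M₂) hN
      (fun y => by dsimp only; split_ifs <;> exact le_max_right _ _),
      rootGeom_cons vertex size hs Q _ (max N₀ M₂) (max M₁ M₂) (fun p => if_pos rfl)
        (fun b => if_neg (Nat.succ_ne_zero _)), pairDenominator_cons, h4, ← map_mul, ← map_mul,
      hEval_reindexLaurent, vtx_comp_consEquiv, h1]
    refine (congr_arg (current Q (vertex 0) (size 0) (μ 0)) h2).trans (h3.trans ?_)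
    refine congr_arg (hEval _) ?_
    simp only [currentKernel, map_mul]
    ring

end CurrentSeq

end

section

/-! ### Rows, Weyl group and straightening of weights -/

namespace CurrentSeq

variable {Q₀ : Type*} [DecidableEq Q₀] (D : CurrentSeq Q₀)

theorem Before.trans {D : CurrentSeq Q₀} {x y z : D.Basis} (hxy : D.Before x y)
    (hyz : D.Before y z) : D.Before x z := by
  rcases hxy with h1 | ⟨h1, h1'⟩ <;> rcases hyz with h2 | ⟨h2, h2'⟩
  · exact Or.inl (h1.trans h2)
  · exact Or.inl (h2 ▸ h1)
  · exact Or.inl (h1 ▸ h2)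
  · exact Or.inr ⟨h1.trans h2, h1'.trans h2'⟩

theorem not_before_self (x : D.Basis) : ¬ D.Before x x := by
  rintro (h | ⟨_, h⟩) <;> exact lt_irrefl _ h

theorem before_or_before {x y : D.Basis} (h : x ≠ y) : D.Before x y ∨ D.Before y x := by
  obtain ⟨k, p⟩ := x
  obtain ⟨l, q⟩ := y
  rcases lt_trichotomy k l with hkl | rfl | hkl
  · exact Or.inl (Or.inl hkl)
  · have hpq : p ≠ q := fun hpq => h (by rw [hpq])
    rcases lt_or_gt_of_ne hpq with hpq | hpq
    · exact Or.inl (Or.inr ⟨rfl, hpq⟩)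
    · exact Or.inr (Or.inr ⟨rfl, hpq⟩)
  · exact Or.inr (Or.inl hkl)

theorem row_lt_row {x y : D.Basis} (hv : D.vtx x = D.vtx y) (h : D.Before x y) :
    D.row x < D.row y := by
  apply Finset.card_lt_card
  refine ⟨fun z hz => ?_, fun hsub => ?_⟩
  · simp only [Finset.mem_filter, Finset.mem_univ, true_and] at hz ⊢
    exact ⟨hz.1.trans hv, hz.2.trans h⟩
  · have := hsub (Finset.mem_filter.2 ⟨Finset.mem_univ x, hv, h⟩)
    exact D.not_before_self x (Finset.mem_filter.1 this).2.2

theorem row_lt_row_iff {x y : D.Basis} (hv : D.vtx x = D.vtx y) :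
    D.row x < D.row y ↔ D.Before x y := by
  refine ⟨fun h => ?_, D.row_lt_row hv⟩
  have hne : x ≠ y := by
    rintro rfl
    exact lt_irrefl _ h
  rcases D.before_or_before hne with hb | hb
  · exact hb
  · exact absurd (D.row_lt_row hv.symm hb) (not_lt.2 h.le)

theorem eq_of_row_eq {x y : D.Basis} (hv : D.vtx x = D.vtx y) (h : D.row x = D.row y) : x = y := by
  by_contra hne
  rcases D.before_or_before hne with hb | hb
  · exact absurd (D.row_lt_row hv hb) (by omega)
  · exact absurd (D.row_lt_row hv.symm hb) (by omega)

theorem card_vtx_eq (i : Q₀) : (Finset.univ.filter fun b => D.vtx b = i).card = D.dim i := by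
  rw [dim, Finset.card_filter, Fintype.sum_sigma, Finset.sum_filter]
  refine Finset.sum_congr rfl fun k _ => ?_
  have : ∀ p : Fin (D.size k), (D.vtx ⟨k, p⟩ = i) ↔ D.vertex k = i := fun p => Iff.rfl
  simp only [this]
  split_ifs <;> simp

/-- The letters at the vertex of b are b, those before it and those after it. -/
theorem row_add_rho (b : D.Basis) : (D.row b : ℤ) + D.rho b + 1 = D.dim (D.vtx b) := by
  have h1 : (Finset.univ.filter fun b' => D.vtx b' = D.vtx b) =
      insert b ((Finset.univ.filter fun b' => D.vtx b' = D.vtx b ∧ D.Before b' b) ∪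
        Finset.univ.filter fun b' => D.vtx b' = D.vtx b ∧ D.Before b b') := by
    ext x
    simp only [Finset.mem_filter, Finset.mem_univ, true_and, Finset.mem_insert, Finset.mem_union]
    constructor
    · intro hx
      by_cases hxb : x = b
      · exact Or.inl hxb
      · rcases D.before_or_before hxb with h | h
        · exact Or.inr (Or.inl ⟨hx, h⟩)
        · exact Or.inr (Or.inr ⟨hx, h⟩)
    · rintro (rfl | h | h)
      · rfl
      · exact h.1
      · exact h.1
  rw [← card_vtx_eq, h1, Finset.card_insert_of_notMem, Finset.card_union_of_disjoint]
  · rw [row, rho]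
    push_cast
    ring
  · rw [Finset.disjoint_left]
    intro x hx hx'
    simp only [Finset.mem_filter, Finset.mem_univ, true_and] at hx hx'
    exact D.not_before_self x (hx.2.trans hx'.2)
  · simp [D.not_before_self b]

theorem rho_nonneg (b : D.Basis) : 0 ≤ D.rho b := Int.natCast_nonneg _

theorem row_lt_dim (b : D.Basis) : D.row b < D.dim (D.vtx b) := by
  have := D.row_add_rho b
  have := D.rho_nonneg b
  omega

/-- The letters at the vertex `i`, numbered by their rows. -/
def letterEquiv (i : Q₀) : {b : D.Basis // D.vtx b = i} ≃ Fin (D.dim i) :=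
  Equiv.ofBijective (fun b => ⟨D.row b.1, (D.row_lt_dim b.1).trans_eq (congr_arg D.dim b.2)⟩) (by
    rw [Fintype.bijective_iff_injective_and_card]
    refine ⟨fun x y h => Subtype.ext (D.eq_of_row_eq (x.2.trans y.2.symm) (Fin.mk.inj_iff.1 h)), ?_⟩
    rw [Fintype.card_fin, ← card_vtx_eq, Fintype.card_subtype])

/-- The letter at the vertex `i` in row `p`. -/
def letter (i : Q₀) (p : Fin (D.dim i)) : D.Basis := ((D.letterEquiv i).symm p).1

theorem vtx_letter (i : Q₀) (p : Fin (D.dim i)) : D.vtx (D.letter i p) = i :=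
  ((D.letterEquiv i).symm p).2

theorem row_letter (i : Q₀) (p : Fin (D.dim i)) : D.row (D.letter i p) = p :=
  congr_arg Fin.val ((D.letterEquiv i).apply_symm_apply p)

theorem exists_letter {i : Q₀} {b : D.Basis} (hb : D.vtx b = i) : ∃ p, D.letter i p = b := by
  subst hb
  exact ⟨⟨D.row b, D.row_lt_dim b⟩, D.eq_of_row_eq (D.vtx_letter _ _) (D.row_letter _ _)⟩

theorem before_letter {i : Q₀} {p q : Fin (D.dim i)} :
    D.Before (D.letter i p) (D.letter i q) ↔ p < q := by
  rw [← D.row_lt_row_iff (by rw [vtx_letter, vtx_letter]), row_letter, row_letter]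
  rfl

theorem rho_letter (i : Q₀) (p : Fin (D.dim i)) : D.rho (D.letter i p) = D.dim i - 1 - p := by
  have := D.row_add_rho (D.letter i p)
  rw [vtx_letter, row_letter] at this
  omega

/-- The letters as pairs of a vertex and a row. -/
def sigmaLetter : (Σ i, Fin (D.dim i)) ≃ D.Basis :=
  (Equiv.sigmaCongrRight fun i => (D.letterEquiv i).symm).trans (Equiv.sigmaFiberEquiv D.vtx)

theorem sigmaLetter_apply (i : Q₀) (p : Fin (D.dim i)) : D.sigmaLetter ⟨i, p⟩ = D.letter i p := rfl

theorem prod_letter [Fintype Q₀] {M : Type*} [CommMonoid M] (f : D.Basis → M) :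
    ∏ b, f b = ∏ i, ∏ p, f (D.letter i p) := by
  rw [← Equiv.prod_comp D.sigmaLetter, Fintype.prod_sigma]
  rfl

theorem sum_letter [Fintype Q₀] {M : Type*} [AddCommMonoid M] (f : D.Basis → M) :
    ∑ b, f b = ∑ i, ∑ p, f (D.letter i p) := by
  rw [← Equiv.sum_comp D.sigmaLetter, Fintype.sum_sigma]
  rfl

theorem mem_weyl {w : Equiv.Perm D.Basis} : w ∈ D.weyl ↔ ∀ b, D.vtx (w b) = D.vtx b := by
  simp [weyl]

theorem mul_mem_weyl {v w : Equiv.Perm D.Basis} (hv : v ∈ D.weyl) (hw : w ∈ D.weyl) :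
    v * w ∈ D.weyl := by
  rw [mem_weyl] at *
  intro b
  rw [Equiv.Perm.mul_apply, hv, hw]

theorem inv_mem_weyl {w : Equiv.Perm D.Basis} (hw : w ∈ D.weyl) : w⁻¹ ∈ D.weyl := by
  rw [mem_weyl] at *
  intro b
  have h := hw (w⁻¹ b)
  rwa [show w (w⁻¹ b) = b from w.apply_symm_apply b, eq_comm] at h

theorem one_mem_weyl : 1 ∈ D.weyl := D.mem_weyl.2 fun _ => rfl

theorem swap_mem_weyl {x y : D.Basis} (h : D.vtx x = D.vtx y) : Equiv.swap x y ∈ D.weyl := by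
  rw [mem_weyl]
  intro b
  rw [Equiv.swap_apply_def]
  split_ifs with h1 h2
  · rw [h1, h]
  · rw [h2, h]
  · rfl

/-! ### Regular weights -/

/-- A weight is strictly dominant if it is strictly decreasing at every vertex. -/
def IsStrictDominant (g : D.Basis → ℤ) : Prop :=
  ∀ b b', D.vtx b = D.vtx b' → D.Before b b' → g b' < g b

variable {D}

theorem IsStrictDominant.before_iff {g : D.Basis → ℤ} (hg : D.IsStrictDominant g) {b b' : D.Basis}
    (h : D.vtx b = D.vtx b') : D.Before b b' ↔ g b' < g b := by
  refine ⟨hg b b' h, fun hlt => ?_⟩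
  have hne : b ≠ b' := by
    rintro rfl
    exact lt_irrefl _ hlt
  rcases D.before_or_before hne with hb | hb
  · exact hb
  · exact absurd (hg b' b h.symm hb) (not_lt.2 hlt.le)

theorem IsDominant.add_rho {lam : D.Basis → ℤ} (hl : D.IsDominant lam) :
    D.IsStrictDominant (lam + D.rho) := by
  intro b b' h hb
  have h1 := hl b b' h hb
  have h2 := D.row_lt_row h hb
  have h3 := D.row_add_rho b
  have h4 := D.row_add_rho b'
  rw [← h] at h4
  simp only [Pi.add_apply]
  omega

/-- A strictly decreasing integer sequence drops by at least d over d steps, and ρ drops by exactly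
d. -/
theorem IsStrictDominant.sub_rho {g : D.Basis → ℤ} (hg : D.IsStrictDominant g) :
    D.IsDominant (g - D.rho) := by
  have key : ∀ (i : Q₀) (d : ℕ) (p q : Fin (D.dim i)), (q : ℕ) = p + d →
      g (D.letter i q) + d ≤ g (D.letter i p) := by
    intro i d
    induction d with
    | zero =>
      intro p q h
      have : q = p := Fin.ext (by omega)
      simp [this]
    | succ d ih =>
      intro p q h
      have h1 := ih p ⟨p + d, by omega⟩ rfl
      have h2 := hg (D.letter i ⟨p + d, by omega⟩) (D.letter i q)
        (by rw [D.vtx_letter, D.vtx_letter]) (D.before_letter.2 (Fin.lt_def.2 (by simp only; omega)))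
      push_cast
      omega
  intro b b' h hb
  obtain ⟨p, hp⟩ := D.exists_letter (rfl : D.vtx b = _)
  obtain ⟨q, hq⟩ := D.exists_letter h.symm
  rw [← hp, ← hq] at hb ⊢
  have hpq := D.before_letter.1 hb
  have h1 := key _ (q - p : ℕ) p q (by have := Fin.lt_def.1 hpq; omega)
  simp only [Pi.sub_apply, D.rho_letter]
  have := Fin.lt_def.1 hpq
  omega

/-- The row of w b can be read off from g ∘ w: it counts the letters at the vertex of b with a
larger value. -/
theorem IsStrictDominant.unique {g g' : D.Basis → ℤ} (hg : D.IsStrictDominant g)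
    (hg' : D.IsStrictDominant g') {w w' : Equiv.Perm D.Basis} (hw : w ∈ D.weyl) (hw' : w' ∈ D.weyl)
    (h : g ∘ w = g' ∘ w') : w = w' ∧ g = g' := by
  have hrow : ∀ b, D.row (w b) = D.row (w' b) := by
    intro b
    have h1 : ∀ (u : Equiv.Perm D.Basis) (f : D.Basis → ℤ), u ∈ D.weyl → D.IsStrictDominant f →
        D.row (u b) = (Finset.univ.filter fun b' => D.vtx b' = D.vtx b ∧
          (f ∘ u) b < (f ∘ u) b').card := by
      intro u f hu hf
      rw [mem_weyl] at hu
      rw [row]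
      symm
      apply Finset.card_bij (fun b' _ => u b')
      · intro b' hb'
        simp only [Finset.mem_filter, Finset.mem_univ, true_and] at hb' ⊢
        have hv : D.vtx (u b') = D.vtx (u b) := by rw [hu, hu, hb'.1]
        exact ⟨hv, (hf.before_iff hv).2 hb'.2⟩
      · intro x _ y _ hxy
        exact u.injective hxy
      · intro c hc
        simp only [Finset.mem_filter, Finset.mem_univ, true_and] at hc
        have huc : u (u⁻¹ c) = c := u.apply_symm_apply c
        refine ⟨u⁻¹ c, ?_, huc⟩
        simp only [Finset.mem_filter, Finset.mem_univ, true_and, Function.comp_apply,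
          huc]
        refine ⟨?_, hf _ _ hc.1 hc.2⟩
        rw [← hu, huc, hc.1, hu]
    rw [h1 w g hw hg, h1 w' g' hw' hg', h]
  rw [mem_weyl] at hw hw'
  have hww : w = w' := Equiv.ext fun b => D.eq_of_row_eq (by rw [hw, hw']) (hrow b)
  refine ⟨hww, ?_⟩
  subst hww
  funext b
  simpa using congr_fun h (w⁻¹ b)

theorem exists_isStrictDominant {g : D.Basis → ℤ}
    (hg : ∀ b b', D.vtx b = D.vtx b' → g b = g b' → b = b') :
    ∃ w ∈ D.weyl, D.IsStrictDominant (g ∘ ⇑w⁻¹) := by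
  -- Negation makes the increasing sort decreasing; distinctness of the entries at a vertex makes it
  -- strict.
  let s : ∀ i, Equiv.Perm (Fin (D.dim i)) := fun i => Tuple.sort fun p => -g (D.letter i p)
  let u : Equiv.Perm D.Basis :=
    (D.sigmaLetter.symm.trans (Equiv.sigmaCongrRight s)).trans D.sigmaLetter
  have hu : ∀ i p, u (D.letter i p) = D.letter i (s i p) := by
    intro i p
    simp only [u, Equiv.trans_apply]
    rw [← sigmaLetter_apply, Equiv.symm_apply_apply]
    rfl
  have hmem : u ∈ D.weyl := by
    rw [mem_weyl]
    intro b
    obtain ⟨p, hp⟩ := D.exists_letter (rfl : D.vtx b = _)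
    conv_lhs => rw [← hp, hu, D.vtx_letter]
  refine ⟨u⁻¹, D.inv_mem_weyl hmem, ?_⟩
  intro b b' h hb
  obtain ⟨p, hp⟩ := D.exists_letter (rfl : D.vtx b = _)
  obtain ⟨q, hq⟩ := D.exists_letter h.symm
  rw [← hp, ← hq] at hb ⊢
  have hpq := D.before_letter.1 hb
  have h1 := Tuple.monotone_sort (fun p => -g (D.letter (D.vtx b) p)) hpq.le
  simp only [Function.comp_apply, inv_inv, hu]
  simp only [Function.comp_apply] at h1
  refine lt_of_le_of_ne (by simpa using h1) fun heq => ?_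
  have h2 := hg _ _ (by rw [D.vtx_letter, D.vtx_letter]) heq
  have h3 := congr_arg D.row h2
  rw [D.row_letter, D.row_letter] at h3
  have h4 := (s _).injective (Fin.ext h3)
  exact absurd h4 (ne_of_gt hpq)

/-! ### Alternating sums over the Weyl group -/

section Alternating

variable {M : Type*} [AddCommGroup M] {K : (D.Basis → ℤ) → Equiv.Perm D.Basis → M}

variable (K) in
/-- The alternating sum of `K g w` over `w` in the Weyl group. -/
def alternatingSum (g : D.Basis → ℤ) : M := ∑ w ∈ D.weyl, (Equiv.Perm.sign w : ℤ) • K g w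

/-- Moving v from the weight to w is a right translation of the Weyl group, which costs the sign of
v. The hypothesis on K is shared by Jacobi-Trudi terms and by alternants. -/
theorem alternatingSum_comp
    (hK : ∀ g, ∀ v ∈ D.weyl, ∀ w, K (g ∘ ⇑v) w = K g (w * v⁻¹))
    (g : D.Basis → ℤ) {v : Equiv.Perm D.Basis} (hv : v ∈ D.weyl) :
    alternatingSum K (g ∘ ⇑v) = (Equiv.Perm.sign v : ℤ) • alternatingSum K g := by
  rw [alternatingSum, alternatingSum, Finset.smul_sum]
  refine Finset.sum_bij' (fun w _ => w * v⁻¹) (fun w _ => w * v)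
    (fun w hw => D.mul_mem_weyl hw (D.inv_mem_weyl hv)) (fun w hw => D.mul_mem_weyl hw hv)
    (fun w _ => by group) (fun w _ => by group) fun w _ => ?_
  rw [hK g v hv, smul_smul]
  congr 1
  rw [Equiv.Perm.sign_mul, Equiv.Perm.sign_inv, ← Units.val_mul, mul_left_comm, ← sq,
    Int.units_sq, mul_one]

/-- The terms of w and w · (b b') cancel. The pairing is needed because antisymmetry alone gives
only 2x = 0, and M may have 2-torsion. -/
theorem alternatingSum_eq_zero
    (hK : ∀ g, ∀ v ∈ D.weyl, ∀ w, K (g ∘ ⇑v) w = K g (w * v⁻¹))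
    {g : D.Basis → ℤ} {b b' : D.Basis} (hne : b ≠ b')
    (hv : D.vtx b = D.vtx b') (hg : g b = g b') : alternatingSum K g = 0 := by
  have hs := D.swap_mem_weyl hv
  have hgs : g ∘ ⇑(Equiv.swap b b') = g := by
    funext x
    rw [Function.comp_apply, Equiv.swap_apply_def]
    split_ifs with h1 h2
    · rw [h1, hg]
    · rw [h2, hg]
    · rfl
  refine Finset.sum_involution (fun w _ => w * Equiv.swap b b') ?_ ?_ ?_ ?_
  · intro w _
    have h1 := hK g _ hs w
    rw [hgs, Equiv.swap_inv] at h1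
    rw [← h1, Equiv.Perm.sign_mul, Equiv.Perm.sign_swap hne]
    simp
  · intro w _ _ h
    rw [mul_eq_left, Equiv.swap_eq_one_iff] at h
    exact hne h
  · intro w hw
    exact D.mul_mem_weyl hw hs
  · intro w _
    simp [mul_assoc]

/-- Straightening: an alternating sum is, up to sign, the alternating sum for the strictly dominant
weight in the same orbit, or it vanishes. -/
theorem alternatingSum_eq_sum
    (hK : ∀ g, ∀ v ∈ D.weyl, ∀ w, K (g ∘ ⇑v) w = K g (w * v⁻¹))
    {g : D.Basis → ℤ} (L : Finset (D.Basis → ℤ))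
    (hL : ∀ lam ∈ L, D.IsDominant lam)
    (hgL : ∀ lam, D.IsDominant lam → ∀ w ∈ D.weyl, (lam + D.rho) ∘ ⇑w = g →
      alternatingSum K (lam + D.rho) ≠ 0 → lam ∈ L) :
    alternatingSum K g = ∑ lam ∈ L, ∑ w ∈ D.weyl,
      if (lam + D.rho) ∘ ⇑w = g then
        (Equiv.Perm.sign w : ℤ) • alternatingSum K (lam + D.rho) else 0 := by
  by_cases hg : ∀ b b', D.vtx b = D.vtx b' → g b = g b' → b = b'
  · obtain ⟨w₀, hw₀, hdom⟩ := exists_isStrictDominant hg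
    set lam₀ := g ∘ ⇑w₀⁻¹ - D.rho with hlam₀
    have h1 : lam₀ + D.rho = g ∘ ⇑w₀⁻¹ := by rw [hlam₀, sub_add_cancel]
    have h2 : (lam₀ + D.rho) ∘ ⇑w₀ = g := by
      rw [h1]
      funext b
      simp
    have hd : D.IsDominant lam₀ := hdom.sub_rho
    have h3 : alternatingSum K g =
        (Equiv.Perm.sign w₀ : ℤ) • alternatingSum K (lam₀ + D.rho) := by
      rw [← alternatingSum_comp hK _ hw₀, h2]
    -- At most one pair (λ, w) meets the condition, so the double sum has at most one nonzero term.
    have huniq : ∀ lam, D.IsDominant lam → ∀ w ∈ D.weyl, (lam + D.rho) ∘ ⇑w = g →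
        w = w₀ ∧ lam = lam₀ := by
      intro lam hl w hw h
      have := hl.add_rho.unique hd.add_rho hw hw₀ (h.trans h2.symm)
      exact ⟨this.1, add_right_cancel this.2⟩
    by_cases hmem : lam₀ ∈ L
    · rw [Finset.sum_eq_single lam₀, Finset.sum_eq_single w₀, if_pos h2, h3]
      · intro w hw hne
        rw [if_neg]
        exact fun h => hne (huniq _ hd w hw h).1
      · intro h
        exact absurd hw₀ h
      · intro lam hl hne
        refine Finset.sum_eq_zero fun w hw => ?_
        rw [if_neg]
        exact fun h => hne (huniq _ (hL _ hl) w hw h).2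
      · intro h
        exact absurd hmem h
    · have h4 : alternatingSum K (lam₀ + D.rho) = 0 := by
        by_contra h
        exact hmem (hgL _ hd _ hw₀ h2 h)
      rw [h3, h4, smul_zero]
      symm
      refine Finset.sum_eq_zero fun lam hl => Finset.sum_eq_zero fun w hw => ?_
      rw [if_neg]
      exact fun h => hmem ((huniq _ (hL _ hl) w hw h).2 ▸ hl)
  -- With a repeated entry the left side is 0, and no term on the right survives because λ + ρ has
  -- distinct entries at each vertex.
  · push Not at hg
    obtain ⟨b, b', hv, hgb, hne⟩ := hg
    rw [alternatingSum_eq_zero hK hne hv hgb]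
    symm
    refine Finset.sum_eq_zero fun lam hl => Finset.sum_eq_zero fun w hw => ?_
    rw [if_neg]
    rintro rfl
    rw [mem_weyl] at hw
    have hst := (hL _ hl).add_rho
    have hv' : D.vtx (w b) = D.vtx (w b') := by rw [hw, hw, hv]
    rcases D.before_or_before (fun h => hne (w.injective h) : w b ≠ w b') with hb | hb
    · exact absurd hgb (ne_of_gt (hst _ _ hv' hb))
    · exact absurd hgb (ne_of_lt (hst _ _ hv'.symm hb))

end Alternating

end CurrentSeq

end

section

/-! ### Determinants: Weyl denominator and Jacobi-Trudi -/

namespace CurrentSeq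

variable {Q₀ : Type*} [DecidableEq Q₀] (D : CurrentSeq Q₀)

section Determinants

variable {S : Type*} [CommRing S]

/-- The matrix which agrees with `f` for pairs of letters at the same vertex. -/
def vertexMatrix (f : D.Basis → D.Basis → S) : Matrix D.Basis D.Basis S :=
  Matrix.of fun b b' => if D.vtx b = D.vtx b' then f b b' else 0

theorem det_vertexMatrix_eq_sum (f : D.Basis → D.Basis → S) :
    (D.vertexMatrix f).det = ∑ w ∈ D.weyl, (Equiv.Perm.sign w : ℤ) • ∏ b, f (w b) b := by
  rw [Matrix.det_apply, weyl, Finset.sum_filter]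
  refine Finset.sum_congr rfl fun w _ => ?_
  simp only [vertexMatrix, Matrix.of_apply, Finset.prod_ite_zero, Finset.mem_univ, true_implies]
  split_ifs
  · rfl
  · exact smul_zero _

theorem det_vertexMatrix_eq_prod [Fintype Q₀] (f : D.Basis → D.Basis → S) :
    (D.vertexMatrix f).det = ∏ i, (Matrix.of fun p q : Fin (D.dim i) =>
      f (D.letter i p) (D.letter i q)).det := by
  classical
  -- The matrix is block diagonal, hence triangular for any ordering of the vertices. Vertices
  -- without letters have empty blocks of determinant 1.
  let e := Fintype.equivFin Q₀
  have hblock : (D.vertexMatrix f).BlockTriangular fun b => e (D.vtx b) := by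
    intro b b' h
    rw [vertexMatrix, Matrix.of_apply, if_neg]
    intro h'
    simp only [h'] at h
    exact lt_irrefl _ h
  rw [hblock.det, Finset.prod_subset (Finset.subset_univ _), ← Equiv.prod_comp e]
  · refine Finset.prod_congr rfl fun i _ => ?_
    let u : Fin (D.dim i) ≃ {b : D.Basis // e (D.vtx b) = e i} :=
      (D.letterEquiv i).symm.trans (Equiv.subtypeEquivRight fun b => e.injective.eq_iff.symm)
    rw [← Matrix.det_submatrix_equiv_self u]
    congr 1
    ext p q
    have h1 : ∀ p, (u p).1 = D.letter i p := fun p => rfl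
    simp only [Matrix.submatrix_apply, Matrix.toSquareBlock_def, Matrix.of_apply, vertexMatrix, h1,
      vtx_letter, if_true]
  · intro a _ ha
    have : IsEmpty {b : D.Basis // e (D.vtx b) = a} :=
      ⟨fun b => ha (Finset.mem_image.2 ⟨b.1, Finset.mem_univ _, b.2⟩)⟩
    exact Matrix.det_isEmpty

theorem prod_pairs [Fintype Q₀] (f : D.Basis → D.Basis → S) :
    (∏ y, ∏ z, if D.vtx y = D.vtx z ∧ D.Before y z then f y z else 1) =
      ∏ i, ∏ p : Fin (D.dim i), ∏ q ∈ Finset.Ioi p, f (D.letter i p) (D.letter i q) := by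
  rw [prod_letter]
  refine Finset.prod_congr rfl fun i _ => Finset.prod_congr rfl fun p _ => ?_
  rw [prod_letter, Finset.prod_eq_single i]
  · simp only [vtx_letter, before_letter, true_and]
    rw [← Finset.prod_filter]
    congr 1
    ext q
    simp
  · intro j _ hj
    refine Finset.prod_eq_one fun q _ => if_neg fun h => hj ?_
    rw [vtx_letter, vtx_letter] at h
    exact h.1.symm
  · intro h
    exact absurd (Finset.mem_univ i) h

end Determinants

theorem single_sum {R ι : Type*} [CommRing R] {A : Type*} [AddCommMonoid A] (s : Finset ι)
    (f : ι → A) : (AddMonoidAlgebra.single (∑ x ∈ s, f x) 1 : AddMonoidAlgebra R A) =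
      ∏ x ∈ s, AddMonoidAlgebra.single (f x) 1 := by
  classical
  induction s using Finset.induction_on with
  | empty => simp [AddMonoidAlgebra.one_def]
  | insert x s hx ih =>
    rw [Finset.sum_insert hx, Finset.prod_insert hx, ← ih, AddMonoidAlgebra.single_mul_single,
      one_mul]

/-- A monomial as a product of powers of the variables. -/
theorem single_eq_prod (R : Type*) [CommRing R] (g : D.Basis → ℤ) :
    (AddMonoidAlgebra.single g 1 : AddMonoidAlgebra R (D.Basis → ℤ)) =
      ∏ b, AddMonoidAlgebra.single (Pi.single b (g b)) 1 := by
  rw [← single_sum, Finset.univ_sum_single]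

theorem single_pow_eq (R : Type*) [CommRing R] (b : D.Basis) (n : ℕ) :
    (AddMonoidAlgebra.single (Pi.single b 1) 1 : AddMonoidAlgebra R (D.Basis → ℤ)) ^ n =
      AddMonoidAlgebra.single (Pi.single b (n : ℤ)) 1 := by
  rw [AddMonoidAlgebra.single_pow, one_pow]
  congr 1
  ext b'
  simp [Pi.single_apply]

/-- The Weyl denominator formula. -/
theorem pairDenominator_eq_sum [Fintype Q₀] (R : Type*) [CommRing R] :
    D.pairDenominator R = ∑ w ∈ D.weyl, (Equiv.Perm.sign w : ℤ) •
      AddMonoidAlgebra.single (D.rho - D.rho ∘ ⇑w) 1 := by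
  set x : D.Basis → AddMonoidAlgebra R (D.Basis → ℤ) :=
    fun b => AddMonoidAlgebra.single (Pi.single b 1) 1 with hx
  have h1 : (D.vertexMatrix fun b b' => x b ^ D.row b').det =
      ∏ y, ∏ z, if D.vtx y = D.vtx z ∧ D.Before y z then x z - x y else 1 := by
    rw [det_vertexMatrix_eq_prod, prod_pairs]
    refine Finset.prod_congr rfl fun i _ => ?_
    rw [← Matrix.det_vandermonde fun p => x (D.letter i p)]
    congr 1
    ext p q
    rw [Matrix.of_apply, row_letter, Matrix.vandermonde_apply]
  -- Dividing each Vandermonde factor x_z - x_y by x_z gives 1 - x_y/x_z; the letter z occurs once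
  -- for each of its `row z` predecessors.
  have h2 : D.pairDenominator R = (∏ y, ∏ z, if D.vtx y = D.vtx z ∧ D.Before y z then
      x z - x y else 1) * AddMonoidAlgebra.single (fun b => -(D.row b : ℤ)) 1 := by
    have h3 : (AddMonoidAlgebra.single (fun b => -(D.row b : ℤ)) 1 :
        AddMonoidAlgebra R (D.Basis → ℤ)) = ∏ y : D.Basis, ∏ z : D.Basis,
        if D.vtx y = D.vtx z ∧ D.Before y z then
          AddMonoidAlgebra.single (-Pi.single z (1 : ℤ)) 1 else 1 := by
      rw [Finset.prod_comm, single_eq_prod]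
      refine Finset.prod_congr rfl fun z _ => ?_
      rw [← Finset.prod_filter, Finset.prod_const, AddMonoidAlgebra.single_pow, one_pow]
      congr 1
      ext b
      by_cases hb : b = z
      · subst hb
        have : (Finset.univ.filter fun y => D.vtx y = D.vtx b ∧ D.Before y b).card = D.row b := rfl
        rw [this]
        simp
      · simp [hb]
    rw [h3, ← Finset.prod_mul_distrib, pairDenominator]
    refine Finset.prod_congr rfl fun y _ => ?_
    rw [← Finset.prod_mul_distrib]
    refine Finset.prod_congr rfl fun z _ => ?_
    split_ifs
    · rw [sub_mul, hx, AddMonoidAlgebra.single_mul_single, AddMonoidAlgebra.single_mul_single,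
        add_neg_cancel, one_mul, ratio, AddMonoidAlgebra.one_def, ← sub_eq_add_neg]
    · rw [mul_one]
  rw [h2, ← h1, det_vertexMatrix_eq_sum, Finset.sum_mul]
  -- The determinant has x_{w b} to the power `row b`, so w enters inversely. As `row + rho` is
  -- constant at each vertex, differences of rows are differences of ρ with opposite sign.
  refine Finset.sum_bij' (fun w _ => w⁻¹) (fun w _ => w⁻¹) (fun w hw => D.inv_mem_weyl hw)
    (fun w hw => D.inv_mem_weyl hw) (fun w _ => inv_inv w) (fun w _ => inv_inv w) fun w hw => ?_
  rw [Equiv.Perm.sign_inv, smul_mul_assoc]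
  congr 1
  have h4 : ∏ b, x (w b) ^ D.row b =
      AddMonoidAlgebra.single (fun b => (D.row (w⁻¹ b) : ℤ)) 1 := by
    rw [single_eq_prod, ← Equiv.prod_comp w fun b => AddMonoidAlgebra.single
      (Pi.single b (D.row (w⁻¹ b) : ℤ)) (1 : R)]
    refine Finset.prod_congr rfl fun b _ => ?_
    rw [hx, single_pow_eq, show w⁻¹ (w b) = b from w.symm_apply_apply b]
  rw [h4, AddMonoidAlgebra.single_mul_single, one_mul]
  congr 1
  ext b
  have h5 := D.row_add_rho b
  have h6 := D.row_add_rho (w⁻¹ b)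
  rw [D.mem_weyl.1 (D.inv_mem_weyl hw)] at h6
  simp only [Pi.add_apply, Pi.sub_apply, Function.comp_apply]
  omega

/-! ### Tensor Schur functions -/

section Schur

variable {R : Type*} [CommRing R]

/-- The summands of the Jacobi-Trudi determinant. -/
def jacobiTrudiTerm (R : Type*) [CommRing R] (g : D.Basis → ℤ) (w : Equiv.Perm D.Basis) :
    SymFun Q₀ R := hProd D.vtx (g - D.rho ∘ ⇑w)

/-- The product is reindexed by v, which is allowed since v keeps every letter at its vertex. -/
theorem jacobiTrudiTerm_comp (g : D.Basis → ℤ) {v : Equiv.Perm D.Basis} (hv : v ∈ D.weyl)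
    (w : Equiv.Perm D.Basis) :
    D.jacobiTrudiTerm R (g ∘ ⇑v) w = D.jacobiTrudiTerm R g (w * v⁻¹) := by
  rw [mem_weyl] at hv
  refine Eq.trans (Finset.prod_congr rfl fun b _ => ?_) (Equiv.prod_comp v _)
  simp [hv]

theorem alternatingSum_jacobiTrudiTerm [Fintype Q₀] (g : D.Basis → ℤ) :
    alternatingSum (D.jacobiTrudiTerm R) g = ∏ i, (Matrix.of fun p q : Fin (D.dim i) =>
      (h i (g (D.letter i p) - D.rho (D.letter i q)) : SymFun Q₀ R)).det := by
  have h1 := (D.det_vertexMatrix_eq_sum fun b b' : D.Basis =>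
    (h (D.vtx b') (g b' - D.rho b) : SymFun Q₀ R)).symm.trans (D.det_vertexMatrix_eq_prod _)
  refine h1.trans (Finset.prod_congr rfl fun i _ => ?_)
  rw [← Matrix.det_transpose]
  congr 1
  ext p q
  simp only [Matrix.transpose_apply, Matrix.of_apply, vtx_letter]

theorem rowLen_eq_zero {lam : YoungDiagram} {p : ℕ} (hp : lam.colLen 0 ≤ p) : lam.rowLen p = 0 := by
  by_contra h
  have h1 : (p, 0) ∈ lam := YoungDiagram.mem_iff_lt_rowLen.2 (Nat.pos_of_ne_zero h)
  exact absurd (YoungDiagram.mem_iff_lt_colLen.1 h1) (not_lt.2 hp)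

/-- An added empty row has indices q - n ≤ 0, so it reads (0, …, 0, 1), and expansion along it
restores the smaller determinant. -/
theorem schur_eq_det (i : Q₀) (lam : YoungDiagram) {n : ℕ} (hn : lam.colLen 0 ≤ n) :
    (schur i lam : SymFun Q₀ R) = (Matrix.of fun p q : Fin n =>
      (h i ((lam.rowLen p : ℤ) - (p : ℕ) + (q : ℕ)) : SymFun Q₀ R)).det := by
  induction n, hn using Nat.le_induction with
  | base => rfl
  | succ n hn ih =>
    rw [Matrix.det_succ_row _ (Fin.last n), Finset.sum_eq_single (Fin.last n), ih]
    · simp only [Matrix.of_apply, Fin.val_last, rowLen_eq_zero hn, ← two_mul, pow_mul]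
      have h1 : ((0 : ℕ) : ℤ) - (n : ℤ) + (n : ℤ) = 0 := by simp
      rw [h1, h_zero]
      simp only [even_two, Even.neg_pow, one_pow, mul_one, one_mul, Fin.succAbove_last]
      rfl
    · intro q _ hq
      have h2 : (q : ℕ) < n := Fin.val_lt_last hq
      rw [Matrix.of_apply, Fin.val_last, rowLen_eq_zero hn, h_of_neg i (by omega)]
      ring
    · intro h
      exact absurd (Finset.mem_univ _) h

theorem partitionWeight_letter (lam : Q₀ → YoungDiagram) (i : Q₀) (p : Fin (D.dim i)) :
    D.partitionWeight lam (D.letter i p) = (lam i).rowLen p := by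
  rw [partitionWeight, vtx_letter, row_letter]

/-- The Jacobi-Trudi formula at all vertices. -/
theorem alternatingSum_partitionWeight [Fintype Q₀] {lam : Q₀ → YoungDiagram}
    (hl : ∀ i, (lam i).colLen 0 ≤ D.dim i) :
    alternatingSum (D.jacobiTrudiTerm R) (D.partitionWeight lam + D.rho) = tensorSchur lam := by
  rw [alternatingSum_jacobiTrudiTerm, tensorSchur]
  refine Finset.prod_congr rfl fun i _ => ?_
  rw [schur_eq_det i (lam i) (hl i)]
  congr 1
  ext p q : 1
  rw [Matrix.of_apply, Matrix.of_apply, Pi.add_apply, partitionWeight_letter, rho_letter,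
    rho_letter]
  refine congr_arg (h (R := R) i) ?_
  ring

/-- By dominance the last letter z at the vertex of b has λ_z < 0, and ρ_z = 0, so every term
contains an h of index λ_z - ρ_{w z} < 0. This is what truncates the expansion to partitions. -/
theorem alternatingSum_eq_zero_of_neg {lam : D.Basis → ℤ} (hl : D.IsDominant lam) {b : D.Basis}
    (hb : lam b < 0) : alternatingSum (D.jacobiTrudiTerm R) (lam + D.rho) = 0 := by
  have hpos : 0 < D.dim (D.vtx b) := lt_of_le_of_lt (Nat.zero_le _) (D.row_lt_dim b)
  set z := D.letter (D.vtx b) ⟨D.dim (D.vtx b) - 1, by omega⟩ with hz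
  have hvz : D.vtx z = D.vtx b := D.vtx_letter _ _
  have hrz : D.rho z = 0 := by
    rw [hz, rho_letter]
    simp only
    omega
  have hlz : lam z < 0 := by
    by_cases h : b = z
    · rwa [← h]
    · have h1 := D.row_lt_dim b
      have h2 : D.row z = D.dim (D.vtx b) - 1 := D.row_letter _ _
      rcases D.before_or_before h with h3 | h3
      · exact lt_of_le_of_lt (hl b z hvz.symm h3) hb
      · have := D.row_lt_row hvz h3
        omega
  refine Finset.sum_eq_zero fun w _ => ?_
  have h4 := D.rho_nonneg (w z)
  rw [jacobiTrudiTerm, hProd_of_neg (b := z), smul_zero]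
  simp only [Pi.sub_apply, Pi.add_apply, Function.comp_apply]
  omega

end Schur

end CurrentSeq

end

section

/-! ### Exact division by the Weyl denominator -/

namespace CurrentSeq

variable {Q₀ : Type*} [DecidableEq Q₀] (D : CurrentSeq Q₀)

/-- The antisymmetrizer as an additive map. -/
def antisymHom : D.WeightRing →+ D.WeightRing :=
  { toFun := D.antisym
    map_zero' := by simp [antisym]
    map_add' := fun x y => by
      simp [antisym, AddMonoidAlgebra.mapDomain_add, Finset.sum_add_distrib] }

theorem antisymHom_apply (f : D.WeightRing) : D.antisymHom f = D.antisym f := rfl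

/-- The summands of the antisymmetrization of a monomial. -/
def antisymTerm (g : D.Basis → ℤ) (w : Equiv.Perm D.Basis) : D.WeightRing := D.xpow (g ∘ ⇑w⁻¹)

theorem antisymTerm_comp (g : D.Basis → ℤ) {v : Equiv.Perm D.Basis} (_ : v ∈ D.weyl)
    (w : Equiv.Perm D.Basis) : D.antisymTerm (g ∘ ⇑v) w = D.antisymTerm g (w * v⁻¹) := by
  rw [antisymTerm, antisymTerm, mul_inv_rev, inv_inv]
  rfl

theorem antisym_xpow (g : D.Basis → ℤ) : D.antisym (D.xpow g) = alternatingSum D.antisymTerm g := by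
  simp [antisym, alternatingSum, antisymTerm, xpow]

theorem xpow_mul_xpow (g g' : D.Basis → ℤ) : D.xpow g * D.xpow g' = D.xpow (g + g') := by
  rw [xpow, xpow, AddMonoidAlgebra.single_mul_single, one_mul, xpow]

/-- The variable of a letter. -/
def letterVar (b : D.Basis) : D.WeightRing := D.xpow (Pi.single b 1)

theorem antisym_xpow_natCast (n : D.Basis → ℕ) : D.antisym (D.xpow fun b => (n b : ℤ)) =
    (D.vertexMatrix fun b b' => D.letterVar b ^ n b').det := by
  rw [det_vertexMatrix_eq_sum, antisym_xpow, alternatingSum]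
  refine Finset.sum_congr rfl fun w _ => ?_
  congr 1
  rw [antisymTerm, xpow, single_eq_prod, ← Equiv.prod_comp w fun b => AddMonoidAlgebra.single
    (Pi.single b (((fun b => (n b : ℤ)) ∘ ⇑w⁻¹) b)) (1 : ℤ)]
  refine Finset.prod_congr rfl fun b _ => ?_
  rw [letterVar, xpow, single_pow_eq, Function.comp_apply,
    show w⁻¹ (w b) = b from w.symm_apply_apply b]

theorem sum_vtx_eq_sum_range {M : Type*} [AddCommMonoid M] (i : Q₀) (f : ℕ → M) :
    ∑ z with D.vtx z = i, f (D.rho z).toNat = ∑ k ∈ Finset.range (D.dim i), f k := by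
  refine Finset.sum_bij (fun z _ => (D.rho z).toNat) ?_ ?_ ?_ (fun _ _ => rfl)
  · intro z hz
    simp only [Finset.mem_filter, Finset.mem_univ, true_and] at hz
    have := D.row_add_rho z
    have := D.rho_nonneg z
    rw [Finset.mem_range, ← hz]
    omega
  · intro z hz z' hz' h
    simp only [Finset.mem_filter, Finset.mem_univ, true_and] at hz hz'
    have h1 := D.row_add_rho z
    have h2 := D.row_add_rho z'
    have := D.rho_nonneg z
    have := D.rho_nonneg z'
    rw [hz] at h1
    rw [hz'] at h2
    exact D.eq_of_row_eq (hz.trans hz'.symm) (by omega)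
  · intro k hk
    rw [Finset.mem_range] at hk
    refine ⟨D.letter i ⟨D.dim i - 1 - k, by omega⟩, ?_, ?_⟩
    · simp [vtx_letter]
    · rw [rho_letter]
      simp only
      omega

/-- The antisymmetrization of a monomial with nonnegative exponents is a multiple of that of
`x^ρ`. -/
theorem antisym_rho_dvd_natCast (n : D.Basis → ℕ) :
    D.antisym (D.xpow D.rho) ∣ D.antisym (D.xpow fun b => (n b : ℤ)) := by
  have hrho : D.rho = fun b => (((D.rho b).toNat : ℕ) : ℤ) :=
    funext fun b => (Int.toNat_of_nonneg (D.rho_nonneg b)).symm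
  -- This monic polynomial of degree ν^{(i)} vanishes at every letter at i. Reducing X^n modulo it
  -- writes x_b^n as a combination of x_b^k with k < ν^{(i)}, with coefficients independent of b;
  -- these k are the values of ρ at i.
  let q : Q₀ → Polynomial D.WeightRing := fun i =>
    ∏ y with D.vtx y = i, (Polynomial.X - Polynomial.C (D.letterVar y))
  have hq : ∀ i, (q i).Monic := fun i => Polynomial.monic_prod_of_monic _ _ fun y _ =>
    Polynomial.monic_X_sub_C _
  have hdeg : ∀ i, (q i).natDegree = D.dim i := by
    intro i
    rw [Polynomial.natDegree_prod_of_monic _ _ fun y _ => Polynomial.monic_X_sub_C _]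
    simp [card_vtx_eq]
  have hroot : ∀ b, (q (D.vtx b)).eval (D.letterVar b) = 0 := by
    intro b
    rw [Polynomial.eval_prod]
    exact Finset.prod_eq_zero (i := b) (by simp) (by simp)
  let r : D.Basis → Polynomial D.WeightRing := fun b => Polynomial.X ^ n b %ₘ q (D.vtx b)
  have hr : ∀ b b', D.vtx b = D.vtx b' → (r b').eval (D.letterVar b) = D.letterVar b ^ n b' := by
    intro b b' h
    have h1 := congr_arg (Polynomial.eval (D.letterVar b))
      (Polynomial.modByMonic_add_div (Polynomial.X ^ n b') (q (D.vtx b')))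
    rw [Polynomial.eval_add, Polynomial.eval_mul, ← h, hroot, zero_mul, add_zero,
      Polynomial.eval_pow, Polynomial.eval_X] at h1
    simpa only [r, h] using h1
  have hsum : ∀ b b', D.vtx b = D.vtx b' → D.letterVar b ^ n b' =
      ∑ z with D.vtx z = D.vtx b', D.letterVar b ^ (D.rho z).toNat *
        (r b').coeff (D.rho z).toNat := by
    intro b b' h
    rw [D.sum_vtx_eq_sum_range (D.vtx b') fun k => D.letterVar b ^ k * (r b').coeff k, ← hr b b' h]
    have hlt : (r b').natDegree < D.dim (D.vtx b') := by
      rw [← hdeg]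
      -- The modulus is not 1, because its vertex carries the letter b'.
      refine Polynomial.natDegree_modByMonic_lt _ (hq _) fun h1 => ?_
      have h2 := hdeg (D.vtx b')
      rw [h1, Polynomial.natDegree_one] at h2
      have := D.row_lt_dim b'
      omega
    rw [Polynomial.eval_eq_sum_range' hlt]
    exact Finset.sum_congr rfl fun k _ => mul_comm _ _
  rw [hrho, antisym_xpow_natCast, antisym_xpow_natCast]
  -- The alternant matrix is the one for ρ times the matrix of remainder coefficients.
  refine ⟨(D.vertexMatrix fun z b' => (r b').coeff (D.rho z).toNat).det, ?_⟩
  rw [← Matrix.det_mul]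
  congr 1
  ext b b' : 1
  rw [Matrix.mul_apply]
  simp only [vertexMatrix, Matrix.of_apply]
  by_cases h : D.vtx b = D.vtx b'
  · rw [if_pos h, hsum b b' h, Finset.sum_filter]
    refine Finset.sum_congr rfl fun z _ => ?_
    by_cases hz : D.vtx z = D.vtx b'
    · rw [if_pos hz, if_pos (h.trans hz.symm), if_pos hz]
    · rw [if_neg hz, if_neg hz, mul_zero]
  · rw [if_neg h]
    symm
    refine Finset.sum_eq_zero fun z _ => ?_
    by_cases hz : D.vtx z = D.vtx b'
    · rw [if_neg (fun h' => h (h'.trans hz)), zero_mul]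
    · rw [if_neg hz, mul_zero]

/-- Adding a large constant k to all exponents makes them nonnegative; the constant weight is Weyl
invariant, so its monomial factors out. -/
theorem antisym_rho_dvd_xpow (g : D.Basis → ℤ) :
    D.antisym (D.xpow D.rho) ∣ D.antisym (D.xpow g) := by
  set k : ℕ := ∑ b, (-g b).toNat with hk
  have hpos : ∀ b, 0 ≤ g b + k := by
    intro b
    have h1 : (-g b).toNat ≤ k := Finset.single_le_sum (f := fun b => (-g b).toNat)
      (fun _ _ => Nat.zero_le _) (Finset.mem_univ b)
    omega
  have h1 : D.antisym (D.xpow g) = D.xpow (fun _ => -(k : ℤ)) *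
      D.antisym (D.xpow fun b => (((g b + k).toNat : ℕ) : ℤ)) := by
    rw [antisym_xpow, antisym_xpow, alternatingSum, alternatingSum, Finset.mul_sum]
    refine Finset.sum_congr rfl fun w _ => ?_
    rw [mul_smul_comm, antisymTerm, antisymTerm, xpow_mul_xpow]
    congr 2
    ext b
    simp [Int.toNat_of_nonneg (hpos _)]
  rw [h1]
  exact Dvd.dvd.mul_left (D.antisym_rho_dvd_natCast _) _

theorem antisym_rho_dvd (f : D.WeightRing) : D.antisym (D.xpow D.rho) ∣ D.antisym f := by
  rw [← antisymHom_apply _ f]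
  induction f using AddMonoidAlgebra.induction_on with
  | of g => exact D.antisym_rho_dvd_xpow g
  | add x y hx hy =>
    rw [map_add]
    exact dvd_add hx hy
  | smul r x hx =>
    rw [map_zsmul, zsmul_eq_mul]
    exact Dvd.dvd.mul_left hx _

theorem rho_isStrictDominant : D.IsStrictDominant D.rho := by
  have h : D.IsDominant 0 := fun _ _ _ _ => le_refl _
  simpa using h.add_rho

/-- The entries of ρ at a vertex are distinct, so only w = 1 contributes to the coefficient of x^ρ,
which is 1. -/
theorem antisym_rho_ne_zero : D.antisym (D.xpow D.rho) ≠ 0 := by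
  classical
  intro h
  have h1 := congr_arg (fun f : D.WeightRing => f.coeff D.rho) h
  simp only [antisym_xpow, alternatingSum] at h1
  have h2 : (∑ w ∈ D.weyl, (Equiv.Perm.sign w : ℤ) • D.antisymTerm D.rho w).coeff D.rho =
      ∑ w ∈ D.weyl, (Equiv.Perm.sign w : ℤ) • (D.antisymTerm D.rho w).coeff D.rho := by
    simp only [AddMonoidAlgebra.coeff_sum, Finsupp.finsetSum_apply, AddMonoidAlgebra.coeff_smul,
      Finsupp.smul_apply]
  rw [h2, Finset.sum_eq_single 1] at h1
  · simp [antisymTerm, xpow] at h1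
  · intro w hw hne
    rw [antisymTerm, xpow, AddMonoidAlgebra.coeff_single, Finsupp.single_apply, if_neg, smul_zero]
    intro h3
    have h4 := D.rho_isStrictDominant.unique D.rho_isStrictDominant (D.inv_mem_weyl hw)
      D.one_mem_weyl (h3.trans rfl)
    exact hne (inv_eq_one.1 h4.1)
  · intro h3
    exact absurd D.one_mem_weyl h3

theorem antisym_mul_demazure (f : D.WeightRing) :
    D.antisym (D.xpow D.rho) * D.demazure f = D.antisym (D.xpow D.rho * f) := by
  have hf : ∃ g, D.antisym (D.xpow D.rho) * g = D.antisym (D.xpow D.rho * f) := by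
    obtain ⟨g, hg⟩ := D.antisym_rho_dvd (D.xpow D.rho * f)
    exact ⟨g, hg.symm⟩
  rw [demazure, dif_pos hf]
  exact hf.choose_spec

theorem antisym_mul_schurChar (lam : D.Basis → ℤ) :
    D.antisym (D.xpow D.rho) * D.schurChar lam =
      alternatingSum D.antisymTerm (lam + D.rho) := by
  rw [schurChar, antisym_mul_demazure, xpow_mul_xpow, antisym_xpow, add_comm]

end CurrentSeq

end

section

/-! ### Kostka-Shoji polynomials as straightening coefficients -/

namespace CurrentSeq

variable {Q₀ Q₁ : Type*} [DecidableEq Q₀] [Fintype Q₁] (D : CurrentSeq Q₀)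
  (Q : QuiverData Q₀ Q₁) (μ : ∀ k, Fin (D.size k) → ℤ)

/-- The weight `μ^• + ρ^•` shifted by the sum of a multiset of roots. -/
def shiftedWeight (n : D.Root Q → ℕ) : D.Basis → ℤ :=
  D.concat μ + D.rho + ∑ α, n α • D.rootWeight α

/-- The monomial in the arrow variables of a multiset of roots. -/
def rootMonomial (n : D.Root Q → ℕ) : MvPolynomial Q₁ ℤ := ∏ α, MvPolynomial.X α.1.1 ^ n α

variable {Q μ}

theorem mem_kostantPartitions_iff {lam : D.Basis → ℤ} {w : Equiv.Perm D.Basis}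
    {n : D.Root Q → ℕ} :
    n ∈ D.kostantPartitions Q (fun b => (lam + D.rho) (w b) - (D.concat μ + D.rho) b) ↔
      (lam + D.rho) ∘ ⇑w = D.shiftedWeight Q μ n := by
  change ∑ α, n α • D.rootWeight α = (lam + D.rho) ∘ ⇑w - (D.concat μ + D.rho) ↔ _
  rw [shiftedWeight, eq_sub_iff_add_eq', eq_comm]

theorem exists_of_map_kostkaShoji_ne_zero {M : Type*} [AddCommGroup M]
    (φ : MvPolynomial Q₁ ℤ →+ M) {lam : D.Basis → ℤ} (h : φ (D.kostkaShoji Q μ lam) ≠ 0) :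
    ∃ w ∈ D.weyl, ∃ n, (lam + D.rho) ∘ ⇑w = D.shiftedWeight Q μ n ∧
      φ (D.rootMonomial Q n) ≠ 0 := by
  rw [kostkaShoji, map_sum] at h
  obtain ⟨w, hw, h⟩ := Finset.exists_ne_zero_of_sum_ne_zero h
  rw [map_zsmul, map_sum] at h
  have h' := right_ne_zero_of_smul h
  obtain ⟨n, hn, h⟩ := Finset.exists_ne_zero_of_sum_ne_zero h'
  rw [Set.Finite.mem_toFinset, mem_kostantPartitions_iff] at hn
  exact ⟨w, hw, n, hn, h⟩

/-- The varying sets of Kostant partitions are replaced by one finite set E, which may omit whatever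
φ kills. The map φ is the inclusion into the arrow ring in one use, and a coefficient in the other.
-/
theorem map_kostkaShoji_eq_sum {M : Type*} [AddCommGroup M] (φ : MvPolynomial Q₁ ℤ →+ M)
    {lam : D.Basis → ℤ} {E : Finset (D.Root Q → ℕ)}
    (hE : ∀ w ∈ D.weyl, ∀ n, (lam + D.rho) ∘ ⇑w = D.shiftedWeight Q μ n →
      φ (D.rootMonomial Q n) ≠ 0 → n ∈ E) :
    φ (D.kostkaShoji Q μ lam) = ∑ w ∈ D.weyl, (Equiv.Perm.sign w : ℤ) • ∑ n ∈ E,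
      if (lam + D.rho) ∘ ⇑w = D.shiftedWeight Q μ n then φ (D.rootMonomial Q n) else 0 := by
  rw [kostkaShoji, map_sum]
  refine Finset.sum_congr rfl fun w hw => ?_
  rw [map_zsmul, map_sum, ← Finset.sum_filter]
  congr 1
  symm
  refine Finset.sum_subset (fun n hn => ?_) fun n hn hn' => ?_
  · rw [Set.Finite.mem_toFinset, mem_kostantPartitions_iff]
    exact (Finset.mem_filter.1 hn).2
  · rw [Set.Finite.mem_toFinset, mem_kostantPartitions_iff] at hn
    by_contra h
    exact hn' (Finset.mem_filter.2 ⟨hE w hw n hn h, hn⟩)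

/-- Straightening of a finite combination of alternating sums: the coefficients are images of
quiver Kostka-Shoji polynomials. -/
theorem sum_smul_alternatingSum {S M : Type*} [CommRing S] [AddCommGroup M] [Module S M]
    {K : (D.Basis → ℤ) → Equiv.Perm D.Basis → M}
    (hK : ∀ g, ∀ v ∈ D.weyl, ∀ w, K (g ∘ ⇑v) w = K g (w * v⁻¹))
    (φ : MvPolynomial Q₁ ℤ →+ S) (E : Finset (D.Root Q → ℕ)) (L : Finset (D.Basis → ℤ))
    (hL : ∀ lam ∈ L, D.IsDominant lam)
    (hE : ∀ lam ∈ L, ∀ w ∈ D.weyl, ∀ n, (lam + D.rho) ∘ ⇑w = D.shiftedWeight Q μ n →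
      φ (D.rootMonomial Q n) ≠ 0 → n ∈ E)
    (hEL : ∀ n ∈ E, ∀ lam, D.IsDominant lam → ∀ w ∈ D.weyl,
      (lam + D.rho) ∘ ⇑w = D.shiftedWeight Q μ n → alternatingSum K (lam + D.rho) ≠ 0 → lam ∈ L) :
    ∑ n ∈ E, φ (D.rootMonomial Q n) • alternatingSum K (D.shiftedWeight Q μ n) =
      ∑ lam ∈ L, φ (D.kostkaShoji Q μ lam) • alternatingSum K (lam + D.rho) := by
  -- Each shifted weight is straightened; after exchanging the sums, the factor at λ is its
  -- alternating Kostant sum.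
  rw [Finset.sum_congr rfl fun n hn => congr_arg (φ (D.rootMonomial Q n) • ·)
    (alternatingSum_eq_sum hK L hL (hEL n hn))]
  simp only [Finset.smul_sum]
  rw [Finset.sum_comm]
  refine Finset.sum_congr rfl fun lam hlam => ?_
  rw [D.map_kostkaShoji_eq_sum φ (hE lam hlam), Finset.sum_comm, Finset.sum_smul]
  refine Finset.sum_congr rfl fun w _ => ?_
  rw [smul_assoc, Finset.sum_smul, Finset.smul_sum]
  refine Finset.sum_congr rfl fun n _ => ?_
  split_ifs
  · rw [smul_comm]
  · rw [smul_zero, zero_smul, smul_zero]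

/-! ### The quiver Hall-Littlewood series -/

theorem coeff_rootMonomial (n : D.Root Q → ℕ) (d : Q₁ →₀ ℕ)
    [Decidable (∑ α : D.Root Q, n α • Finsupp.single α.1.1 1 = d)] :
    MvPolynomial.coeff d (D.rootMonomial Q n) =
      if ∑ α : D.Root Q, n α • Finsupp.single α.1.1 1 = d then 1 else 0 := by
  classical
  have h : D.rootMonomial Q n = MvPolynomial.monomial (∑ α, n α • Finsupp.single α.1.1 1) 1 := by
    rw [MvPolynomial.monomial_sum_one, rootMonomial]
    refine Finset.prod_congr rfl fun α _ => ?_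
    rw [MvPolynomial.X, MvPolynomial.monomial_pow, one_pow]
  rw [h, MvPolynomial.coeff_monomial]
  congr

/-- Every root carries exactly one arrow variable, so a fixed monomial in the t_b bounds all
multiplicities. -/
theorem le_degree_of_coeff_rootMonomial_ne_zero {n : D.Root Q → ℕ} {d : Q₁ →₀ ℕ}
    (h : MvPolynomial.coeff d (D.rootMonomial Q n) ≠ 0) (α : D.Root Q) : n α ≤ d.degree := by
  classical
  rw [coeff_rootMonomial] at h
  have hd := of_not_not fun hd => h (if_neg hd)
  rw [← hd, map_sum]
  refine le_trans ?_ (Finset.single_le_sum (fun _ _ => Nat.zero_le _) (Finset.mem_univ α))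
  simp

theorem xpow_sum {ι : Type*} (s : Finset ι) (f : ι → D.Basis → ℤ) :
    D.xpow (∑ x ∈ s, f x) = ∏ x ∈ s, D.xpow (f x) := single_sum s f

theorem xpow_nsmul (n : ℕ) (g : D.Basis → ℤ) : D.xpow (n • g) = D.xpow g ^ n := by
  rw [xpow, xpow, AddMonoidAlgebra.single_pow, one_pow]

theorem coeff_rootSeries [DecidableEq (D.Root Q)] (d : Q₁ →₀ ℕ) :
    MvPowerSeries.coeff d (D.rootSeries Q) =
      ∑ n ∈ Fintype.piFinset fun _ : D.Root Q => Finset.range (d.degree + 1),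
        MvPolynomial.coeff d (D.rootMonomial Q n) • D.xpow (∑ α, n α • D.rootWeight α) := by
  classical
  have h1 : D.rootSeries Q * ∏ α : D.Root Q,
      (1 - MvPowerSeries.monomial (Finsupp.single α.1.1 1) (D.xpow (D.rootWeight α))) = 1 := by
    rw [rootSeries, ← Finset.prod_mul_distrib]
    refine Finset.prod_eq_one fun α _ => ?_
    rw [mul_comm]
    refine MvPowerSeries.mul_invOfUnit _ 1 ?_
    rw [map_sub, map_one, ← MvPowerSeries.coeff_zero_eq_constantCoeff_apply,
      MvPowerSeries.coeff_monomial, if_neg, sub_zero, Units.val_one]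
    intro h
    have := DFunLike.congr_fun h α.1.1
    simp at this
  rw [coeff_eq_coeff_mul_geom_sum _ _ _ h1 (Nat.lt_succ_self _), one_mul, Finset.prod_univ_sum,
    map_sum]
  refine Finset.sum_congr rfl fun n _ => ?_
  simp only [MvPowerSeries.monomial_pow]
  rw [MvPowerSeries.prod_monomial, MvPowerSeries.coeff_monomial, coeff_rootMonomial, xpow_sum]
  simp only [xpow_nsmul]
  by_cases h : ∑ α : D.Root Q, n α • Finsupp.single α.1.1 1 = d
  · rw [if_pos h, if_pos h.symm, one_smul]
  · rw [if_neg h, if_neg (Ne.symm h), zero_smul]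

variable (Q μ)

/-- The dominant weights `λ` for which `λ + ρ` is conjugate to the shifted weight of an
element of `E`. -/
def dominantWeights (E : Finset (D.Root Q → ℕ)) : Finset (D.Basis → ℤ) := by
  classical
  exact ((E ×ˢ D.weyl).image fun x : (D.Root Q → ℕ) × Equiv.Perm D.Basis =>
    D.shiftedWeight Q μ x.1 ∘ ⇑x.2⁻¹ - D.rho).filter D.IsDominant

variable {Q μ}

theorem mem_dominantWeights {E : Finset (D.Root Q → ℕ)} {lam : D.Basis → ℤ}
    (hl : D.IsDominant lam) {w : Equiv.Perm D.Basis} (hw : w ∈ D.weyl) {n : D.Root Q → ℕ}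
    (hn : n ∈ E) (h : (lam + D.rho) ∘ ⇑w = D.shiftedWeight Q μ n) :
    lam ∈ D.dominantWeights Q μ E := by
  classical
  refine Finset.mem_filter.2 ⟨Finset.mem_image.2 ⟨(n, w), Finset.mk_mem_product hn hw, ?_⟩, hl⟩
  ext b
  simp [← h]

theorem isDominant_of_mem_dominantWeights {E : Finset (D.Root Q → ℕ)} {lam : D.Basis → ℤ}
    (h : lam ∈ D.dominantWeights Q μ E) : D.IsDominant lam := by
  classical
  exact (Finset.mem_filter.1 h).2

/-- The coefficient of a monomial, as an additive map. -/
def coeffHom (d : Q₁ →₀ ℕ) : MvPolynomial Q₁ ℤ →+ ℤ :=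
  { toFun := MvPolynomial.coeff d
    map_zero' := MvPolynomial.coeff_zero d
    map_add' := MvPolynomial.coeff_add d }

theorem mem_dominantWeights_of_coeff_ne_zero [DecidableEq (D.Root Q)] {d : Q₁ →₀ ℕ}
    {lam : D.Basis → ℤ} (hl : D.IsDominant lam)
    (h : MvPolynomial.coeff d (D.kostkaShoji Q μ lam) ≠ 0) :
    lam ∈ D.dominantWeights Q μ
      (Fintype.piFinset fun _ : D.Root Q => Finset.range (d.degree + 1)) := by
  obtain ⟨w, hw, n, hn, h⟩ := D.exists_of_map_kostkaShoji_ne_zero (coeffHom d) h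
  refine D.mem_dominantWeights hl hw (Fintype.mem_piFinset.2 fun α => Finset.mem_range.2 ?_) hn
  exact Nat.lt_succ_of_le (D.le_degree_of_coeff_rootMonomial_ne_zero h α)

theorem finite_coeff_kostkaShoji_ne_zero (d : Q₁ →₀ ℕ) :
    {lam : D.Basis → ℤ | D.IsDominant lam ∧
      MvPolynomial.coeff d (D.kostkaShoji Q μ lam) ≠ 0}.Finite := by
  classical
  exact (Finset.finite_toSet _).subset fun lam h =>
    D.mem_dominantWeights_of_coeff_ne_zero h.1 h.2

theorem coeff_hlSeries (d : Q₁ →₀ ℕ) :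
    MvPowerSeries.coeff d (D.hlSeries Q μ) =
      D.demazure (D.xpow (D.concat μ) * MvPowerSeries.coeff d (D.rootSeries Q)) := rfl

theorem coeff_hlSeries_eq_finsum (d : Q₁ →₀ ℕ) :
    MvPowerSeries.coeff d (D.hlSeries Q μ) =
      ∑ᶠ (lam : D.Basis → ℤ) (_ : D.IsDominant lam),
        MvPolynomial.coeff d (D.kostkaShoji Q μ lam) • D.schurChar lam := by
  classical
  set E := Fintype.piFinset fun _ : D.Root Q => Finset.range (d.degree + 1) with hE
  rw [finsum_cond_eq_sum_of_cond_iff (t := D.dominantWeights Q μ E) _ fun {lam} h =>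
    ⟨fun hl => D.mem_dominantWeights_of_coeff_ne_zero hl (left_ne_zero_of_smul h),
      D.isDominant_of_mem_dominantWeights⟩]
  -- After multiplication by J(x^ρ) both sides are combinations of alternants, to which
  -- straightening applies.
  refine mul_left_cancel₀ D.antisym_rho_ne_zero ?_
  have h1 : D.antisym (D.xpow D.rho *
      (D.xpow (D.concat μ) * MvPowerSeries.coeff d (D.rootSeries Q))) =
      ∑ n ∈ E, coeffHom d (D.rootMonomial Q n) •
        alternatingSum D.antisymTerm (D.shiftedWeight Q μ n) := by
    rw [coeff_rootSeries, Finset.mul_sum, Finset.mul_sum, ← antisymHom_apply, map_sum]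
    refine Finset.sum_congr rfl fun n _ => ?_
    rw [mul_smul_comm, mul_smul_comm, map_zsmul, antisymHom_apply, xpow_mul_xpow, xpow_mul_xpow,
      antisym_xpow, ← add_assoc, add_comm D.rho]
    rfl
  have h2 : ∀ lam, D.antisym (D.xpow D.rho) * MvPolynomial.coeff d (D.kostkaShoji Q μ lam) •
      D.schurChar lam = coeffHom d (D.kostkaShoji Q μ lam) •
        alternatingSum D.antisymTerm (lam + D.rho) := by
    intro lam
    rw [mul_smul_comm, antisym_mul_schurChar]
    rfl
  rw [coeff_hlSeries, antisym_mul_demazure, h1, Finset.mul_sum,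
    Finset.sum_congr rfl fun lam _ => h2 lam]
  refine D.sum_smul_alternatingSum (fun g v hv w => D.antisymTerm_comp g hv w) (coeffHom d) E _
    (fun lam h => D.isDominant_of_mem_dominantWeights h) ?_ ?_
  · exact fun _ _ _ _ n _ h => Fintype.mem_piFinset.2 fun α => Finset.mem_range.2 <|
      Nat.lt_succ_of_le (D.le_degree_of_coeff_rootMonomial_ne_zero h α)
  · exact fun n hn lam hl w hw h _ => D.mem_dominantWeights hl hw hn h

end CurrentSeq

end

/-! ### Tuples of partitions as dominant weights -/

section

theorem card_eq_sum_rowLen (lam : YoungDiagram) {n : ℕ} (hn : lam.colLen 0 ≤ n) :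
    lam.card = ∑ p : Fin n, lam.rowLen p := by
  have h : Set.MapsTo Prod.fst (lam.cells : Set (ℕ × ℕ)) (Finset.range n : Finset ℕ) := by
    intro c hc
    have h1 : (c.1, 0) ∈ lam := lam.up_left_mem le_rfl (Nat.zero_le c.2) hc
    exact Finset.mem_coe.2 (Finset.mem_range.2 ((YoungDiagram.mem_iff_lt_colLen.1 h1).trans_le hn))
  rw [Fin.sum_univ_eq_sum_range fun p => lam.rowLen p]
  refine (Finset.card_eq_sum_card_fiberwise h).trans (Finset.sum_congr rfl fun p _ => ?_)
  rw [YoungDiagram.rowLen_eq_card]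
  rfl

theorem eq_of_rowLen_eq {lam lam' : YoungDiagram} (h : ∀ p, lam.rowLen p = lam'.rowLen p) :
    lam = lam' := by
  ext ⟨p, q⟩
  rw [YoungDiagram.mem_cells, YoungDiagram.mem_cells, YoungDiagram.mem_iff_lt_rowLen, h,
    ← YoungDiagram.mem_iff_lt_rowLen]

/-- A partition with prescribed rows. -/
theorem exists_rowLen_eq {n : ℕ} {f : Fin n → ℕ} (hf : Antitone f) :
    ∃ lam : YoungDiagram, lam.colLen 0 ≤ n ∧ ∀ p : Fin n, lam.rowLen p = f p := by
  refine ⟨YoungDiagram.ofRowLens (List.ofFn f) (List.sortedGE_ofFn_iff.2 hf), ?_, fun p => ?_⟩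
  · by_contra h
    have h1 := YoungDiagram.mem_iff_lt_colLen.2 (not_le.1 h)
    obtain ⟨h2, _⟩ := YoungDiagram.mem_ofRowLens.1 h1
    simp at h2
  · have h := YoungDiagram.rowLen_ofRowLens (hw := List.sortedGE_ofFn_iff.2 hf)
      ⟨p, by simp⟩
    simpa using h

namespace CurrentSeq

variable {Q₀ Q₁ : Type*} [DecidableEq Q₀] (D : CurrentSeq Q₀)

/-! ### Partitions as weights -/

theorem isDominant_partitionWeight (lam : Q₀ → YoungDiagram) :
    D.IsDominant (D.partitionWeight lam) := by
  intro b b' hv hb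
  rw [partitionWeight, partitionWeight, ← hv]
  exact_mod_cast (lam (D.vtx b)).rowLen_anti _ _ (D.row_lt_row hv hb).le

theorem sum_partitionWeight [Fintype Q₀] {lam : Q₀ → YoungDiagram}
    (hl : ∀ i, (lam i).colLen 0 ≤ D.dim i) :
    ∑ b, D.partitionWeight lam b = ∑ i, ((lam i).card : ℤ) := by
  rw [sum_letter]
  refine Finset.sum_congr rfl fun i _ => ?_
  rw [card_eq_sum_rowLen _ (hl i)]
  push_cast
  exact Finset.sum_congr rfl fun p _ => D.partitionWeight_letter lam i p

theorem partitionWeight_injOn :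
    Set.InjOn D.partitionWeight {lam | ∀ i, (lam i).colLen 0 ≤ D.dim i} := by
  intro lam hl lam' hl' h
  funext i
  refine eq_of_rowLen_eq fun p => ?_
  by_cases hp : p < D.dim i
  · have := congr_fun h (D.letter i ⟨p, hp⟩)
    rw [partitionWeight_letter, partitionWeight_letter] at this
    exact_mod_cast this
  · rw [rowLen_eq_zero ((hl i).trans (not_lt.1 hp)), rowLen_eq_zero ((hl' i).trans (not_lt.1 hp))]

theorem exists_partitionWeight_eq {g : D.Basis → ℤ} (hg : D.IsDominant g) (h0 : ∀ b, 0 ≤ g b) :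
    ∃ lam : Q₀ → YoungDiagram, (∀ i, (lam i).colLen 0 ≤ D.dim i) ∧ D.partitionWeight lam = g := by
  have hanti : ∀ i, Antitone fun p => (g (D.letter i p)).toNat := by
    intro i p q hpq
    rcases hpq.eq_or_lt with rfl | hpq
    · exact le_rfl
    · exact Int.toNat_le_toNat
        (hg _ _ (by rw [vtx_letter, vtx_letter]) (D.before_letter.2 hpq))
  choose lam hl hrow using fun i => exists_rowLen_eq (hanti i)
  refine ⟨lam, hl, funext fun b => ?_⟩
  obtain ⟨p, hp⟩ := D.exists_letter (rfl : D.vtx b = D.vtx b)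
  rw [← hp, partitionWeight_letter, hrow, Int.toNat_of_nonneg (h0 _)]

/-- A tuple is determined by its weight, whose entries are nonnegative and at most the total size s.
-/
theorem finite_partitions_of_card [Fintype Q₀] (s : ℤ) :
    {lam : Q₀ → YoungDiagram | (∀ i, (lam i).colLen 0 ≤ D.dim i) ∧
      s = ∑ i, ((lam i).card : ℤ)}.Finite := by
  classical
  refine Set.Finite.of_injOn (f := D.partitionWeight) (t := Set.Icc 0 fun _ => s) ?_
    (D.partitionWeight_injOn.mono fun lam h => h.1) (Set.finite_Icc _ _)
  intro lam hl
  have h0 : ∀ b, 0 ≤ D.partitionWeight lam b := fun b => Int.natCast_nonneg _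
  refine ⟨h0, fun b => ?_⟩
  rw [hl.2, ← D.sum_partitionWeight hl.1]
  exact Finset.single_le_sum (fun b _ => h0 b) (Finset.mem_univ b)

/-! ### The tensor Schur expansion -/

section Expansion

variable [Fintype Q₁] {Q : QuiverData Q₀ Q₁} {μ : ∀ k, Fin (D.size k) → ℤ}

theorem sum_rootWeight (α : D.Root Q) : ∑ b, D.rootWeight α b = 0 := by
  simp [rootWeight]

/-- Roots have coordinate sum 0 and permutations preserve it, so ρ cancels. This is the homogeneity
of the expansion. -/
theorem sum_eq_of_comp_eq_shiftedWeight {g : D.Basis → ℤ} {w : Equiv.Perm D.Basis}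
    {n : D.Root Q → ℕ} (h : (g + D.rho) ∘ ⇑w = D.shiftedWeight Q μ n) :
    ∑ b, g b = ∑ k, ∑ p, μ k p := by
  have h1 : ∑ b, ((g + D.rho) ∘ ⇑w) b = ∑ b, (g + D.rho) b := Equiv.sum_comp w (g + D.rho)
  have h2 : ∑ b, (∑ α, n α • D.rootWeight α) b = 0 := by
    simp only [Finset.sum_apply, Pi.smul_apply]
    rw [Finset.sum_comm]
    refine Finset.sum_eq_zero fun α _ => ?_
    rw [← Finset.smul_sum, sum_rootWeight, smul_zero]
  have h3 : ∑ b, D.concat μ b = ∑ k, ∑ p, μ k p := Fintype.sum_sigma _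
  rw [h] at h1
  simp only [shiftedWeight, Pi.add_apply, Finset.sum_add_distrib] at h1
  linarith

theorem sum_eq_card_of_kostkaShoji_ne_zero [Fintype Q₀] {lam : Q₀ → YoungDiagram}
    (hl : ∀ i, (lam i).colLen 0 ≤ D.dim i)
    (h : D.kostkaShoji Q μ (D.partitionWeight lam) ≠ 0) :
    ∑ k, ∑ p, μ k p = ∑ i, ((lam i).card : ℤ) := by
  obtain ⟨w, _, n, hn, _⟩ := D.exists_of_map_kostkaShoji_ne_zero (AddMonoidHom.id _) h
  rw [← D.sum_eq_of_comp_eq_shiftedWeight hn, sum_partitionWeight D hl]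

theorem toArrowRing_rootMonomial (n : D.Root Q → ℕ) :
    toArrowRing (D.rootMonomial Q n) = ∏ α, arrowVar α.1.1 ^ n α := by
  simp [toArrowRing, rootMonomial]

variable (Q μ) in
-- The monomial x^{ρ - ρ∘w} of the Weyl denominator, shifted by μ and the chosen roots, is the w-th
-- term of a Jacobi-Trudi determinant.
theorem exists_hallLittlewood_eq_sum [Fintype Q₀] [DecidableEq (D.Root Q)] :
    ∃ M, ∀ N, M ≤ N → D.hallLittlewood Q μ =
      ∑ n ∈ Fintype.piFinset fun _ : D.Root Q => Finset.range N,
        toArrowRing (D.rootMonomial Q n) •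
          alternatingSum (D.jacobiTrudiTerm (ArrowRing Q₁)) (D.shiftedWeight Q μ n) := by
  obtain ⟨M, hM⟩ := D.exists_hallLittlewood_eq_hEval Q μ
  refine ⟨M, fun N hN => ?_⟩
  rw [hM (fun _ => N) fun _ => hN, pairDenominator_eq_sum, Finset.mul_sum, Finset.sum_mul, map_sum]
  have h1 : ∀ w : Equiv.Perm D.Basis, hEval (R := ArrowRing Q₁) D.vtx
      (AddMonoidAlgebra.single (D.concat μ) 1 * (Equiv.Perm.sign w : ℤ) •
        AddMonoidAlgebra.single (D.rho - D.rho ∘ ⇑w) 1 * D.rootGeom Q fun _ => N) =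
      ∑ n ∈ Fintype.piFinset fun _ : D.Root Q => Finset.range N,
        (Equiv.Perm.sign w : ℤ) • toArrowRing (D.rootMonomial Q n) •
          D.jacobiTrudiTerm (ArrowRing Q₁) (D.shiftedWeight Q μ n) w := by
    intro w
    rw [mul_smul_comm, smul_mul_assoc, map_zsmul, AddMonoidAlgebra.single_mul_single, one_mul,
      hEval_single_mul_rootGeom, Finset.smul_sum]
    refine Finset.sum_congr rfl fun n _ => ?_
    rw [toArrowRing_rootMonomial, jacobiTrudiTerm, shiftedWeight]
    congr 3
    abel
  rw [Finset.sum_congr rfl fun w _ => h1 w, Finset.sum_comm]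
  refine Finset.sum_congr rfl fun n _ => ?_
  rw [alternatingSum, Finset.smul_sum]
  exact Finset.sum_congr rfl fun w _ => smul_comm _ _ _

theorem hallLittlewood_eq_finsum [Fintype Q₀] :
    D.hallLittlewood Q μ =
      ∑ᶠ (lam : Q₀ → YoungDiagram) (_ : ∀ i, (lam i).colLen 0 ≤ D.dim i),
        toArrowRing (D.kostkaShoji Q μ (D.partitionWeight lam)) • tensorSchur lam := by
  classical
  obtain ⟨M, hM⟩ := exists_hallLittlewood_eq_sum D Q μ
  have hfin := D.finite_partitions_of_card (∑ k, ∑ p, μ k p)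
  let L := hfin.toFinset.image D.partitionWeight
  have hL : ∀ g ∈ L, D.IsDominant g := by
    intro g hg
    obtain ⟨lam, _, rfl⟩ := Finset.mem_image.1 hg
    exact D.isDominant_partitionWeight lam
  let F : Finset (D.Root Q → ℕ) := L.biUnion fun g => D.weyl.biUnion fun w =>
    (D.finite_kostantPartitions Q
      (fun b => (g + D.rho) (w b) - (D.concat μ + D.rho) b)).toFinset
  -- The order exceeds every multiplicity of every Kostant partition entering the finitely many
  -- relevant coefficients.
  let N := M + (F.sup fun n => ∑ α, n α) + 1
  rw [finsum_cond_eq_sum_of_cond_iff (t := hfin.toFinset) _ ?_, hM N (by omega)]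
  · refine Eq.trans (D.sum_smul_alternatingSum (fun g v hv w => D.jacobiTrudiTerm_comp g hv w)
      (toArrowRing (Q₁ := Q₁)).toRingHom.toAddMonoidHom _ L hL ?_ ?_) ?_
    · intro g hg w hw n hn _
      refine Fintype.mem_piFinset.2 fun α => Finset.mem_range.2 ?_
      have hF : n ∈ F := Finset.mem_biUnion.2 ⟨g, hg, Finset.mem_biUnion.2 ⟨w, hw,
        (Set.Finite.mem_toFinset _).2 (D.mem_kostantPartitions_iff.2 hn)⟩⟩
      have h1 : ∑ α, n α ≤ F.sup fun n => ∑ α, n α := Finset.le_sup (f := fun n => ∑ α, n α) hF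
      have h2 : n α ≤ ∑ α, n α :=
        Finset.single_le_sum (fun _ _ => Nat.zero_le _) (Finset.mem_univ α)
      omega
    · intro n _ g hg w _ hgn hne
      -- A dominant weight with nonzero determinant has no negative entry, so it comes from
      -- partitions, whose total size is forced by the degree.
      obtain ⟨lam, hl, rfl⟩ := D.exists_partitionWeight_eq hg fun b => by
        by_contra hb
        exact hne (D.alternatingSum_eq_zero_of_neg hg (not_le.1 hb))
      refine Finset.mem_image.2 ⟨lam, (Set.Finite.mem_toFinset _).2 ⟨hl, ?_⟩, rfl⟩
      rw [← D.sum_eq_of_comp_eq_shiftedWeight hgn, sum_partitionWeight D hl]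
    · rw [Finset.sum_image fun lam h lam' h' => D.partitionWeight_injOn
        ((Set.Finite.mem_toFinset _).1 h).1 ((Set.Finite.mem_toFinset _).1 h').1]
      refine Finset.sum_congr rfl fun lam h => ?_
      rw [D.alternatingSum_partitionWeight ((Set.Finite.mem_toFinset _).1 h).1]
      rfl
  · intro lam h
    rw [Set.Finite.mem_toFinset]
    have hne : D.kostkaShoji Q μ (D.partitionWeight lam) ≠ 0 := fun h0 => h (by
      rw [h0, map_zero, zero_smul])
    exact ⟨fun hl => ⟨hl, D.sum_eq_card_of_kostkaShoji_ne_zero hl hne⟩, fun h => h.1⟩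

end Expansion

end CurrentSeq

end

end QuiverHL

end

theorem theorem3p1 {Q₀ Q₁ : Type*} [Fintype Q₀] [DecidableEq Q₀] [Fintype Q₁]
    (Q : QuiverHL.QuiverData Q₀ Q₁) (D : QuiverHL.CurrentSeq Q₀)
    (μ : ∀ k, Fin (D.size k) → ℤ) (hμ : ∀ k, Antitone (μ k)) :
    -- the sum below is finite, since its terms vanish for degree reasons
    {lam : Q₀ → YoungDiagram | (∀ i, (lam i).colLen 0 ≤ D.dim i) ∧
      D.kostkaShoji Q μ (D.partitionWeight lam) ≠ 0}.Finite ∧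
    (∀ lam : Q₀ → YoungDiagram, (∀ i, (lam i).colLen 0 ≤ D.dim i) →
      D.kostkaShoji Q μ (D.partitionWeight lam) ≠ 0 →
        ∑ k, ∑ p, μ k p = ∑ i, ((lam i).card : ℤ)) ∧
    -- the tensor Schur expansion of the quiver Hall-Littlewood symmetric function
    D.hallLittlewood Q μ =
      ∑ᶠ (lam : Q₀ → YoungDiagram) (_ : ∀ i, (lam i).colLen 0 ≤ D.dim i),
        QuiverHL.toArrowRing (D.kostkaShoji Q μ (D.partitionWeight lam)) •
          QuiverHL.tensorSchur lam ∧
    -- the same polynomials are the coefficients of the quiver Hall-Littlewood series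
    ∀ d : Q₁ →₀ ℕ,
      D.antisym (D.xpow D.rho) * MvPowerSeries.coeff d (D.hlSeries Q μ) =
        D.antisym (D.xpow D.rho *
          (D.xpow (D.concat μ) * MvPowerSeries.coeff d (D.rootSeries Q))) ∧
      {lam : D.Basis → ℤ | D.IsDominant lam ∧
        MvPolynomial.coeff d (D.kostkaShoji Q μ lam) ≠ 0}.Finite ∧
      MvPowerSeries.coeff d (D.hlSeries Q μ) =
        ∑ᶠ (lam : D.Basis → ℤ) (_ : D.IsDominant lam),
          MvPolynomial.coeff d (D.kostkaShoji Q μ lam) • D.schurChar lam := by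
  have hsum : ∀ lam : Q₀ → YoungDiagram, (∀ i, (lam i).colLen 0 ≤ D.dim i) →
      D.kostkaShoji Q μ (D.partitionWeight lam) ≠ 0 →
        ∑ k, ∑ p, μ k p = ∑ i, ((lam i).card : ℤ) :=
    fun _ hl h => D.sum_eq_card_of_kostkaShoji_ne_zero hl h
  exact ⟨(D.finite_partitions_of_card _).subset fun lam h => ⟨h.1, hsum lam h.1 h.2⟩, hsum,
    D.hallLittlewood_eq_finsum, fun d => ⟨D.antisym_mul_demazure _,
      D.finite_coeff_kostkaShoji_ne_zero d, D.coeff_hlSeries_eq_finsum d⟩⟩
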